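/- **Model.** A MapReduce cluster for graphs on $n$ vertices has $M$ machines, each with space for $S$ words of $O(\log n)$ bits. The computation proceeds in synchronous rounds. In each round every machine reads the words it has received (at most $S$), runs a randomized program for a number of steps polynomial in $n$, using at most $S$ words of working memory, and emits key-value pairs (at most $S$), whose key is the index of a machine; at the end of the round each value is delivered to the machine given by its key, and these received words are all that is carried over to the next round. If a machine exceeds its limits, the computation fails. An algorithm is a finite list of programs, one per round, which does not depend on the graph or on $n$ (a program may read $n$, $M$ and the index of its machine); its number of rounds is the length of the list. **Theorem (MIS2).** (1) There is an absolute constant $C_0$ such that for every fixed $\mu>0$ there are constants $C$, $K$ (depending only on $\mu$) such that for every $c$ with $\mu<c\le 1$ there is a MapReduce algorithm with at most $C_0\,c/\mu$ rounds with the following property. Run it on $M=\lceil n^{c-\mu}\rceil$ machines with $S = C\lceil n^{1+\mu}\rceil = O(n^{1+\mu})$ words of space each, words being numbers below $(n+2)^K$ and the number of steps of a machine in a round being at most $(n+2)^K$. Then for every $n$-vertex graph $G$ with at most $n^{1+c}$ edges, and every distribution of the edges of $G$ over the machines with at most $\lceil n^{1+\mu}\rceil$ edges per machine, the algorithm outputs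 a maximal independent set of $G$ with high probability. Here and below, "with high probability" means: for every $d$, the probability is at least $1-n^{-d}$ for all $n\ge n_0$, where $n_0$ depends only on $\mu$ and $d$. (2) For a graph $G=(V,E)$ with $n$ vertices and $I\subseteq V$ let $N^+(I)$ consist of $I$ and all neighbours of vertices in $I$, let $d_I(v)$ be the number of neighbours of $v$ outside $N^+(I)$ if $v\notin N^+(I)$ and $d_I(v)=0$ otherwise, and let $E_I$ be the set of edges of $G$ both of whose endpoints have $d_I>0$. Fix $\mu>0$ and put $\alpha=\mu/8$. One hungry-greedy iteration from an independent set $I$ does the following. For each $i=1,\dots,\lceil 1/\alpha\rceil$ it draws $\lceil n^{(i+1)\alpha}\rceil$ groups of $\lceil n^{\mu/2}\rceil$ independent uniformly random vertices from the degree class $\{v: n^{1-i\alpha}\le d_I(v)<n^{1-(i-1)\alpha}\}$ (no groups if the class is empty). Then, with $J=I$ initially, for $i=1,\dots,\lceil 1/\alpha\rceil$ and for each group of class $i$ in turn, if the group contains a vertex $v$ with $d_J(v)\ge n^{1-(i+1)\alpha}$, one such vertex (chosen by an arbitrary selection rule) is added to $J$. For every $n$-vertex graph $G$, every selection rule and every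 independent set $I$, the resulting set $J$ contains $I$, is independent, and satisfies $$|E_J|\le \frac{2\,|E_I|}{n^{\mu/8}}$$ with high probability. -/

import Mathlib

open scoped ENNReal

noncomputable section

namespace MapReduce

/-! ### Local computation: randomized word programs with a step count -/

/-- Binary operations on natural numbers; `lt` and `eq` return `1` for true and `0` for false. -/
inductive Op
  | add | sub | mul | div | mod | lt | eq

/-- The value of a binary operation (`sub` is truncated, division by `0` gives `0`). -/
def Op.eval : Op → ℕ → ℕ → ℕ
  | .add, a, b => a + b
  | .sub, a, b => a - b
  | .mul, a, b => a * b
  | .div, a, b => a / b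
  | .mod, a, b => a % b
  | .lt, a, b => if a < b then 1 else 0
  | .eq, a, b => if a = b then 1 else 0

/-- Expressions of a machine's program. A program can refer to constants, to the number `n` of
vertices, to the number of machines, to the index of the machine that runs it, to its inbox (a
read-only list of words) and to its working memory. -/
inductive Exp
  | const (k : ℕ)
  | numVerts
  | numMachines
  | self
  | inboxLen
  | inbox (pos : Exp)
  | mem (addr : Exp)
  | op (o : Op) (a b : Exp)

/-- Programs. `store a e` writes the value of `e` at address `a`; `rand a b` writes a uniformly
random element of `{0, …, b - 1}` at address `a`; `send d e` emits the message (key-value pair)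
with key (destination machine) `d` and value `e`; `loop x b p` runs `p` once for each
`i = 0, …, b - 1`, with `i` written at address `x` before the pass; the bound `b` is evaluated
once, on entry. -/
inductive Prog
  | skip
  | store (addr val : Exp)
  | rand (addr bound : Exp)
  | send (dest val : Exp)
  | seq (p q : Prog)
  | ite (test : Exp) (p q : Prog)
  | loop (ctr : ℕ) (bound : Exp) (body : Prog)

/-- Parameters of a cluster: number of vertices of the input graph, number of machines, space per
machine (in words), word range (a word is a natural number below `wordBound`), and the maximum
number of steps that a machine may make within one round. -/
structure Cluster where
  verts : ℕ
  machines : ℕ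
  space : ℕ
  wordBound : ℕ
  steps : ℕ

/-- The state of one machine inside a round: working memory, messages emitted so far (key and
value), and number of steps made so far. -/
structure Local where
  mem : ℕ → ℕ
  out : List (ℕ × ℕ)
  time : ℕ

/-- At the start of a round the working memory is blank: nothing but the inbox is carried over
from the previous round. -/
def Local.init : Local := ⟨fun _ => 0, [], 0⟩

/-- The machine has `space` memory cells; a write to any other address has no effect. A stored
value is truncated to a word. -/
def Local.write (P : Cluster) (s : Local) (addr val : ℕ) : Local :=
  if addr < P.space then
    { s with mem := Function.update s.mem addr (val % P.wordBound) }
  else s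

def Local.emit (P : Cluster) (s : Local) (dest val : ℕ) : Local :=
  { s with out := s.out ++ [(dest, val % P.wordBound)] }

def Local.tick (s : Local) (k : ℕ) : Local := { s with time := s.time + k }

/-- Number of nodes of an expression, which is also the number of steps of its evaluation. -/
def Exp.cost : Exp → ℕ
  | .const _ => 1
  | .numVerts => 1
  | .numMachines => 1
  | .self => 1
  | .inboxLen => 1
  | .inbox a => a.cost + 1
  | .mem a => a.cost + 1
  | .op _ a b => a.cost + b.cost + 1

/-- The value of an expression on machine `me` with inbox `inb`. Reading beyond the end of the
inbox gives `0`. -/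
def Exp.eval (P : Cluster) (me : ℕ) (inb : List ℕ) (s : Local) : Exp → ℕ
  | .const k => k
  | .numVerts => P.verts
  | .numMachines => P.machines
  | .self => me
  | .inboxLen => inb.length
  | .inbox a => inb.getD (a.eval P me inb s) 0
  | .mem a => s.mem (a.eval P me inb s)
  | .op o a b => o.eval (a.eval P me inb s) (b.eval P me inb s)

/-- Uniform distribution on `{0, …, b - 1}`, and the point mass at `0` if `b = 0`. -/
def uniformBelow (b : ℕ) : PMF ℕ :=
  PMF.uniformOfFinset (Finset.range (max b 1)) ⟨0, by simp⟩

/-- Random iteration: apply `f 0`, then `f 1`, …, then `f (k - 1)`. -/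
def iterate {σ : Type} (f : ℕ → σ → PMF σ) : ℕ → σ → PMF σ
  | 0, s => PMF.pure s
  | k + 1, s => (iterate f k s).bind (f k)

/-- Execution of a program on machine `me` with inbox `inb`: the law of the final local state.
Each command costs one step plus the evaluation of its expressions, and each pass of a loop costs
one further step. -/
def Prog.exec (P : Cluster) (me : ℕ) (inb : List ℕ) : Prog → Local → PMF Local
  | .skip, s => PMF.pure (s.tick 1)
  | .store a e, s =>
      PMF.pure ((s.write P (a.eval P me inb s) (e.eval P me inb s)).tick (a.cost + e.cost + 1))
  | .rand a b, s =>
      (uniformBelow (b.eval P me inb s)).map fun r =>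
        (s.write P (a.eval P me inb s) r).tick (a.cost + b.cost + 1)
  | .send d e, s =>
      PMF.pure ((s.emit P (d.eval P me inb s) (e.eval P me inb s)).tick (d.cost + e.cost + 1))
  | .seq p q, s => (p.exec P me inb s).bind (q.exec P me inb)
  | .ite t p q, s =>
      if t.eval P me inb s ≠ 0 then p.exec P me inb (s.tick (t.cost + 1))
      else q.exec P me inb (s.tick (t.cost + 1))
  | .loop x b p, s =>
      iterate (fun i s' => p.exec P me inb ((s'.write P x i).tick 1)) (b.eval P me inb s)
        (s.tick (b.cost + 1))

/-! ### Rounds -/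

/-- Between two rounds, the state of the cluster consists of the inboxes of its machines. -/
abbrev Config (P : Cluster) : Type := Fin P.machines → List ℕ

/-- Independent samples from a list of distributions. -/
def sampleAll {α : Type} : List (PMF α) → PMF (List α)
  | [] => PMF.pure []
  | p :: ps => p.bind fun x => (sampleAll ps).map fun xs => x :: xs

/-- The next inboxes, from the final local states of the machines (listed by index): machine `j`
receives the values of all messages with key `j`. -/
def deliver (P : Cluster) (ls : List Local) : Config P := fun j =>
  ls.flatMap fun s => (s.out.filter fun m => m.1 = (j : ℕ)).map Prod.snd

open Classical in
/-- Communication at the end of a round. The computation crashes (`none`) if some machine has made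
more steps than allowed, has emitted more words than its space, or receives more words than its
space. -/
def shuffle (P : Cluster) (ls : List Local) : Option (Config P) :=
  if (∀ s ∈ ls, s.time ≤ P.steps ∧ s.out.length ≤ P.space) ∧
      ∀ j, (deliver P ls j).length ≤ P.space then
    some (deliver P ls)
  else none

/-- One round: all machines run the program `p` on their inboxes, with independent randomness, and
the messages are delivered. -/
def round (P : Cluster) (p : Prog) (cfg : Config P) : PMF (Option (Config P)) :=
  (sampleAll ((List.finRange P.machines).map fun j : Fin P.machines =>
    p.exec P (j : ℕ) (cfg j) Local.init)).map (shuffle P)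

/-- A MapReduce algorithm is the list of the programs of its rounds; its number of rounds is the
length of the list. -/
abbrev Algorithm : Type := List Prog

/-- The law of the final configuration (`none` if the computation has crashed). -/
def run (P : Cluster) : Algorithm → Config P → PMF (Option (Config P))
  | [], cfg => PMF.pure (some cfg)
  | p :: ps, cfg => (round P p cfg).bind fun r =>
      match r with
      | none => PMF.pure none
      | some cfg' => run P ps cfg'

/-! ### Graph input and output -/

/-- `place` distributes the edges of `G` over `M` machines: each edge lies on exactly one machine,
once, written as an ordered pair in one of the two ways, and no machine holds more than `cap`
edges. -/
def IsPlacement {n M : ℕ} (G : SimpleGraph (Fin n)) (cap : ℕ)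
    (place : Fin M → List (Fin n × Fin n)) : Prop :=
  (∀ j, (place j).length ≤ cap) ∧
  (((List.ofFn place).flatten.map fun p => s(p.1, p.2)).Nodup) ∧
  ∀ e : Sym2 (Fin n), e ∈ (List.ofFn place).flatten.map (fun p => s(p.1, p.2)) ↔ e ∈ G.edgeSet

/-- The initial configuration: the edge `(u, v)` is stored as the word `u * n + v`. -/
def inputConfig (P : Cluster) (place : Fin P.machines → List (Fin P.verts × Fin P.verts)) :
    Config P :=
  fun j => (place j).map fun p => (p.1 : ℕ) * P.verts + (p.2 : ℕ)

/-- The set of vertices that a final configuration lists. -/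
def outputSet (P : Cluster) (cfg : Config P) : Set (Fin P.verts) :=
  {v | ∃ j, (v : ℕ) ∈ cfg j}

/-- The event that the computation does not crash and outputs a maximal independent set of `G`. -/
def FindsMIS (P : Cluster) (G : SimpleGraph (Fin P.verts)) : Set (Option (Config P)) :=
  {r | ∃ cfg, r = some cfg ∧ Maximal G.IsIndepSet (outputSet P cfg)}

/-- The cluster for graphs with `n` vertices and `n ^ (1 + c)` edges: `⌈n ^ (c - μ)⌉` machines, each
with `C * ⌈n ^ (1 + μ)⌉` words of space; words are numbers below `(n + 2) ^ K`, that is, they have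
`O(log n)` bits; each machine may make at most `(n + 2) ^ K` steps in each round. -/
def cluster (n : ℕ) (c μ : ℝ) (C K : ℕ) : Cluster where
  verts := n
  machines := ⌈(n : ℝ) ^ (c - μ)⌉₊
  space := C * ⌈(n : ℝ) ^ (1 + μ)⌉₊
  wordBound := (n + 2) ^ K
  steps := (n + 2) ^ K

end MapReduce

/-! ### The hungry-greedy iteration -/

namespace HungryGreedy

variable {n : ℕ}

/-- The closed neighbourhood `N⁺(I)`: the vertices of `I` and their neighbours. -/
def closedNbhd (G : SimpleGraph (Fin n)) (I : Finset (Fin n)) : Set (Fin n) :=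
  {v | v ∈ I ∨ ∃ u ∈ I, G.Adj u v}

open Classical in
/-- The residual degree `d_I(v)`: the number of neighbours of `v` outside `N⁺(I)` if `v ∉ N⁺(I)`,
and `0` otherwise. -/
def residualDeg (G : SimpleGraph (Fin n)) (I : Finset (Fin n)) (v : Fin n) : ℕ :=
  if v ∈ closedNbhd G I then 0 else {u | G.Adj v u ∧ u ∉ closedNbhd G I}.ncard

/-- The number of edges of the subgraph induced by the vertices of positive residual degree. -/
def residualEdges (G : SimpleGraph (Fin n)) (I : Finset (Fin n)) : ℕ :=
  {e | e ∈ G.edgeSet ∧ ∀ v ∈ e, 0 < residualDeg G I v}.ncard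

open Classical in
/-- The `i`-th degree class: the vertices `v` with `n ^ (1 - i α) ≤ d_I(v) < n ^ (1 - (i - 1) α)`. -/
def degreeClass (G : SimpleGraph (Fin n)) (α : ℝ) (I : Finset (Fin n)) (i : ℕ) : Finset (Fin n) :=
  {v | (n : ℝ) ^ (1 - i * α) ≤ residualDeg G I v ∧
    (residualDeg G I v : ℝ) < (n : ℝ) ^ (1 - ((i : ℝ) - 1) * α)}

/-- `groups` groups of `size` independent uniform samples from `S` (no group if `S` is empty). -/
def drawGroups (S : Finset (Fin n)) (groups size : ℕ) : PMF (List (List (Fin n))) :=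
  if h : S.Nonempty then
    MapReduce.sampleAll (List.replicate groups
      (MapReduce.sampleAll (List.replicate size (PMF.uniformOfFinset S h))))
  else PMF.pure []

open Classical in
/-- Processing one group of the `i`-th class: if the group contains a vertex `v` with
`d_I(v) ≥ n ^ (1 - (i + 1) α)`, then one such vertex is added to `I`. Which one is decided by the
selection rule `pick`. -/
def addFromGroup (G : SimpleGraph (Fin n)) (α : ℝ) (pick : Finset (Fin n) → Fin n) (i : ℕ)
    (I : Finset (Fin n)) (X : List (Fin n)) : Finset (Fin n) :=
  let heavy := X.toFinset.filter fun v => (n : ℝ) ^ (1 - ((i : ℝ) + 1) * α) ≤ residualDeg G I v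
  if heavy.Nonempty then insert (pick heavy) I else I

/-- Processing all samples, one degree class after the other: `groups` lists the groups of the
classes `i, i + 1, …`. -/
def addFromGroups (G : SimpleGraph (Fin n)) (α : ℝ) (pick : Finset (Fin n) → Fin n) :
    ℕ → List (List (List (Fin n))) → Finset (Fin n) → Finset (Fin n)
  | _, [], I => I
  | i, Xs :: rest, I =>
      addFromGroups G α pick (i + 1) rest (Xs.foldl (addFromGroup G α pick i) I)

/-- One iteration from the independent set `I`, with `α = μ / 8`: for `i = 1, …, ⌈1 / α⌉` draw
`⌈n ^ ((i + 1) α)⌉` groups of `⌈n ^ (μ / 2)⌉` vertices from the `i`-th degree class (with respect to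
the set `I` at the start of the iteration), then process all groups greedily. The result is the
law of the new independent set. -/
def iteration (G : SimpleGraph (Fin n)) (μ : ℝ) (pick : Finset (Fin n) → Fin n)
    (I : Finset (Fin n)) : PMF (Finset (Fin n)) :=
  (MapReduce.sampleAll ((List.range' 1 ⌈8 / μ⌉₊).map fun i =>
    drawGroups (degreeClass G (μ / 8) I i) ⌈(n : ℝ) ^ (((i : ℝ) + 1) * (μ / 8))⌉₊
      ⌈(n : ℝ) ^ (μ / 2)⌉₊)).map
    fun groups => addFromGroups G (μ / 8) pick 1 groups I

end HungryGreedy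

end

/-! Part (1) runs the greedy algorithm on random samples of increasing density. Given an independent
set `J`, call a vertex alive if it lies outside the closed neighbourhood of `J`, and let `D` be the
degree sum of the graph on the alive vertices. A phase samples every vertex with probability `1 /
a`, collects the edges between sampled alive vertices on machine `0`, runs greedy there in vertex
order, and marks the newly dominated vertices. Two estimates carry the argument.

Progress (`toOuterMeasure_aliveDeg_le`): reveal the coins along the greedy run. Whenever an alive
neighbour of an alive vertex `v` comes up, it is sampled with probability `1 / a`, and then `v`
dies. So `v` outlives more than `a * t` such tests with probability at most `exp (-t)`, and after
the phase `D ≤ n * a * t`, however large `D` was before.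

Space (`toOuterMeasure_goodSample_le`): two applications of a Chernoff bound show that the sample
spans at most `4 * D / a ^ 2 + 3 * n * t` ordered adjacent pairs.

Let `a_k` be the `k`-fold rounded-up square root of the number `M` of machines. Since `a_k ≤ a_(k+1)
^ 2`, the degree sum left by phase `k` is small enough for phase `k + 1` to fit on one machine
(`ensures_phases`). The start is covered by `n ^ (1 + c) ≤ n ^ (1 + μ) * M`. With `t = n ^ (μ / 4)`
and `T = ⌈4 c / μ⌉` phases, `a_T ≤ 4 n ^ (μ / 4)`, so everything that is left fits on machine `0`,
where greedy finishes the job.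

A phase takes seven rounds. Machines keep their input edges and a set of marks on vertices, all of
which must be sent again in every round. Marks are broadcast in two rounds: first every mark goes to
one responsible machine, then that machine forwards it to all; this keeps the traffic of a machine
linear in `n`. The programs are verified by a logic `wp` about all possible outcomes, and running
time is bounded separately by `time_exec_le`. The only probabilistic fact about programs is the law
of the sample (`sample_transition`); `Ensures` adds up the failure probabilities.

Part (2). Let `δ = n ^ (-3α)`. While more than a fraction `δ` of class `i` is still heavy, that is,
has residual degree at least `n ^ (1 - (i + 1) α)`, a group of `n ^ (4α)` samples misses the heavy
vertices with probability at most `exp (-n ^ α)`. Each hit dominates more than `n ^ (1 - (i + 1) α)`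
new vertices, so `n ^ ((i + 1) α)` hits would dominate more than `n` vertices. Hence at the end at
most a fraction `δ` of each class is heavy (`card_heavy_foldl`), and this persists, as residual
degrees only decrease. Light vertices have lost a factor `n ^ α` of their degree, and the few heavy
ones contribute little, even summed over all classes (`residualEdges_le`). -/

noncomputable section

/-! ### Expectations and failure probabilities -/

namespace PMF

variable {α β : Type}

/-- The expectation of a nonnegative function. -/
def expect (p : PMF α) (Φ : α → ℝ≥0∞) : ℝ≥0∞ := ∑' x, p x * Φ x

lemma expect_mono (p : PMF α) {Φ Ψ : α → ℝ≥0∞} (h : ∀ x ∈ p.support, Φ x ≤ Ψ x) :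
    p.expect Φ ≤ p.expect Ψ := by
  refine ENNReal.tsum_le_tsum fun x => ?_
  by_cases hx : x ∈ p.support
  · gcongr; exact h x hx
  · simp [(p.apply_eq_zero_iff x).2 hx]

lemma expect_const (p : PMF α) (c : ℝ≥0∞) : (p.expect fun _ => c) = c := by
  simp [expect, ENNReal.tsum_mul_right, p.tsum_coe]

lemma expect_le_of_le (p : PMF α) {Φ : α → ℝ≥0∞} {c : ℝ≥0∞} (h : ∀ x ∈ p.support, Φ x ≤ c) :
    p.expect Φ ≤ c :=
  (p.expect_mono h).trans (p.expect_const c).le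

lemma expect_pure (a : α) (Φ : α → ℝ≥0∞) : (PMF.pure a).expect Φ = Φ a := by
  rw [expect, tsum_eq_single a]
  · simp
  · intro b hb; simp [hb]

lemma expect_bind (p : PMF α) (f : α → PMF β) (Φ : β → ℝ≥0∞) :
    (p.bind f).expect Φ = p.expect fun x => (f x).expect Φ := by
  simp only [expect, bind_apply, ← ENNReal.tsum_mul_right, ← ENNReal.tsum_mul_left]
  rw [ENNReal.tsum_comm]
  simp only [mul_assoc]

lemma expect_map (p : PMF α) (f : α → β) (Φ : β → ℝ≥0∞) :
    (p.map f).expect Φ = p.expect (Φ ∘ f) := by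
  rw [map, expect_bind]
  simp [expect_pure, Function.comp_def]

lemma expect_mul_left (p : PMF α) (c : ℝ≥0∞) (Φ : α → ℝ≥0∞) :
    (p.expect fun x => c * Φ x) = c * p.expect Φ := by
  simp only [expect, ← ENNReal.tsum_mul_left]
  exact tsum_congr fun x => by ring

lemma toOuterMeasure_eq_expect (p : PMF α) (s : Set α) :
    p.toOuterMeasure s = p.expect (s.indicator 1) := by
  rw [toOuterMeasure_apply, expect]
  refine tsum_congr fun x => ?_
  by_cases hx : x ∈ s <;> simp [hx]

/-- Markov's inequality, multiplied out so that no division in `ℝ≥0∞` occurs. -/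
lemma mul_toOuterMeasure_le_expect (p : PMF α) (s : Set α) (c : ℝ≥0∞) {Φ : α → ℝ≥0∞}
    (h : ∀ x ∈ s, c ≤ Φ x) : c * p.toOuterMeasure s ≤ p.expect Φ := by
  rw [toOuterMeasure_eq_expect, ← expect_mul_left]
  refine expect_mono p fun x _ => ?_
  by_cases hx : x ∈ s <;> simp [hx, h]

/-- Union bound for a two-stage experiment: either the first stage falls into `t`, or the second
stage fails with conditional probability at most `ε`. Failure probabilities of successive groups and
successive rounds are added with it. -/
lemma toOuterMeasure_bind_le (p : PMF α) (f : α → PMF β) (t : Set α) (s : Set β) {ε : ℝ≥0∞}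
    (h : ∀ x ∈ p.support, x ∉ t → (f x).toOuterMeasure s ≤ ε) :
    (p.bind f).toOuterMeasure s ≤ p.toOuterMeasure t + ε := by
  classical
  rw [toOuterMeasure_eq_expect, expect_bind, toOuterMeasure_eq_expect]
  have : ∀ x ∈ p.support, (f x).expect (s.indicator 1) ≤ t.indicator 1 x + ε := by
    intro x hx
    by_cases hxt : x ∈ t
    · simp only [hxt, Set.indicator_of_mem, Pi.one_apply]
      refine le_add_right (expect_le_of_le _ fun y _ => ?_)
      by_cases hy : y ∈ s <;> simp [hy]
    · rw [← toOuterMeasure_eq_expect]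
      exact le_add_left (h x hx hxt)
  refine (expect_mono p this).trans ?_
  simp only [expect, mul_add, ENNReal.tsum_add, ENNReal.tsum_mul_right, tsum_coe, one_mul]
  exact le_rfl

lemma toOuterMeasure_add_compl (p : PMF α) (s : Set α) :
    p.toOuterMeasure s + p.toOuterMeasure sᶜ = 1 := by
  rw [toOuterMeasure_apply, toOuterMeasure_apply, ← ENNReal.tsum_add, ← p.tsum_coe]
  exact tsum_congr fun x => congrFun (Set.indicator_self_add_compl s p) x

/-- Converts a failure bound into the success form of the theorem. Intersecting with the support
allows deterministic facts about possible outcomes to be used in the inclusion. -/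
lemma ofReal_one_sub_le (p : PMF α) (s t : Set α) {ε : ℝ} (hε : 0 ≤ ε)
    (hst : sᶜ ∩ p.support ⊆ t) (h : p.toOuterMeasure t ≤ ENNReal.ofReal ε) :
    ENNReal.ofReal (1 - ε) ≤ p.toOuterMeasure s := by
  have h1 := p.toOuterMeasure_add_compl s
  have h2 : p.toOuterMeasure sᶜ ≤ ENNReal.ofReal ε :=
    (p.toOuterMeasure_mono hst).trans h
  rw [ENNReal.ofReal_sub _ hε, ENNReal.ofReal_one, tsub_le_iff_right, ← h1]
  gcongr

lemma toOuterMeasure_union_le (p : PMF α) (s t : Set α) :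
    p.toOuterMeasure (s ∪ t) ≤ p.toOuterMeasure s + p.toOuterMeasure t :=
  MeasureTheory.measure_union_le s t

lemma toOuterMeasure_exists_le {ι : Type} (p : PMF α) (s : Finset ι) (B : ι → α → Prop)
    {ε : ℝ≥0∞} (h : ∀ i ∈ s, p.toOuterMeasure {x | B i x} ≤ ε) :
    p.toOuterMeasure {x | ∃ i ∈ s, B i x} ≤ s.card * ε := by
  have : {x | ∃ i ∈ s, B i x} = ⋃ i ∈ s, {x | B i x} := by ext; simp
  rw [this]
  refine (MeasureTheory.measure_biUnion_finset_le s _).trans ?_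
  exact (Finset.sum_le_sum h).trans (by simp)

lemma map_congr_support (p : PMF α) {f g : α → β} (h : ∀ x ∈ p.support, f x = g x) :
    p.map f = p.map g := by
  ext b
  simp only [map_apply]
  refine tsum_congr fun a => ?_
  by_cases ha : a ∈ p.support
  · rw [h a ha]
  · simp [(p.apply_eq_zero_iff a).2 ha]

lemma bind_congr_support (p : PMF α) {f g : α → PMF β} (h : ∀ x ∈ p.support, f x = g x) :
    p.bind f = p.bind g := by
  ext b
  simp only [bind_apply]
  refine tsum_congr fun a => ?_
  by_cases ha : a ∈ p.support
  · rw [h a ha]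
  · simp [(p.apply_eq_zero_iff a).2 ha]

end PMF

/-! ### Iterated random maps and independent samples -/

namespace MapReduce

variable {α σ τ : Type}

/-- Optional stopping for iterated random maps: a potential that does not increase in expectation
in any pass does not increase in expectation overall. -/
lemma expect_iterate_le (f : ℕ → σ → PMF σ) (Φ : ℕ → σ → ℝ≥0∞) (k : ℕ)
    (h : ∀ i < k, ∀ s, (f i s).expect (Φ (i + 1)) ≤ Φ i s) (s : σ) :
    (iterate f k s).expect (Φ k) ≤ Φ 0 s := by
  induction k with
  | zero => simp [iterate, PMF.expect_pure]
  | succ k ih =>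
    rw [iterate, PMF.expect_bind]
    exact (PMF.expect_mono _ fun x _ => h k (by omega) x).trans
      (ih fun i hi => h i (by omega))

lemma support_iterate (f : ℕ → σ → PMF σ) (Inv : ℕ → σ → Prop) (k : ℕ)
    (h : ∀ i < k, ∀ s, Inv i s → ∀ s' ∈ (f i s).support, Inv (i + 1) s') (s : σ) (h0 : Inv 0 s) :
    ∀ s' ∈ (iterate f k s).support, Inv k s' := by
  induction k with
  | zero => simp [iterate, h0]
  | succ k ih =>
    intro s' hs'
    rw [iterate, PMF.mem_support_bind_iff] at hs'
    obtain ⟨t, ht, hs'⟩ := hs'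
    exact h k (by omega) t (ih (fun i hi => h i (by omega)) t ht) s' hs'

/-- Projection of an iterated random map. -/
lemma map_iterate (f : ℕ → σ → PMF σ) (f' : ℕ → τ → PMF τ) (π : ℕ → σ → τ)
    (Inv : ℕ → σ → Prop) (k : ℕ)
    (h : ∀ i < k, ∀ s, Inv i s → ∀ s' ∈ (f i s).support, Inv (i + 1) s')
    (hπ : ∀ i < k, ∀ s, Inv i s → (f i s).map (π (i + 1)) = f' i (π i s)) (s : σ) (h0 : Inv 0 s) :
    (iterate f k s).map (π k) = iterate f' k (π 0 s) := by
  induction k with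
  | zero => simp [iterate, PMF.pure_map]
  | succ k ih =>
    rw [iterate, iterate, PMF.map_bind, ← ih (fun i hi => h i (by omega)) fun i hi => hπ i (by omega),
      PMF.bind_map]
    refine PMF.bind_congr_support _ fun t ht => ?_
    exact hπ k (by omega) t (support_iterate f Inv k (fun i hi => h i (by omega)) s h0 t ht)

lemma mem_support_sampleAll {ps : List (PMF α)} {xs : List α} :
    xs ∈ (sampleAll ps).support ↔ List.Forall₂ (fun p x => x ∈ p.support) ps xs := by
  induction ps generalizing xs with
  | nil => simp [sampleAll]
  | cons p ps ih =>
    simp only [sampleAll, PMF.mem_support_bind_iff, PMF.mem_support_map_iff, ih,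
      List.forall₂_cons_left_iff]
    constructor
    · rintro ⟨a, ha, b, hb, rfl⟩; exact ⟨a, b, ha, hb, rfl⟩
    · rintro ⟨a, b, ha, hb, rfl⟩; exact ⟨a, ha, b, hb, rfl⟩

/-- All independent samples lie in `s`. -/
lemma toOuterMeasure_sampleAll_replicate (q : PMF α) (s : Set α) (k : ℕ) :
    (sampleAll (List.replicate k q)).toOuterMeasure {xs | ∀ x ∈ xs, x ∈ s} =
      q.toOuterMeasure s ^ k := by
  induction k with
  | zero => simp [sampleAll]
  | succ k ih =>
    rw [List.replicate_succ, sampleAll, PMF.toOuterMeasure_eq_expect, PMF.expect_bind, pow_succ',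
      ← ih, mul_comm, PMF.toOuterMeasure_eq_expect q, ← PMF.expect_mul_left]
    refine congrArg _ (funext fun x => ?_)
    rw [← PMF.toOuterMeasure_eq_expect, PMF.toOuterMeasure_map_apply]
    by_cases hx : x ∈ s <;> simp [hx]

/-- Some step of the fold of `f` over `xs` is bad. -/
def BadRun (f : σ → α → σ) (B : σ → α → Prop) : σ → List α → Prop
  | _, [] => False
  | s, x :: xs => B s x ∨ BadRun f B (f s x) xs

/-- Union bound for a process that is driven by independent samples: if at every step and in
every state, the next sample is bad with probability at most `ε`, then some step is bad with
probability at most `ε` times the number of steps. -/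
lemma toOuterMeasure_badRun_le (f : σ → α → σ) (B : σ → α → Prop) (Inv : List (PMF α) → σ → Prop)
    {ε : ℝ≥0∞} (hInv : ∀ p ps s x, Inv (p :: ps) s → Inv ps (f s x))
    (h : ∀ p ps s, Inv (p :: ps) s → p.toOuterMeasure {x | B s x} ≤ ε) (ps : List (PMF α)) (s : σ)
    (h0 : Inv ps s) :
    (sampleAll ps).toOuterMeasure {xs | BadRun f B s xs} ≤ ps.length * ε := by
  induction ps generalizing s with
  | nil => simp [sampleAll, BadRun]
  | cons p ps ih =>
    rw [sampleAll]
    refine (PMF.toOuterMeasure_bind_le p _ {x | B s x} _ (ε := ps.length * ε) ?_).trans ?_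
    · intro x _ hx
      rw [PMF.toOuterMeasure_map_apply]
      have : (fun xs => x :: xs) ⁻¹' {xs | BadRun f B s xs} = {xs | BadRun f B (f s x) xs} := by
        ext xs
        simp only [Set.mem_preimage, Set.mem_ofPred_eq, BadRun]
        exact or_iff_right hx
      rw [this]
      exact ih _ (hInv _ _ _ _ h0)
    · rw [List.length_cons, Nat.cast_succ, add_mul, one_mul, add_comm]
      gcongr
      exact h _ _ _ h0

end MapReduce
end

noncomputable section

/-! ### The hungry-greedy iteration -/

namespace HungryGreedy

variable {n : ℕ} (G : SimpleGraph (Fin n))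

lemma closedNbhd_mono {I J : Finset (Fin n)} (h : I ⊆ J) : closedNbhd G I ⊆ closedNbhd G J := by
  rintro v (hv | ⟨u, hu, huv⟩)
  · exact Or.inl (h hv)
  · exact Or.inr ⟨u, h hu, huv⟩

lemma residualDeg_anti {I J : Finset (Fin n)} (h : I ⊆ J) (v : Fin n) :
    residualDeg G J v ≤ residualDeg G I v := by
  unfold residualDeg
  by_cases hJ : v ∈ closedNbhd G J
  · simp [hJ]
  · have hI : v ∉ closedNbhd G I := fun hI => hJ (closedNbhd_mono G h hI)
    simp only [hJ, hI, if_false]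
    exact Set.ncard_le_ncard (fun u hu => ⟨hu.1, fun hI => hu.2 (closedNbhd_mono G h hI)⟩)
      (Set.toFinite _)

lemma notMem_closedNbhd_of_residualDeg_pos {I : Finset (Fin n)} {v : Fin n}
    (h : 0 < residualDeg G I v) : v ∉ closedNbhd G I := by
  intro hv
  simp [residualDeg, hv] at h

lemma isIndepSet_insert {I : Finset (Fin n)} {v : Fin n} (hI : G.IsIndepSet (I : Set (Fin n)))
    (hv : v ∉ closedNbhd G I) : G.IsIndepSet ((insert v I : Finset (Fin n)) : Set (Fin n)) := by
  have h : ∀ u ∈ I, ¬G.Adj u v := fun u hu huv => hv (Or.inr ⟨u, hu, huv⟩)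
  rw [Finset.coe_insert, SimpleGraph.IsIndepSet]
  refine Set.Pairwise.insert hI fun u hu _ => ⟨fun hvu => h u hu hvu.symm, h u hu⟩

/-- The newly dominated vertices include `v` and its residual neighbours. The `+ 1` for `v` itself
makes the later count of hits strict. -/
lemma ncard_compl_closedNbhd_insert {I : Finset (Fin n)} {v : Fin n} (hv : v ∉ closedNbhd G I) :
    (closedNbhd G (insert v I))ᶜ.ncard + (residualDeg G I v + 1) ≤ (closedNbhd G I)ᶜ.ncard := by
  have h1 : residualDeg G I v + 1 = (insert v {u | G.Adj v u ∧ u ∉ closedNbhd G I}).ncard := by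
    rw [Set.ncard_insert_of_notMem (by simp) (Set.toFinite _)]
    simp [residualDeg, hv]
  rw [h1, ← Set.ncard_union_eq _ (Set.toFinite _) (Set.toFinite _)]
  · refine Set.ncard_le_ncard ?_ (Set.toFinite _)
    rintro u (hu | rfl | hu)
    · exact fun h => hu (closedNbhd_mono G (Finset.subset_insert v I) h)
    · exact hv
    · exact hu.2
  · rw [Set.disjoint_right]
    rintro u (rfl | hu) h
    · exact h (Or.inl (by simp))
    · exact h (Or.inr ⟨v, by simp, hu.1⟩)

/-- The sum of the residual degrees is twice the number of residual edges. -/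
lemma sum_residualDeg (I : Finset (Fin n)) :
    ∑ v, residualDeg G I v = 2 * residualEdges G I := by
  classical
  -- The graph on the undominated vertices. Its degrees are the residual degrees, and an edge
  -- between undominated vertices automatically gives both ends positive residual degree, so the
  -- claim is the handshake lemma for `H`.
  let H : SimpleGraph (Fin n) :=
    { Adj := fun u v => G.Adj u v ∧ u ∉ closedNbhd G I ∧ v ∉ closedNbhd G I
      symm := ⟨fun u v h => ⟨h.1.symm, h.2.2, h.2.1⟩⟩
      loopless := ⟨fun u h => G.loopless.irrefl u h.1⟩ }
  have hdeg : ∀ v, residualDeg G I v = H.degree v := by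
    intro v
    rw [← SimpleGraph.card_neighborFinset_eq_degree, ← Set.ncard_coe_finset,
      SimpleGraph.coe_neighborFinset, residualDeg]
    by_cases hv : v ∈ closedNbhd G I
    · have : H.neighborSet v = ∅ := by
        ext u; simp [H, hv]
      simp [hv, this]
    · rw [if_neg hv]
      congr 1
      ext u
      simp [H, hv]
  have hedge : {e | e ∈ G.edgeSet ∧ ∀ v ∈ e, 0 < residualDeg G I v} = H.edgeSet := by
    ext e
    induction e with
    | h u v =>
      simp only [Set.mem_ofPred_eq, SimpleGraph.mem_edgeSet, Sym2.mem_iff, forall_eq_or_imp,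
        forall_eq]
      constructor
      · rintro ⟨h, hu, hv⟩
        exact ⟨h, notMem_closedNbhd_of_residualDeg_pos G hu,
          notMem_closedNbhd_of_residualDeg_pos G hv⟩
      · intro h
        refine ⟨h.1, ?_, ?_⟩
        · rw [hdeg, SimpleGraph.degree_pos_iff_exists_adj]; exact ⟨v, h⟩
        · rw [hdeg, SimpleGraph.degree_pos_iff_exists_adj]; exact ⟨u, h.symm⟩
  rw [residualEdges, hedge, Finset.sum_congr rfl fun v _ => hdeg v,
    H.sum_degrees_eq_twice_card_edges, ← Set.ncard_coe_finset, SimpleGraph.coe_edgeFinset]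

/-! ### Processing the groups of samples -/

section Groups

variable (α : ℝ) (pick : Finset (Fin n) → Fin n)

lemma subset_addFromGroup (i : ℕ) (J : Finset (Fin n)) (X : List (Fin n)) :
    J ⊆ addFromGroup G α pick i J X := by
  unfold addFromGroup
  dsimp only
  split_ifs
  · exact Finset.subset_insert _ _
  · exact subset_rfl

lemma subset_foldl_addFromGroup (i : ℕ) (Xs : List (List (Fin n))) (J : Finset (Fin n)) :
    J ⊆ Xs.foldl (addFromGroup G α pick i) J := by
  induction Xs generalizing J with
  | nil => exact subset_rfl
  | cons X Xs ih => exact (subset_addFromGroup G α pick i J X).trans (ih _)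

lemma subset_addFromGroups (i : ℕ) (Ls : List (List (List (Fin n)))) (J : Finset (Fin n)) :
    J ⊆ addFromGroups G α pick i Ls J := by
  induction Ls generalizing J i with
  | nil => exact subset_rfl
  | cons Xs Ls ih =>
    rw [addFromGroups]
    exact (subset_foldl_addFromGroup G α pick i Xs J).trans (ih _ _)

variable {pick} (hn : 0 < n) (hpick : ∀ S : Finset (Fin n), S.Nonempty → pick S ∈ S)
include hn hpick

lemma isIndepSet_addFromGroup (i : ℕ) {J : Finset (Fin n)} (X : List (Fin n))
    (hJ : G.IsIndepSet (J : Set (Fin n))) :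
    G.IsIndepSet (addFromGroup G α pick i J X : Set (Fin n)) := by
  classical
  unfold addFromGroup
  dsimp only
  split_ifs with h
  · refine isIndepSet_insert G hJ (notMem_closedNbhd_of_residualDeg_pos G ?_)
    have := hpick _ h
    rw [Finset.mem_filter] at this
    -- The threshold is positive, so the picked vertex has positive residual degree and therefore
    -- lies outside the closed neighbourhood.
    have h0 : (0 : ℝ) < (n : ℝ) ^ (1 - ((i : ℝ) + 1) * α) :=
      Real.rpow_pos_of_pos (by exact_mod_cast hn) _
    exact_mod_cast h0.trans_le this.2
  · exact hJ

lemma isIndepSet_foldl_addFromGroup (i : ℕ) (Xs : List (List (Fin n))) {J : Finset (Fin n)}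
    (hJ : G.IsIndepSet (J : Set (Fin n))) :
    G.IsIndepSet ((Xs.foldl (addFromGroup G α pick i) J : Finset (Fin n)) : Set (Fin n)) := by
  induction Xs generalizing J with
  | nil => exact hJ
  | cons X Xs ih => exact ih (isIndepSet_addFromGroup G α hn hpick i X hJ)

lemma isIndepSet_addFromGroups (i : ℕ) (Ls : List (List (List (Fin n)))) {J : Finset (Fin n)}
    (hJ : G.IsIndepSet (J : Set (Fin n))) :
    G.IsIndepSet (addFromGroups G α pick i Ls J : Set (Fin n)) := by
  induction Ls generalizing J i with
  | nil => exact hJ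
  | cons Xs Ls ih =>
    rw [addFromGroups]
    exact ih _ (isIndepSet_foldl_addFromGroup G α hn hpick i Xs hJ)

omit hn hpick in
open Classical in
/-- The vertices of `V` whose residual degree with respect to `J` is at least
`n ^ (1 - (i + 1) α)`. -/
def heavy (i : ℕ) (V J : Finset (Fin n)) : Finset (Fin n) :=
  {v ∈ V | (n : ℝ) ^ (1 - ((i : ℝ) + 1) * α) ≤ residualDeg G J v}

omit hn hpick in
lemma heavy_anti (i : ℕ) (V : Finset (Fin n)) {I J : Finset (Fin n)} (h : I ⊆ J) :
    heavy G α i V J ⊆ heavy G α i V I := by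
  intro v hv
  simp only [heavy, Finset.mem_filter] at hv ⊢
  exact ⟨hv.1, hv.2.trans (by exact_mod_cast residualDeg_anti G h v)⟩

/-- If the group contains a heavy vertex, then many vertices are dominated when it is processed. -/
lemma ncard_compl_addFromGroup (i : ℕ) (V J : Finset (Fin n)) (X : List (Fin n))
    (hX : ∃ x ∈ X, x ∈ heavy G α i V J) :
    ((closedNbhd G (addFromGroup G α pick i J X))ᶜ.ncard : ℝ) +
      ((n : ℝ) ^ (1 - ((i : ℝ) + 1) * α) + 1) ≤ (closedNbhd G J)ᶜ.ncard := by
  classical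
  have h0 : (0 : ℝ) < (n : ℝ) ^ (1 - ((i : ℝ) + 1) * α) :=
    Real.rpow_pos_of_pos (by exact_mod_cast hn) _
  unfold addFromGroup
  dsimp only
  obtain ⟨x, hx, hxh⟩ := hX
  have hne : ((X.toFinset.filter fun v =>
      (n : ℝ) ^ (1 - ((i : ℝ) + 1) * α) ≤ residualDeg G J v)).Nonempty :=
    ⟨x, by simp only [heavy, Finset.mem_filter] at hxh; simp [hx, hxh.2]⟩
  rw [if_pos hne]
  have hp := hpick _ hne
  rw [Finset.mem_filter] at hp
  have hv : pick (X.toFinset.filter fun v =>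
      (n : ℝ) ^ (1 - ((i : ℝ) + 1) * α) ≤ residualDeg G J v) ∉ closedNbhd G J :=
    notMem_closedNbhd_of_residualDeg_pos G (by exact_mod_cast h0.trans_le hp.2)
  have := ncard_compl_closedNbhd_insert G hv
  have h2 : (((closedNbhd G (insert (pick (X.toFinset.filter fun v =>
      (n : ℝ) ^ (1 - ((i : ℝ) + 1) * α) ≤ residualDeg G J v)) J))ᶜ.ncard : ℝ)) +
      ((residualDeg G J (pick (X.toFinset.filter fun v =>
      (n : ℝ) ^ (1 - ((i : ℝ) + 1) * α) ≤ residualDeg G J v)) : ℝ) + 1) ≤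
      (closedNbhd G J)ᶜ.ncard := by exact_mod_cast this
  linarith [hp.2]

omit hn hpick in
/-- The group `X` misses the heavy vertices although there are many of them. -/
def Missed (δ : ℝ) (i : ℕ) (V J : Finset (Fin n)) (X : List (Fin n)) : Prop :=
  δ * V.card < (heavy G α i V J).card ∧ ∀ x ∈ X, x ∉ heavy G α i V J

/-- If no group misses while heavy vertices are abundant, then either they became rare at some
moment, and stay rare because `heavy` is antitone, or every group hit one and shrank the undominated
set by the stated amount. -/
lemma card_heavy_foldl_or (δ : ℝ) (i : ℕ) (V : Finset (Fin n)) (Xs : List (List (Fin n)))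
    (J : Finset (Fin n))
    (h : ¬MapReduce.BadRun (addFromGroup G α pick i) (Missed G α δ i V) J Xs) :
    ((heavy G α i V (Xs.foldl (addFromGroup G α pick i) J)).card : ℝ) ≤ δ * V.card ∨
    ((closedNbhd G (Xs.foldl (addFromGroup G α pick i) J))ᶜ.ncard : ℝ) +
      Xs.length * ((n : ℝ) ^ (1 - ((i : ℝ) + 1) * α) + 1) ≤ (closedNbhd G J)ᶜ.ncard := by
  induction Xs generalizing J with
  | nil => right; simp
  | cons X Xs ih =>
    rw [MapReduce.BadRun, not_or] at h
    rcases ih _ h.2 with h1 | h1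
    · exact Or.inl h1
    · rw [Missed, not_and_or, not_lt] at h
      rcases h.1 with h2 | h2
      · left
        refine le_trans ?_ h2
        exact_mod_cast Finset.card_le_card (heavy_anti G α i V
          (subset_foldl_addFromGroup G α pick i (X :: Xs) J))
      · right
        push Not at h2
        have := ncard_compl_addFromGroup G α hn hpick i V J X h2
        rw [List.foldl_cons, List.length_cons]
        push_cast
        linarith

/-- The second alternative is impossible: `n ^ ((i + 1) α)` groups, each dominating `n ^ (1 - (i +
1) α) + 1` new vertices, would exhaust more than `n` vertices. -/
lemma card_heavy_foldl (δ : ℝ) (i : ℕ) (V : Finset (Fin n)) (Xs : List (List (Fin n)))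
    (J : Finset (Fin n)) (hlen : (n : ℝ) ^ (((i : ℝ) + 1) * α) ≤ Xs.length)
    (h : ¬MapReduce.BadRun (addFromGroup G α pick i) (Missed G α δ i V) J Xs) :
    ((heavy G α i V (Xs.foldl (addFromGroup G α pick i) J)).card : ℝ) ≤ δ * V.card := by
  have hn' : (0 : ℝ) < n := by exact_mod_cast hn
  rcases card_heavy_foldl_or G α hn hpick δ i V Xs J h with h1 | h1
  · exact h1
  · exfalso
    have h2 : ((closedNbhd G J)ᶜ.ncard : ℝ) ≤ n := by
      have := Set.ncard_le_ncard (Set.subset_univ (closedNbhd G J)ᶜ) (Set.toFinite _)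
      rw [Set.ncard_univ, Nat.card_fin] at this
      exact_mod_cast this
    have h3 : (n : ℝ) ^ (((i : ℝ) + 1) * α) * (n : ℝ) ^ (1 - ((i : ℝ) + 1) * α) = n := by
      rw [← Real.rpow_add hn']; simp
    have h4 : (0 : ℝ) < (n : ℝ) ^ (1 - ((i : ℝ) + 1) * α) := Real.rpow_pos_of_pos hn' _
    have h5 : (0 : ℝ) < (n : ℝ) ^ (((i : ℝ) + 1) * α) := Real.rpow_pos_of_pos hn' _
    have h6 : (n : ℝ) ≤ Xs.length * (n : ℝ) ^ (1 - ((i : ℝ) + 1) * α) := by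
      calc (n : ℝ) = (n : ℝ) ^ (((i : ℝ) + 1) * α) * (n : ℝ) ^ (1 - ((i : ℝ) + 1) * α) := h3.symm
        _ ≤ _ := mul_le_mul_of_nonneg_right hlen h4.le
    have h7 : (0 : ℝ) ≤ ((closedNbhd G (Xs.foldl (addFromGroup G α pick i) J))ᶜ.ncard : ℝ) :=
      Nat.cast_nonneg _
    nlinarith

-- The bound achieved for a class right after its own groups survives the processing of later
-- classes, since `heavy` is antitone in the independent set.
omit hn hpick in
lemma card_heavy_addFromGroups (δ : ℝ) (V : ℕ → Finset (Fin n)) (i : ℕ)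
    (Ls : List (List (List (Fin n)))) (J : Finset (Fin n))
    (h : ¬MapReduce.BadRun (fun (s : ℕ × Finset (Fin n)) (Xs : List (List (Fin n))) =>
        (s.1 + 1, Xs.foldl (addFromGroup G α pick s.1) s.2))
      (fun s Xs => ¬((heavy G α s.1 (V s.1) (Xs.foldl (addFromGroup G α pick s.1) s.2)).card : ℝ) ≤
        δ * (V s.1).card) (i, J) Ls) (k : ℕ) (hk : k < Ls.length) :
    ((heavy G α (i + k) (V (i + k)) (addFromGroups G α pick i Ls J)).card : ℝ) ≤
      δ * (V (i + k)).card := by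
  induction Ls generalizing i J k with
  | nil => simp at hk
  | cons Xs Ls ih =>
    rw [MapReduce.BadRun, not_or, not_not] at h
    rw [addFromGroups]
    cases k with
    | zero =>
      refine le_trans ?_ h.1
      exact_mod_cast Finset.card_le_card (heavy_anti G α i _ (subset_addFromGroups G α pick _ Ls _))
    | succ k =>
      have := ih _ _ h.2 k (by simpa using hk)
      rwa [show i + (k + 1) = i + 1 + k by ring]

end Groups

/-- If the fraction of heavy vertices is more than `δ`, then a group of `size` samples misses them
with probability at most `exp (-δ * size)`. -/
lemma toOuterMeasure_missed_le (α : ℝ) {δ : ℝ} (i size : ℕ)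
    (V J : Finset (Fin n)) (hV : V.Nonempty) :
    (MapReduce.sampleAll (List.replicate size (PMF.uniformOfFinset V hV))).toOuterMeasure
      {X | Missed G α δ i V J X} ≤ ENNReal.ofReal (Real.exp (-(δ * size))) := by
  classical
  by_cases hc : δ * V.card < (heavy G α i V J).card
  · have hV0 : (0 : ℝ) < V.card := by exact_mod_cast hV.card_pos
    have hsub : heavy G α i V J ⊆ V := Finset.filter_subset _ _
    have hle : ((heavy G α i V J).card : ℝ) ≤ V.card := by exact_mod_cast Finset.card_le_card hsub
    -- Missing means that all `size` independent samples avoid the heavy set, which has probability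
    -- at most `(1 - δ) ^ size ≤ exp (-δ * size)`.
    refine (PMF.toOuterMeasure_mono (t := {X | ∀ x ∈ X, x ∈ {x | x ∉ heavy G α i V J}})
      _ (fun X hX => hX.1.2)).trans ?_
    rw [MapReduce.toOuterMeasure_sampleAll_replicate]
    have h1 : (V.filter (· ∈ {x | x ∉ heavy G α i V J})).card = V.card - (heavy G α i V J).card := by
      rw [← Finset.card_sdiff_of_subset hsub]
      congr 1
      ext x; simp
    have h2 : ((V.filter (· ∈ {x | x ∉ heavy G α i V J})).card : ℝ≥0∞) / V.card =
        ENNReal.ofReal (1 - (heavy G α i V J).card / V.card) := by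
      rw [h1, one_sub_div hV0.ne', ENNReal.ofReal_div_of_pos hV0,
        ← Nat.cast_sub (Finset.card_le_card hsub), ENNReal.ofReal_natCast, ENNReal.ofReal_natCast]
    have h2' : (PMF.uniformOfFinset V hV).toOuterMeasure {x | x ∉ heavy G α i V J} =
        ENNReal.ofReal (1 - (heavy G α i V J).card / V.card) := by
      rw [← h2, PMF.toOuterMeasure_uniformOfFinset_apply]
      congr!
    have h3 : δ ≤ (heavy G α i V J).card / V.card := by rw [le_div_iff₀ hV0]; exact hc.le
    have h4 : ((heavy G α i V J).card : ℝ) / V.card ≤ 1 := by rwa [div_le_one hV0]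
    rw [h2', ← ENNReal.ofReal_pow (by linarith)]
    refine ENNReal.ofReal_le_ofReal ?_
    calc (1 - ((heavy G α i V J).card : ℝ) / V.card) ^ size
        ≤ (Real.exp (-δ)) ^ size := by
          refine pow_le_pow_left₀ (by linarith) ?_ _
          linarith [Real.add_one_le_exp (-δ)]
      _ = Real.exp (-(δ * size)) := by rw [← Real.exp_nat_mul]; congr 1; ring
  · have : {X | Missed G α δ i V J X} = ∅ := by
      ext X; simp [Missed, hc]
    simp [this]

/-- Union bound over the groups of one class. The groups are drawn from the fixed set `V`, so the
next group is independent of the set `J` built by the previous ones. For an empty class there is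
nothing heavy. -/
lemma toOuterMeasure_drawGroups_le (α : ℝ) {δ : ℝ} {pick : Finset (Fin n) → Fin n} (hn : 0 < n)
    (hpick : ∀ S : Finset (Fin n), S.Nonempty → pick S ∈ S) (i groups size : ℕ)
    (V J : Finset (Fin n)) (hg : (n : ℝ) ^ (((i : ℝ) + 1) * α) ≤ groups) :
    (drawGroups V groups size).toOuterMeasure
      {Xs | ¬((heavy G α i V (Xs.foldl (addFromGroup G α pick i) J)).card : ℝ) ≤ δ * V.card} ≤
      groups * ENNReal.ofReal (Real.exp (-(δ * size))) := by
  classical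
  unfold drawGroups
  split_ifs with hV
  · refine (PMF.toOuterMeasure_mono
      (t := {Xs | MapReduce.BadRun (addFromGroup G α pick i) (Missed G α δ i V) J Xs}) _ ?_).trans ?_
    · rintro Xs ⟨h, hs⟩
      by_contra hbad
      refine h (card_heavy_foldl G α hn hpick δ i V Xs J ?_ hbad)
      rw [MapReduce.mem_support_sampleAll] at hs
      rw [← hs.length_eq, List.length_replicate]
      exact hg
    · refine (MapReduce.toOuterMeasure_badRun_le _ _
        (fun ps _ => ∀ p ∈ ps, p = MapReduce.sampleAll (List.replicate size
          (PMF.uniformOfFinset V hV))) (fun p ps s x h q hq => h q (by simp [hq])) ?_ _ _ ?_).trans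
        (by rw [List.length_replicate])
      · intro p ps s h
        rw [h p (by simp)]
        exact toOuterMeasure_missed_le G α i size V s hV
      · intro p hp
        exact List.eq_of_mem_replicate hp
  · rw [Finset.not_nonempty_iff_eq_empty] at hV
    subst hV
    simp [heavy]

lemma residualDeg_lt (I : Finset (Fin n)) (v : Fin n) : residualDeg G I v < n := by
  unfold residualDeg
  split_ifs
  · exact v.pos
  · have h : {u | G.Adj v u ∧ u ∉ closedNbhd G I} ⊂ Set.univ :=
      Set.ssubset_univ_iff.2 fun h =>
        G.loopless.irrefl v ((Set.eq_univ_iff_forall.1 h v).1)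
    have := Set.ncard_lt_ncard h
    rwa [Set.ncard_univ, Nat.card_fin] at this

/-- The degree classes cover the vertices of positive residual degree. -/
lemma exists_mem_degreeClass {α : ℝ} {k : ℕ} (hk : 1 ≤ k * α) {I : Finset (Fin n)}
    {v : Fin n} (hv : 0 < residualDeg G I v) : ∃ i < k, v ∈ degreeClass G α I (i + 1) := by
  classical
  have hn : (1 : ℝ) ≤ n := by exact_mod_cast v.pos
  -- The class of `v` is the least such index. It is at most `k` because `n ^ (1 - k α) ≤ 1`, and it
  -- is not `0` because residual degrees are below `n`.
  have hex : ∃ i : ℕ, (n : ℝ) ^ (1 - i * α) ≤ residualDeg G I v := by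
    refine ⟨k, (Real.rpow_le_one_of_one_le_of_nonpos hn (by linarith)).trans ?_⟩
    exact_mod_cast hv
  have hle : Nat.find hex ≤ k := by
    refine Nat.find_min' hex ((Real.rpow_le_one_of_one_le_of_nonpos hn (by linarith)).trans ?_)
    exact_mod_cast hv
  obtain ⟨i, hi⟩ : ∃ i, Nat.find hex = i + 1 := by
    refine Nat.exists_eq_succ_of_ne_zero fun h0 => ?_
    have := Nat.find_spec hex
    rw [h0] at this
    simp only [Nat.cast_zero, zero_mul, sub_zero, Real.rpow_one] at this
    exact absurd (residualDeg_lt G I v) (by exact_mod_cast this.not_gt)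
  refine ⟨i, by omega, ?_⟩
  simp only [degreeClass, Finset.mem_filter, Finset.mem_univ, true_and]
  refine ⟨hi ▸ Nat.find_spec hex, ?_⟩
  have := Nat.find_min hex (m := i) (by omega)
  push_cast
  rw [add_sub_cancel_right]
  exact not_le.1 this

/-- Compare degrees vertex by vertex. A light vertex of class `i` has lost a factor `n ^ α`. A heavy
one is charged the upper end of its class; that is `n ^ α` times the lower end, and heaviness has
density `n ^ (-3α)`, so a class contributes at most `n ^ (-2α)` of the old degree sum. The `k ≤ n ^
α` classes together contribute one more share `n ^ (-α)`, whence the factor `2`. -/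
lemma residualEdges_le {α : ℝ} {k : ℕ} (hn : 0 < n) (hk : 1 ≤ k * α)
    (hkn : (k : ℝ) ≤ (n : ℝ) ^ α) {I J : Finset (Fin n)} (hIJ : I ⊆ J)
    (h : ∀ i < k, ((heavy G α (i + 1) (degreeClass G α I (i + 1)) J).card : ℝ) ≤
      (n : ℝ) ^ (-(3 * α)) * (degreeClass G α I (i + 1)).card) :
    (residualEdges G J : ℝ) ≤ 2 * residualEdges G I / (n : ℝ) ^ α := by
  classical
  have hn' : (0 : ℝ) < n := by exact_mod_cast hn
  have hn1 : (1 : ℝ) ≤ n := by exact_mod_cast hn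
  have hpt : ∀ v, (residualDeg G J v : ℝ) ≤ (n : ℝ) ^ (-α) * residualDeg G I v +
      ∑ i ∈ Finset.range k, if v ∈ heavy G α (i + 1) (degreeClass G α I (i + 1)) J then
        (n : ℝ) ^ (1 - i * α) else 0 := by
    intro v
    have hnn : 0 ≤ ∑ i ∈ Finset.range k,
        if v ∈ heavy G α (i + 1) (degreeClass G α I (i + 1)) J then
          (n : ℝ) ^ (1 - i * α) else 0 :=
      Finset.sum_nonneg fun i _ => by split_ifs <;> positivity
    have hle : (residualDeg G J v : ℝ) ≤ residualDeg G I v := by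
      exact_mod_cast residualDeg_anti G hIJ v
    rcases Nat.eq_zero_or_pos (residualDeg G I v) with h0 | h0
    · rw [h0] at hle ⊢
      simp only [Nat.cast_zero, mul_zero, zero_add] at hle ⊢
      linarith
    obtain ⟨i, hi, hvi⟩ := exists_mem_degreeClass G hk h0
    by_cases hh : v ∈ heavy G α (i + 1) (degreeClass G α I (i + 1)) J
    · have h1 : (n : ℝ) ^ (1 - i * α) ≤ ∑ i ∈ Finset.range k,
          if v ∈ heavy G α (i + 1) (degreeClass G α I (i + 1)) J then
          (n : ℝ) ^ (1 - i * α) else 0 := by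
        refine le_trans ?_ (Finset.single_le_sum (fun i _ => by split_ifs <;> positivity)
          (Finset.mem_range.2 hi))
        rw [if_pos hh]
      have h2 : (residualDeg G I v : ℝ) < (n : ℝ) ^ (1 - i * α) := by
        simp only [degreeClass, Finset.mem_filter] at hvi
        simpa using hvi.2.2
      have h3 : 0 ≤ (n : ℝ) ^ (-α) * residualDeg G I v := by positivity
      linarith
    · have h1 : (residualDeg G J v : ℝ) < (n : ℝ) ^ (1 - (((i + 1 : ℕ) : ℝ) + 1) * α) := by
        by_contra hcon
        exact hh (by simp only [heavy, Finset.mem_filter]; exact ⟨hvi, not_lt.1 hcon⟩)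
      have h2 : (n : ℝ) ^ (1 - ((i + 1 : ℕ) : ℝ) * α) ≤ residualDeg G I v := by
        simp only [degreeClass, Finset.mem_filter] at hvi
        exact hvi.2.1
      have h3 : (n : ℝ) ^ (1 - (((i + 1 : ℕ) : ℝ) + 1) * α) =
          (n : ℝ) ^ (-α) * (n : ℝ) ^ (1 - ((i + 1 : ℕ) : ℝ) * α) := by
        rw [← Real.rpow_add hn']; congr 1; ring
      have h4 : (n : ℝ) ^ (-α) * (n : ℝ) ^ (1 - ((i + 1 : ℕ) : ℝ) * α) ≤
          (n : ℝ) ^ (-α) * residualDeg G I v := by gcongr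
      linarith
  have hsum : ∀ K, (∑ v, (residualDeg G K v : ℝ)) = 2 * residualEdges G K := fun K => by
    exact_mod_cast sum_residualDeg G K
  have hclass : ∀ i ∈ Finset.range k, ∑ v,
      (if v ∈ heavy G α (i + 1) (degreeClass G α I (i + 1)) J then (n : ℝ) ^ (1 - i * α) else 0) ≤
      (n : ℝ) ^ (-(2 * α)) * (2 * residualEdges G I) := by
    intro i hi
    rw [← Finset.sum_filter, Finset.sum_const, nsmul_eq_mul, Finset.filter_mem_eq_inter,
      Finset.univ_inter]
    have h1 : ((degreeClass G α I (i + 1)).card : ℝ) * (n : ℝ) ^ (1 - ((i + 1 : ℕ) : ℝ) * α) ≤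
        2 * residualEdges G I := by
      rw [← hsum, ← nsmul_eq_mul]
      refine (Finset.card_nsmul_le_sum _ (fun v => (residualDeg G I v : ℝ)) _ ?_).trans
        (Finset.sum_le_sum_of_subset_of_nonneg (Finset.subset_univ _) fun v _ _ => by positivity)
      intro v hv
      simp only [degreeClass, Finset.mem_filter] at hv
      exact hv.2.1
    calc ((heavy G α (i + 1) (degreeClass G α I (i + 1)) J).card : ℝ) * (n : ℝ) ^ (1 - i * α)
        ≤ (n : ℝ) ^ (-(3 * α)) * (degreeClass G α I (i + 1)).card * (n : ℝ) ^ (1 - i * α) := by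
          gcongr; exact h i (Finset.mem_range.1 hi)
      _ = (n : ℝ) ^ (-(2 * α)) * ((degreeClass G α I (i + 1)).card *
            (n : ℝ) ^ (1 - ((i + 1 : ℕ) : ℝ) * α)) := by
          have : (n : ℝ) ^ (-(3 * α)) * (n : ℝ) ^ (1 - i * α) =
              (n : ℝ) ^ (-(2 * α)) * (n : ℝ) ^ (1 - ((i + 1 : ℕ) : ℝ) * α) := by
            rw [← Real.rpow_add hn', ← Real.rpow_add hn']; congr 1; push_cast; ring
          rw [mul_right_comm, this]; ring
      _ ≤ _ := by gcongr
  have htot : 2 * (residualEdges G J : ℝ) ≤ (n : ℝ) ^ (-α) * (2 * residualEdges G I) +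
      k * ((n : ℝ) ^ (-(2 * α)) * (2 * residualEdges G I)) := by
    rw [← hsum J]
    refine (Finset.sum_le_sum fun v _ => hpt v).trans ?_
    rw [Finset.sum_add_distrib, ← Finset.mul_sum, hsum, Finset.sum_comm]
    gcongr
    refine (Finset.sum_le_sum hclass).trans ?_
    simp
  have h5 : (k : ℝ) * (n : ℝ) ^ (-(2 * α)) ≤ (n : ℝ) ^ (-α) := by
    calc (k : ℝ) * (n : ℝ) ^ (-(2 * α)) ≤ (n : ℝ) ^ α * (n : ℝ) ^ (-(2 * α)) := by gcongr
      _ = _ := by rw [← Real.rpow_add hn']; congr 1; ring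
  have h6 : (k : ℝ) * ((n : ℝ) ^ (-(2 * α)) * (2 * residualEdges G I)) ≤
      (n : ℝ) ^ (-α) * (2 * residualEdges G I) := by
    rw [← mul_assoc]; gcongr
  rw [div_eq_mul_inv, ← Real.rpow_neg hn'.le]
  linarith

/-- The iteration succeeds except with small probability. -/
lemma toOuterMeasure_iteration_le {μ : ℝ} (hμ : 0 < μ) (hn : 0 < n)
    (hkn : (⌈8 / μ⌉₊ : ℝ) ≤ (n : ℝ) ^ (μ / 8)) {pick : Finset (Fin n) → Fin n}
    (hpick : ∀ S : Finset (Fin n), S.Nonempty → pick S ∈ S) {I : Finset (Fin n)}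
    (hI : G.IsIndepSet (I : Set (Fin n))) :
    (iteration G μ pick I).toOuterMeasure {J | I ⊆ J ∧ G.IsIndepSet (J : Set (Fin n)) ∧
      (residualEdges G J : ℝ) ≤ 2 * (residualEdges G I : ℝ) / (n : ℝ) ^ (μ / 8)}ᶜ ≤
    ENNReal.ofReal (⌈8 / μ⌉₊ * (((n : ℝ) ^ (1 + 2 * (μ / 8)) + 1) *
      Real.exp (-(n : ℝ) ^ (μ / 8)))) := by
  classical
  set α := μ / 8 with hα
  set k := ⌈8 / μ⌉₊ with hk
  have hα0 : 0 < α := by positivity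
  have hn' : (0 : ℝ) < n := by exact_mod_cast hn
  have hn1 : (1 : ℝ) ≤ n := by exact_mod_cast hn
  have hkα : 1 ≤ k * α := by
    have : 8 / μ ≤ k := Nat.le_ceil _
    calc (1 : ℝ) = 8 / μ * α := by rw [hα]; field_simp
      _ ≤ _ := by gcongr
  -- This bounds the number of groups in each class by `n ^ (1 + 2α) + 1`.
  have hkα2 : k * α ≤ 1 + α := by
    have : (k : ℝ) < 8 / μ + 1 := Nat.ceil_lt_add_one (by positivity)
    calc k * α ≤ (8 / μ + 1) * α := by gcongr
      _ = 1 + α := by rw [hα]; field_simp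
  -- The iteration is viewed as a process whose steps are whole classes; the state carries the class
  -- index, so that `B` can ask whether the class just processed has kept too many heavy vertices.
  let F : ℕ × Finset (Fin n) → List (List (Fin n)) → ℕ × Finset (Fin n) := fun s Xs =>
    (s.1 + 1, Xs.foldl (addFromGroup G α pick s.1) s.2)
  let B : ℕ × Finset (Fin n) → List (List (Fin n)) → Prop := fun s Xs =>
    ¬((heavy G α s.1 (degreeClass G α I s.1) (Xs.foldl (addFromGroup G α pick s.1) s.2)).card : ℝ) ≤
      (n : ℝ) ^ (-(3 * α)) * (degreeClass G α I s.1).card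
  let draw : ℕ → PMF (List (List (Fin n))) := fun i =>
    drawGroups (degreeClass G α I i) ⌈(n : ℝ) ^ (((i : ℝ) + 1) * α)⌉₊ ⌈(n : ℝ) ^ (μ / 2)⌉₊
  rw [iteration, PMF.toOuterMeasure_map_apply]
  refine (PMF.toOuterMeasure_mono (t := {Ls | MapReduce.BadRun F B (1, I) Ls}) _ ?_).trans ?_
  · rintro Ls ⟨h, hs⟩
    by_contra hbad
    refine h ⟨subset_addFromGroups G α pick 1 Ls I,
      isIndepSet_addFromGroups G α hn hpick 1 Ls hI, ?_⟩
    refine residualEdges_le G hn hkα hkn (subset_addFromGroups G α pick 1 Ls I) ?_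
    intro i hi
    have hlen : Ls.length = k := by
      rw [MapReduce.mem_support_sampleAll] at hs
      rw [← hs.length_eq, List.length_map, List.length_range']
    have := card_heavy_addFromGroups G α _ (degreeClass G α I) 1 Ls I hbad i (by omega)
    rwa [add_comm 1 i] at this
  · have key := MapReduce.toOuterMeasure_badRun_le F B
      -- The invariant ties the state to the remaining distributions: the next one is that of class
      -- `s.1`, and this index is at most `k`.
      (fun ps s => ∃ m, s.1 + m = k + 1 ∧ ps = (List.range' s.1 m).map draw)
      (ε := ENNReal.ofReal (((n : ℝ) ^ (1 + 2 * α) + 1) * Real.exp (-(n : ℝ) ^ α))) ?_ ?_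
      ((List.range' 1 k).map draw) (1, I) ⟨k, by ring, rfl⟩
    · refine key.trans (le_of_eq ?_)
      rw [List.length_map, List.length_range', ENNReal.ofReal_mul (Nat.cast_nonneg k),
        ENNReal.ofReal_natCast]
    · rintro p ps s x ⟨m, hm, h⟩
      cases m with
      | zero => simp at h
      | succ m =>
        rw [List.range'_succ, List.map_cons, List.cons.injEq] at h
        exact ⟨m, by simp only [F]; omega, h.2⟩
    · rintro p ps ⟨i, J⟩ ⟨m, hm, h⟩
      cases m with
      | zero => simp at h
      | succ m =>
        rw [List.range'_succ, List.map_cons, List.cons.injEq] at h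
        dsimp only at h hm
        rw [h.1]
        refine (toOuterMeasure_drawGroups_le G α hn hpick i _ _ _ J (Nat.le_ceil _)).trans ?_
        rw [← ENNReal.ofReal_natCast, ← ENNReal.ofReal_mul (by positivity)]
        refine ENNReal.ofReal_le_ofReal ?_
        have hik : (i : ℝ) ≤ k := by exact_mod_cast (by omega : i ≤ k)
        gcongr
        · refine (Nat.ceil_lt_add_one (by positivity)).le.trans ?_
          refine add_le_add_left (Real.rpow_le_rpow_of_exponent_le hn1 ?_) _
          · have : (i : ℝ) * α ≤ k * α := by gcongr
            linarith
        -- Here `α = μ / 8` enters: the group size is `n ^ (4α)`, so density times size is at least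
        -- `n ^ α`.
        · calc (n : ℝ) ^ α = (n : ℝ) ^ (-(3 * α)) * (n : ℝ) ^ (μ / 2) := by
                rw [← Real.rpow_add hn']; congr 1; rw [hα]; ring
            _ ≤ _ := by gcongr; exact Nat.le_ceil _

/-- Stretched exponentials beat powers. -/
lemma eventually_mul_exp_neg_rpow_le {a : ℝ} (ha : 0 < a) (C b : ℝ) (d : ℕ) :
    ∀ᶠ n : ℕ in Filter.atTop,
      C * (n : ℝ) ^ b * Real.exp (-(n : ℝ) ^ a) ≤ (n : ℝ) ^ (-(d : ℝ)) := by
  -- After the substitution by `n ^ a` this exponent becomes `-(b + d + 1)`; the extra `1` absorbs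
  -- the constant, as `C ≤ n` eventually.
  have h1 := ((isLittleO_exp_neg_mul_rpow_atTop one_pos (-(b + d + 1) / a)).comp_tendsto
    ((tendsto_rpow_atTop ha).comp tendsto_natCast_atTop_atTop)).bound one_pos
  filter_upwards [h1, Filter.eventually_ge_atTop (max 1 ⌈C⌉₊)] with n hn hn2
  have hn1 : 1 ≤ n := (le_max_left _ _).trans hn2
  have hC : C ≤ n := (Nat.le_ceil C).trans (by exact_mod_cast (le_max_right _ _).trans hn2)
  have hn0 : (0 : ℝ) < n := by exact_mod_cast hn1
  simp only [Function.comp_apply, one_mul, neg_mul, Real.norm_eq_abs, Real.abs_exp] at hn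
  rw [← Real.rpow_mul hn0.le, mul_div_cancel₀ _ ha.ne', abs_of_nonneg (by positivity)] at hn
  calc C * (n : ℝ) ^ b * Real.exp (-(n : ℝ) ^ a)
      ≤ n * (n : ℝ) ^ b * (n : ℝ) ^ (-(b + d + 1)) := by gcongr
    _ = (n : ℝ) ^ (-(d : ℝ)) := by
      nth_rw 1 [← Real.rpow_one (n : ℝ)]
      rw [← Real.rpow_add hn0, ← Real.rpow_add hn0]; congr 1; ring

lemma eventually_le_rpow {a : ℝ} (ha : 0 < a) (C : ℝ) :
    ∀ᶠ n : ℕ in Filter.atTop, C ≤ (n : ℝ) ^ a :=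
  ((tendsto_rpow_atTop ha).comp tendsto_natCast_atTop_atTop).eventually_ge_atTop C

/-- The hungry-greedy iteration reduces the number of residual edges with high probability. -/
theorem iteration_whp (μ : ℝ) (hμ : 0 < μ) : ∃ n₀ : ℕ → ℕ, ∀ d n : ℕ, n₀ d ≤ n →
    ∀ G : SimpleGraph (Fin n), ∀ pick : Finset (Fin n) → Fin n,
      (∀ S : Finset (Fin n), S.Nonempty → pick S ∈ S) →
      ∀ I : Finset (Fin n), G.IsIndepSet (I : Set (Fin n)) →
        ENNReal.ofReal (1 - (n : ℝ) ^ (-(d : ℝ))) ≤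
          (iteration G μ pick I).toOuterMeasure {J | I ⊆ J ∧ G.IsIndepSet (J : Set (Fin n)) ∧
              (residualEdges G J : ℝ) ≤ 2 * (residualEdges G I : ℝ) / (n : ℝ) ^ (μ / 8)} := by
  have h8 : 0 < μ / 8 := by positivity
  have hev : ∀ d : ℕ, ∃ N : ℕ, ∀ n ≥ N, 0 < n ∧ (⌈8 / μ⌉₊ : ℝ) ≤ (n : ℝ) ^ (μ / 8) ∧
      (2 * ⌈8 / μ⌉₊ : ℝ) * (n : ℝ) ^ (1 + 2 * (μ / 8)) * Real.exp (-(n : ℝ) ^ (μ / 8)) ≤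
        (n : ℝ) ^ (-(d : ℝ)) := fun d =>
    Filter.eventually_atTop.1 ((Filter.eventually_gt_atTop 0).and ((eventually_le_rpow h8 _).and
      (eventually_mul_exp_neg_rpow_le h8 _ _ d)))
  choose n₀ hn₀ using hev
  refine ⟨n₀, fun d n hn G pick hpick I hI => ?_⟩
  obtain ⟨hn0, hk, he⟩ := hn₀ d n hn
  have hn1 : (1 : ℝ) ≤ n := by exact_mod_cast hn0
  refine PMF.ofReal_one_sub_le _ _ _ (by positivity) Set.inter_subset_left
    ((toOuterMeasure_iteration_le G hμ hn0 hk hpick hI).trans (ENNReal.ofReal_le_ofReal ?_))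
  refine le_trans ?_ he
  have h1 : (1 : ℝ) ≤ (n : ℝ) ^ (1 + 2 * (μ / 8)) := Real.one_le_rpow hn1 (by positivity)
  rw [show (2 * (⌈8 / μ⌉₊ : ℝ)) * (n : ℝ) ^ (1 + 2 * (μ / 8)) * Real.exp (-(n : ℝ) ^ (μ / 8)) =
    ⌈8 / μ⌉₊ * (((n : ℝ) ^ (1 + 2 * (μ / 8)) + (n : ℝ) ^ (1 + 2 * (μ / 8))) *
      Real.exp (-(n : ℝ) ^ (μ / 8))) by ring]
  gcongr

end HungryGreedy
end

noncomputable section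

/-! ### A program logic for machine programs -/

namespace MapReduce

namespace Exp

instance : Add Exp := ⟨.op .add⟩
instance : Sub Exp := ⟨.op .sub⟩
instance : Mul Exp := ⟨.op .mul⟩
instance : Div Exp := ⟨.op .div⟩
instance : Mod Exp := ⟨.op .mod⟩
instance (k : ℕ) : OfNat Exp k := ⟨.const k⟩

/-- The value of an expression as a function of the contents of the memory. -/
def val (P : Cluster) (me : ℕ) (inb : List ℕ) (m : ℕ → ℕ) (e : Exp) : ℕ :=
  e.eval P me inb ⟨m, [], 0⟩

variable (P : Cluster) (me : ℕ) (inb : List ℕ) (m : ℕ → ℕ)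

/-- Evaluation ignores the messages and the clock, which is why `wp` can be a statement about memory
and output alone. -/
lemma eval_eq_val (s : Local) (e : Exp) : e.eval P me inb s = e.val P me inb s.mem := by
  induction e with
  | inbox a ih => simp only [val, eval] at ih ⊢; rw [ih]
  | mem a ih => simp only [val, eval] at ih ⊢; rw [ih]
  | op o a b iha ihb => simp only [val, eval] at iha ihb ⊢; rw [iha, ihb]
  | _ => rfl

@[simp] lemma val_const (k : ℕ) : (Exp.const k).val P me inb m = k := rfl
@[simp] lemma val_numVerts : Exp.numVerts.val P me inb m = P.verts := rfl
@[simp] lemma val_numMachines : Exp.numMachines.val P me inb m = P.machines := rfl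
@[simp] lemma val_self : Exp.self.val P me inb m = me := rfl
@[simp] lemma val_inboxLen : Exp.inboxLen.val P me inb m = inb.length := rfl
@[simp] lemma val_inbox (a : Exp) :
    (Exp.inbox a).val P me inb m = inb.getD (a.val P me inb m) 0 := rfl
@[simp] lemma val_mem (a : Exp) : (Exp.mem a).val P me inb m = m (a.val P me inb m) := rfl
@[simp] lemma val_two : (2 : Exp).val P me inb m = 2 := rfl
@[simp] lemma val_three : (3 : Exp).val P me inb m = 3 := rfl
@[simp] lemma val_four : (4 : Exp).val P me inb m = 4 := rfl
@[simp] lemma val_ten : (10 : Exp).val P me inb m = 10 := rfl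
@[simp] lemma val_zero : (0 : Exp).val P me inb m = 0 := rfl
@[simp] lemma val_one : (1 : Exp).val P me inb m = 1 := rfl
@[simp] lemma val_add (a b : Exp) :
    (a + b).val P me inb m = a.val P me inb m + b.val P me inb m := rfl
@[simp] lemma val_sub (a b : Exp) :
    (a - b).val P me inb m = a.val P me inb m - b.val P me inb m := rfl
@[simp] lemma val_mul (a b : Exp) :
    (a * b).val P me inb m = a.val P me inb m * b.val P me inb m := rfl
@[simp] lemma val_div (a b : Exp) :
    (a / b).val P me inb m = a.val P me inb m / b.val P me inb m := rfl
@[simp] lemma val_mod (a b : Exp) :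
    (a % b).val P me inb m = a.val P me inb m % b.val P me inb m := rfl
@[simp] lemma val_lt (a b : Exp) : (Exp.op .lt a b).val P me inb m =
    if a.val P me inb m < b.val P me inb m then 1 else 0 := rfl
@[simp] lemma val_eq (a b : Exp) : (Exp.op .eq a b).val P me inb m =
    if a.val P me inb m = b.val P me inb m then 1 else 0 := rfl

end Exp

lemma mem_support_uniformBelow {b r : ℕ} : r ∈ (uniformBelow b).support ↔ r < max b 1 :=
  (PMF.mem_support_uniformOfFinset_iff _ r).trans Finset.mem_range

/-- Every possible outcome of `p`, started with memory `m` and output `o`, satisfies `Q`. -/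
def wp (P : Cluster) (me : ℕ) (inb : List ℕ) (p : Prog) (Q : (ℕ → ℕ) → List (ℕ × ℕ) → Prop)
    (m : ℕ → ℕ) (o : List (ℕ × ℕ)) : Prop :=
  ∀ s : Local, s.mem = m → s.out = o → ∀ s' ∈ (p.exec P me inb s).support, Q s'.mem s'.out

section WP

variable {P : Cluster} {me : ℕ} {inb : List ℕ} {Q R : (ℕ → ℕ) → List (ℕ × ℕ) → Prop}
  {m : ℕ → ℕ} {o : List (ℕ × ℕ)}

lemma wp_mono {p : Prog} (h : wp P me inb p R m o) (hRQ : ∀ m' o', R m' o' → Q m' o') :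
    wp P me inb p Q m o :=
  fun s hm ho s' hs' => hRQ _ _ (h s hm ho s' hs')

lemma wp_skip (h : Q m o) : wp P me inb .skip Q m o := by
  rintro s rfl rfl s' hs'
  simp only [Prog.exec, PMF.support_pure, Set.mem_singleton_iff] at hs'
  subst hs'
  exact h

/-- The two side conditions rule out a lost write and a truncated word, so the program logic never
has to mention the space limit or reduction modulo the word bound. -/
lemma wp_store {a e : Exp} (ha : a.val P me inb m < P.space)
    (he : e.val P me inb m < P.wordBound)
    (h : Q (Function.update m (a.val P me inb m) (e.val P me inb m)) o) :
    wp P me inb (.store a e) Q m o := by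
  rintro s rfl rfl s' hs'
  simp only [Prog.exec, PMF.support_pure, Set.mem_singleton_iff] at hs'
  subst hs'
  simpa [Local.write, Local.tick, Exp.eval_eq_val, ha, Nat.mod_eq_of_lt he] using h

lemma wp_rand {a b : Exp} (ha : a.val P me inb m < P.space)
    (hb : b.val P me inb m < P.wordBound)
    (h : ∀ r < max (b.val P me inb m) 1, Q (Function.update m (a.val P me inb m) r) o) :
    wp P me inb (.rand a b) Q m o := by
  rintro s rfl rfl s' hs'
  simp only [Prog.exec, PMF.mem_support_map_iff, mem_support_uniformBelow,
    Exp.eval_eq_val] at hs'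
  obtain ⟨r, hr, rfl⟩ := hs'
  have hr' : r % P.wordBound = r := Nat.mod_eq_of_lt (by omega)
  simpa [Local.write, Local.tick, ha, hr'] using h r hr

lemma wp_send {d e : Exp} (he : e.val P me inb m < P.wordBound)
    (h : Q m (o ++ [(d.val P me inb m, e.val P me inb m)])) :
    wp P me inb (.send d e) Q m o := by
  rintro s rfl rfl s' hs'
  simp only [Prog.exec, PMF.support_pure, Set.mem_singleton_iff] at hs'
  subst hs'
  simpa [Local.emit, Local.tick, Exp.eval_eq_val, Nat.mod_eq_of_lt he] using h

lemma wp_seq {p q : Prog} (h : wp P me inb p (wp P me inb q Q) m o) :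
    wp P me inb (.seq p q) Q m o := by
  rintro s rfl rfl s' hs'
  simp only [Prog.exec, PMF.mem_support_bind_iff] at hs'
  obtain ⟨t, ht, hs'⟩ := hs'
  exact h s rfl rfl t ht t rfl rfl s' hs'

lemma wp_ite {t : Exp} {p q : Prog} (hp : t.val P me inb m ≠ 0 → wp P me inb p Q m o)
    (hq : t.val P me inb m = 0 → wp P me inb q Q m o) : wp P me inb (.ite t p q) Q m o := by
  rintro s rfl rfl s' hs'
  simp only [Prog.exec, Exp.eval_eq_val] at hs'
  split_ifs at hs' with h
  · exact hp h (s.tick (t.cost + 1)) rfl rfl s' hs'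
  · exact hq (not_not.1 h) (s.tick (t.cost + 1)) rfl rfl s' hs'

lemma wp_loop {x : ℕ} {b : Exp} {p : Prog} (Inv : ℕ → (ℕ → ℕ) → List (ℕ × ℕ) → Prop)
    (hx : x < P.space) (hb : b.val P me inb m ≤ P.wordBound) (h0 : Inv 0 m o)
    (hs : ∀ i < b.val P me inb m, ∀ m' o', Inv i m' o' →
      wp P me inb p (Inv (i + 1)) (Function.update m' x i) o')
    (hQ : ∀ m' o', Inv (b.val P me inb m) m' o' → Q m' o') :
    wp P me inb (.loop x b p) Q m o := by
  rintro s rfl rfl s' hs'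
  simp only [Prog.exec, Exp.eval_eq_val] at hs'
  refine hQ _ _ (support_iterate _ (fun i s => Inv i s.mem s.out) _ ?_ _ h0 s' hs')
  intro i hi t ht t' ht'
  refine hs i hi _ _ ht _ ?_ ?_ t' ht'
  · simp [Local.write, Local.tick, hx, Nat.mod_eq_of_lt (hi.trans_le hb)]
  · simp [Local.write, Local.tick, hx]

/-- A loop whose `i`-th pass emits the messages `L i`. -/
lemma wp_loop_emit {x : ℕ} {b : Exp} {p : Prog} (S : (ℕ → ℕ) → Prop) (L : ℕ → List (ℕ × ℕ))
    (hx : x < P.space) (hb : b.val P me inb m ≤ P.wordBound) (h0 : S m)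
    (hS : ∀ m' i, S m' → S (Function.update m' x i))
    (hs : ∀ i < b.val P me inb m, ∀ m' o', S m' → m' x = i →
      wp P me inb p (fun m'' o'' => S m'' ∧ o'' = o' ++ L i) m' o') :
    wp P me inb (.loop x b p) (fun m' o' => S m' ∧
      o' = o ++ (List.range (b.val P me inb m)).flatMap L) m o := by
  refine wp_loop (fun i m' o' => S m' ∧ o' = o ++ (List.range i).flatMap L) hx hb
    ⟨h0, by simp⟩ ?_ fun m' o' h => h
  rintro i hi m' o' ⟨h1, rfl⟩
  refine wp_mono (hs i hi _ _ (hS _ _ h1) (by simp)) ?_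
  rintro m'' o'' ⟨h2, rfl⟩
  exact ⟨h2, by simp [List.range_succ, List.flatMap_append]⟩

end WP

/-! ### Running times -/

/-- All loop bounds of the program are at most `B`. -/
def Prog.BoundedBy (P : Cluster) (me : ℕ) (inb : List ℕ) (B : ℕ) : Prog → Prop
  | .seq p q => p.BoundedBy P me inb B ∧ q.BoundedBy P me inb B
  | .ite _ p q => p.BoundedBy P me inb B ∧ q.BoundedBy P me inb B
  | .loop _ b p => (∀ m, b.val P me inb m ≤ B) ∧ p.BoundedBy P me inb B
  | _ => True

/-- The exponent in the bound for the running time. -/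
def Prog.weight : Prog → ℕ
  | .skip => 1
  | .store a e => a.cost + e.cost + 1
  | .rand a b => a.cost + b.cost + 1
  | .send d e => d.cost + e.cost + 1
  | .seq p q => p.weight + q.weight + 1
  | .ite t p q => t.cost + p.weight + q.weight + 2
  | .loop _ b p => b.cost + p.weight + 4

lemma le_pow_self {B : ℕ} (hB : 2 ≤ B) (k : ℕ) : k ≤ B ^ k := (Nat.lt_pow_self (by omega)).le

lemma pow_add_pow_le {B : ℕ} (hB : 2 ≤ B) (a b : ℕ) : B ^ a + B ^ b ≤ B ^ (a + b + 1) := by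
  have h1 : B ^ a ≤ B ^ (a + b) := Nat.pow_le_pow_right (by omega) (by omega)
  have h2 : B ^ b ≤ B ^ (a + b) := Nat.pow_le_pow_right (by omega) (by omega)
  calc B ^ a + B ^ b ≤ B ^ (a + b) * 2 := by omega
    _ ≤ B ^ (a + b) * B := by gcongr
    _ = _ := (pow_succ _ _).symm

/-- The running time is at most polynomial in the bound for the lengths of the loops. -/
lemma time_exec_le {P : Cluster} {me : ℕ} {inb : List ℕ} {B : ℕ} (hB : 2 ≤ B) (p : Prog)
    (hp : p.BoundedBy P me inb B) (s : Local) :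
    ∀ s' ∈ (p.exec P me inb s).support, s'.time ≤ s.time + B ^ p.weight := by
  have hwt : ∀ (s : Local) a v, (s.write P a v).time = s.time := fun s a v => by
    simp only [Local.write]; split_ifs <;> rfl
  induction p generalizing s with
  | skip =>
    intro s' hs'
    simp only [Prog.exec, PMF.support_pure, Set.mem_singleton_iff] at hs'
    subst hs'
    simp only [Local.tick, Prog.weight, pow_one]; omega
  | store a e =>
    intro s' hs'
    simp only [Prog.exec, PMF.support_pure, Set.mem_singleton_iff] at hs'
    subst hs'
    simp only [Local.tick, hwt, Prog.weight]
    exact Nat.add_le_add_left (le_pow_self hB _) _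
  | rand a b =>
    intro s' hs'
    simp only [Prog.exec, PMF.mem_support_map_iff] at hs'
    obtain ⟨r, _, rfl⟩ := hs'
    simp only [Local.tick, hwt, Prog.weight]
    exact Nat.add_le_add_left (le_pow_self hB _) _
  | send d e =>
    intro s' hs'
    simp only [Prog.exec, PMF.support_pure, Set.mem_singleton_iff] at hs'
    subst hs'
    simp only [Local.tick, Local.emit, Prog.weight]
    exact Nat.add_le_add_left (le_pow_self hB _) _
  | seq p q ihp ihq =>
    intro s' hs'
    simp only [Prog.exec, PMF.mem_support_bind_iff] at hs'
    obtain ⟨t, ht, hs'⟩ := hs'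
    have h1 := ihp hp.1 s t ht
    have h2 := ihq hp.2 t s' hs'
    have h3 := pow_add_pow_le hB p.weight q.weight
    simp only [Prog.weight]; omega
  | ite t p q ihp ihq =>
    intro s' hs'
    simp only [Prog.exec] at hs'
    have h1 := pow_add_pow_le hB p.weight q.weight
    have h2 := pow_add_pow_le hB t.cost (p.weight + q.weight + 1)
    have h3 := Nat.lt_pow_self (n := t.cost) (by omega : 1 < B)
    have h4 : 0 < B ^ p.weight := Nat.pow_pos (by omega)
    have h5 : 0 < B ^ q.weight := Nat.pow_pos (by omega)
    have h6 : t.cost + (p.weight + q.weight + 1) + 1 = (Prog.ite t p q).weight := by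
      simp only [Prog.weight]; omega
    rw [h6] at h2
    split_ifs at hs'
    · have := ihp hp.1 _ s' hs'
      simp only [Local.tick] at this; omega
    · have := ihq hp.2 _ s' hs'
      simp only [Local.tick] at this; omega
  | loop x b p ih =>
    intro s' hs'
    simp only [Prog.exec] at hs'
    have h1 := support_iterate _ (fun i t => t.time ≤ s.time + (b.cost + 1) +
      i * (B ^ p.weight + 1)) _ ?_ (s.tick (b.cost + 1)) (by simp [Local.tick]) s' hs'
    · have hbB : b.eval P me inb s ≤ B := by rw [Exp.eval_eq_val]; exact hp.1 _
      have h2 : b.eval P me inb s * (B ^ p.weight + 1) ≤ B * (B ^ p.weight + 1) := by gcongr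
      -- At most `B` passes, each costing its body plus one step; a further factor `B ≥ 2` absorbs
      -- the extra step.
      have h3 : B * (B ^ p.weight + 1) ≤ B ^ (p.weight + 2) := by
        have := Nat.one_le_pow p.weight B (by omega)
        calc B * (B ^ p.weight + 1) ≤ B * (B ^ p.weight * B) := by gcongr; nlinarith
          _ = _ := by ring
      have h4 := pow_add_pow_le hB (b.cost + 1) (p.weight + 2)
      have h5 := le_pow_self hB (b.cost + 1)
      simp only [Prog.weight]
      rw [show b.cost + p.weight + 4 = b.cost + 1 + (p.weight + 2) + 1 by omega]
      omega
    · intro i hi t ht t' ht'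
      have := ih hp.2 _ t' ht'
      simp only [Local.tick, hwt] at this
      rw [add_one_mul]
      omega

end MapReduce
end

noncomputable section

/-! ### The programs of the algorithm and their specifications

Memory cells below `10` hold counters and temporary values; cell `10 + x` with `x < 3 * n` is a mark:
`x = v` says that `v` lies in the independent set, `x = n + v` that `v` is dominated, and
`x = 2 * n + v` that `v` is in the current sample. Words below `n * n` are edges of the input, the
word `n * n + x` is the mark `x`, and `n * n + 3 * n + e` is the edge `e`, sent to machine `0`. -/

namespace MapReduce

namespace Prog

/-- Translate the marks in the inbox to the memory. -/
def load : Prog :=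
  .loop 0 .inboxLen (.ite (.op .lt (.inbox (.mem 0)) (.numVerts * .numVerts + 3 * .numVerts) -
      .op .lt (.inbox (.mem 0)) (.numVerts * .numVerts))
    (.store (10 + (.inbox (.mem 0) - .numVerts * .numVerts)) 1) .skip)

/-- Emit the marks `x < tags * n`, encoded as `base + x`, to all machines `j` for which
`x % n % numMachines` is the value of `χ`; `χ` may refer to `j` as `.mem 2`. -/
def emitMarks (base : Exp) (tags : ℕ) (χ : Exp) : Prog :=
  .loop 1 (.const tags * .numVerts) (.ite (.mem (10 + .mem 1))
    (.loop 2 .numMachines (.ite (.op .eq (.mem 1 % .numVerts % .numMachines) χ)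
      (.send (.mem 2) (base + .mem 1)) .skip)) .skip)

/-- Keep the edges of the input. -/
def keepEdges : Prog :=
  .loop 1 .inboxLen (.ite (.op .lt (.inbox (.mem 1)) (.numVerts * .numVerts))
    (.send .self (.inbox (.mem 1))) .skip)

/-- The vertex `v` is sampled and neither chosen nor dominated. -/
def eligible (v : Exp) : Exp :=
  .mem (10 + 2 * .numVerts + v) * .op .eq (.mem (10 + v) + .mem (10 + .numVerts + v)) 0

/-- Send the edges between eligible vertices to machine `0`. -/
def gatherEdges : Prog :=
  .loop 1 .inboxLen (.ite (.op .lt (.inbox (.mem 1)) (.numVerts * .numVerts) *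
      (eligible (.inbox (.mem 1) / .numVerts) * eligible (.inbox (.mem 1) % .numVerts)))
    (.send 0 (.numVerts * .numVerts + 3 * .numVerts + .inbox (.mem 1))) .skip)

/-- Write the iterated rounded-up square root of the number of machines to cell `3`. -/
def iteratedRoot : ℕ → Prog
  | 0 => .store 3 .numMachines
  | k + 1 => .seq (iteratedRoot k) (.seq (.store 4 0) (.seq
      (.loop 1 .numMachines (.store 4 (.mem 4 + .op .lt (.mem 4 * .mem 4) (.mem 3))))
      (.store 3 (.mem 4))))

/-- Sample every vertex with probability `1 / a`, where `a` is the content of cell `3`. -/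
def flipCoins : Prog :=
  .loop 1 .numVerts (.seq (.rand (10 + 2 * .numVerts + .mem 1) (.mem 3))
    (.store (10 + 2 * .numVerts + .mem 1) (.op .eq (.mem (10 + 2 * .numVerts + .mem 1)) 0)))

/-- Process one gathered edge in the greedy algorithm: if the vertex in cell `1` is one end of the
edge, then mark the other end as dominated. -/
def dominateAlong (e : Exp) : Prog :=
  .seq (.ite (.op .eq (e / .numVerts) (.mem 1))
      (.store (10 + .numVerts + e % .numVerts) 1) .skip)
    (.ite (.op .eq (e % .numVerts) (.mem 1)) (.store (10 + .numVerts + e / .numVerts) 1) .skip)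

/-- The greedy algorithm on the eligible vertices, with the gathered edges. -/
def greedy : Prog :=
  .loop 1 .numVerts (.ite (eligible (.mem 1)) (.seq (.store (10 + .mem 1) 1)
    (.loop 2 .inboxLen (.ite (.op .lt (.inbox (.mem 2)) (.numVerts * .numVerts + 3 * .numVerts)) .skip
      (dominateAlong (.inbox (.mem 2) - (.numVerts * .numVerts + 3 * .numVerts)))))) .skip)

/-- Mark the neighbours of chosen vertices along the edges of the input. -/
def dominate : Prog :=
  .loop 1 .inboxLen (.ite (.op .lt (.inbox (.mem 1)) (.numVerts * .numVerts))
    (.seq (.ite (.mem (10 + .inbox (.mem 1) / .numVerts))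
        (.store (10 + .numVerts + .inbox (.mem 1) % .numVerts) 1) .skip)
      (.ite (.mem (10 + .inbox (.mem 1) % .numVerts))
        (.store (10 + .numVerts + .inbox (.mem 1) / .numVerts) 1) .skip)) .skip)

end Prog

/-- The cluster is large enough for the programs below. -/
structure Cluster.Fits (P : Cluster) : Prop where
  verts_pos : 0 < P.verts
  machines_pos : 0 < P.machines
  machines_le : P.machines ≤ P.verts
  le_space : 10 + 3 * P.verts ≤ P.space
  space_le : P.space ≤ P.wordBound
  words_le : P.verts * P.verts + 3 * P.verts + P.verts * P.verts ≤ P.wordBound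

/-- The marks in the memory are those in `X`. -/
def Marks (P : Cluster) (X : Finset ℕ) (m : ℕ → ℕ) : Prop :=
  ∀ x < 3 * P.verts, m (10 + x) = if x ∈ X then 1 else 0

/-- The marks in an inbox. -/
def inboxMarks (P : Cluster) (inb : List ℕ) : Finset ℕ :=
  {x ∈ Finset.range (3 * P.verts) | P.verts * P.verts + x ∈ inb}

/-! ### Correctness of loading marks and emitting messages -/

section Specs

variable {P : Cluster} {me : ℕ} {inb : List ℕ} {m : ℕ → ℕ} {o : List (ℕ × ℕ)} {X : Finset ℕ}

lemma Marks.update_of_lt (h : Marks P X m) {a : ℕ} (ha : a < 10) (v : ℕ) :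
    Marks P X (Function.update m a v) := by
  intro x hx
  rw [Function.update_of_ne (by omega), h x hx]

lemma Marks.set (h : Marks P X m) {x : ℕ} :
    Marks P (insert x X) (Function.update m (10 + x) 1) := by
  intro y hy
  by_cases hxy : y = x
  · subst hxy; simp
  · rw [Function.update_of_ne (by omega), h y hy]
    simp [hxy]

lemma Marks.congr {Y : Finset ℕ} (h : Marks P X m) (hXY : ∀ x < 3 * P.verts, x ∈ X ↔ x ∈ Y) :
    Marks P Y m := by
  intro x hx
  rw [h x hx]
  simp [hXY x hx]

lemma wp_load (hP : P.Fits) (hinb : inb.length ≤ P.space)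
    (hm : ∀ x < 3 * P.verts, m (10 + x) = 0) :
    wp P me inb .load (fun m' o' => Marks P (inboxMarks P inb) m' ∧ o' = o) m o := by
  have h1 := hP.le_space
  have h2 := hP.space_le
  refine wp_loop (fun i m' o' => Marks P (inboxMarks P (inb.take i)) m' ∧ o' = o) (by omega)
    (by simpa using hinb.trans h2) ⟨fun x hx => by simp [hm x hx, inboxMarks], rfl⟩ ?_ ?_
  · rintro i hi m' o' ⟨hM, rfl⟩
    simp only [Exp.val_inboxLen] at hi
    have hget : inb.getD i 0 = inb[i] := by simp [hi]
    have hM' := hM.update_of_lt (show 0 < 10 by omega) i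
    refine wp_ite (fun h => ?_) (fun h => wp_skip ?_)
    -- The test is a difference of two comparisons, which is `1` exactly on the interval of words
    -- that encode marks.
    · have hw : P.verts * P.verts ≤ inb[i] ∧ inb[i] < P.verts * P.verts + 3 * P.verts := by
        simp [hi] at h
        split_ifs at h <;> omega
      refine wp_store ?_ ?_ ⟨?_, rfl⟩
      · simp [hi]; omega
      · simp; omega
      · simp only [Exp.val_add, Exp.val_ten, Exp.val_sub, Exp.val_inbox, Exp.val_mem, Exp.val_zero,
          Function.update_self, Exp.val_mul, Exp.val_numVerts, Exp.val_one, hget]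
        refine (hM'.set (x := inb[i] - P.verts * P.verts)).congr fun x hx => ?_
        simp only [inboxMarks, Finset.mem_insert, Finset.mem_filter, Finset.mem_range, hx, true_and,
          List.take_add_one, List.getElem?_eq_getElem hi, Option.toList_some, List.mem_append,
          List.mem_singleton]
        constructor
        · rintro (h | h)
          · right; omega
          · exact Or.inl h
        · rintro (h | h)
          · exact Or.inr h
          · left; omega
    · refine ⟨hM'.congr fun x hx => ?_, rfl⟩
      have hw : ¬(P.verts * P.verts ≤ inb[i] ∧ inb[i] < P.verts * P.verts + 3 * P.verts) := by
        simp [hi] at h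
        split_ifs at h <;> omega
      simp only [inboxMarks, Finset.mem_filter, Finset.mem_range, hx, true_and,
          List.take_add_one, List.getElem?_eq_getElem hi, Option.toList_some, List.mem_append,
          List.mem_singleton]
      constructor
      · exact Or.inl
      · rintro (h | h)
        · exact h
        · omega
  · rintro m' o' ⟨h, rfl⟩
    simpa using h

/-- The messages emitted by `Prog.emitMarks`. -/
def markMessages (P : Cluster) (base tags : ℕ) (χ : ℕ → ℕ) (X : Finset ℕ) : List (ℕ × ℕ) :=
  (List.range (tags * P.verts)).flatMap fun x => if x ∈ X then
    (List.range P.machines).flatMap fun j =>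
      if x % P.verts % P.machines = χ j then [(j, base + x)] else [] else []

lemma wp_emitMarks (hP : P.Fits) (hX : Marks P X m) {base χ : Exp} {b : ℕ} {c : ℕ → ℕ} {tags : ℕ}
    (ht : tags ≤ 3) (hb : b ≤ P.verts * P.verts) (hbase : ∀ m, base.val P me inb m = b)
    (hχ : ∀ m, χ.val P me inb m = c (m 2)) :
    wp P me inb (.emitMarks base tags χ)
      (fun m' o' => Marks P X m' ∧ o' = o ++ markMessages P b tags c X) m o := by
  have h1 := hP.le_space
  have h2 := hP.space_le
  have h3 := hP.machines_le
  have h4 := hP.words_le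
  have htn : tags * P.verts ≤ 3 * P.verts := by gcongr
  have key := wp_loop_emit (P := P) (me := me) (inb := inb) (m := m) (o := o) (x := 1)
    (b := .const tags * .numVerts) (p := .ite (.mem (10 + .mem 1))
    (.loop 2 .numMachines (.ite (.op .eq (.mem 1 % .numVerts % .numMachines) χ)
      (.send (.mem 2) (base + .mem 1)) .skip)) .skip) (Marks P X)
    (fun x => if x ∈ X then (List.range P.machines).flatMap fun j =>
      if x % P.verts % P.machines = c j then [(j, b + x)] else [] else [])
    (by omega) (by simp; omega) hX (fun m' i h => h.update_of_lt (by omega) _) ?_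
  · exact wp_mono key fun m' o' h => h
  · intro x hx m' o' hM hmx
    simp only [Exp.val_mul, Exp.val_const, Exp.val_numVerts] at hx
    have hx3 : x < 3 * P.verts := by omega
    have hval : m' (10 + x) = if x ∈ X then 1 else 0 := hM x hx3
    refine wp_ite (fun h => ?_) (fun h => wp_skip ?_)
    · have hxX : x ∈ X := by
        simp [hmx, hval] at h
        exact h
      rw [if_pos hxX]
      refine wp_mono (wp_loop_emit (fun m'' => Marks P X m'' ∧ m'' 1 = x) (fun j =>
        if x % P.verts % P.machines = c j then [(j, b + x)] else []) (by omega)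
        (by simp; omega) ⟨hM, hmx⟩ (fun m'' i h => ⟨h.1.update_of_lt (by omega) _, ?_⟩) ?_) ?_
      · simpa using h.2
      · rintro j hj m'' o'' ⟨hM'', hmx''⟩ hmj
        refine wp_ite (fun h => wp_send ?_ ⟨⟨hM'', hmx''⟩, ?_⟩)
          (fun h => wp_skip ⟨⟨hM'', hmx''⟩, ?_⟩)
        · simp [hbase, hmx'']
          nlinarith [hP.verts_pos]
        · have : x % P.verts % P.machines = c j := by
            simpa [hχ, hmx'', hmj] using h
          simp [hbase, hmx'', hmj, this]
        · have : ¬x % P.verts % P.machines = c j := by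
            simpa [hχ, hmx'', hmj] using h
          simp [this]
      · rintro m'' o'' ⟨hM'', h⟩
        exact ⟨hM''.1, h⟩
    · have hxX : x ∉ X := by
        simp [hmx, hval] at h
        exact h
      simp [hxX, hM]

lemma flatMap_range_getD (inb : List ℕ) (f : ℕ → List (ℕ × ℕ)) :
    ((List.range inb.length).flatMap fun i => f (inb.getD i 0)) = inb.flatMap f := by
  induction inb using List.reverseRecOn with
  | nil => simp
  | append_singleton l a ih =>
    rw [List.length_append, List.length_singleton, List.range_succ, List.flatMap_append,
      List.flatMap_append, ← ih]
    congr 1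
    · refine List.flatMap_congr fun i hi => ?_
      rw [List.mem_range] at hi
      rw [List.getD_append _ _ _ _ hi]
    · simp

lemma flatMap_ite_singleton {α β : Type} (l : List α) (p : α → Prop) [DecidablePred p]
    (f : α → β) : (l.flatMap fun a => if p a then [f a] else []) = (l.filter p).map f := by
  induction l with
  | nil => simp
  | cons a l ih => by_cases h : p a <;> simp [h, ih]

lemma wp_keepEdges (hP : P.Fits) (hinb : inb.length ≤ P.space) (hX : Marks P X m) :
    wp P me inb .keepEdges (fun m' o' => Marks P X m' ∧
      o' = o ++ (inb.filter (· < P.verts * P.verts)).map fun w => (me, w)) m o := by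
  have h1 := hP.le_space
  have h2 := hP.space_le
  have h4 := hP.words_le
  refine wp_mono (wp_loop_emit (Marks P X)
    (fun i => if inb.getD i 0 < P.verts * P.verts then [(me, inb.getD i 0)] else [])
    (by omega) (by simp; omega) hX (fun m' i h => h.update_of_lt (by omega) _) ?_) ?_
  · intro i hi m' o' hM hmi
    refine wp_ite (fun h => wp_send ?_ ⟨hM, ?_⟩) (fun h => wp_skip ⟨hM, ?_⟩)
    all_goals
      simp only [Exp.val_lt, Exp.val_inbox, Exp.val_mem, Exp.val_one, hmi, Exp.val_mul,
        Exp.val_numVerts, Exp.val_self] at h ⊢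
    · split_ifs at h
      · omega
      · exact absurd rfl h
    · split_ifs at h ⊢
      · rfl
      · exact absurd rfl h
    · split_ifs at h ⊢
      simp
  · rintro m' o' ⟨hM, rfl⟩
    refine ⟨hM, ?_⟩
    rw [Exp.val_inboxLen, flatMap_range_getD inb (fun w => if w < P.verts * P.verts then [(me, w)]
      else []), flatMap_ite_singleton]

/-- The vertices that are sampled and neither chosen nor dominated. -/
def eligibleSet (P : Cluster) (X : Finset ℕ) : Finset ℕ :=
  {v ∈ Finset.range P.verts | 2 * P.verts + v ∈ X ∧ v ∉ X ∧ P.verts + v ∉ X}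

lemma val_eligible (hX : Marks P X m) {e : Exp} {v : ℕ} (hv : e.val P me inb m = v)
    (hvn : v < P.verts) :
    (Prog.eligible e).val P me inb m = if v ∈ eligibleSet P X then 1 else 0 := by
  have h1 := hX v (by omega)
  have h2 := hX (P.verts + v) (by omega)
  have h3 := hX (2 * P.verts + v) (by omega)
  simp only [Prog.eligible, Exp.val_mul, Exp.val_mem, Exp.val_add, Exp.val_ten, Exp.val_two, Exp.val_numVerts,
    Exp.val_eq, Exp.val_zero, hv, eligibleSet, Finset.mem_filter, Finset.mem_range, hvn, true_and]
  rw [add_assoc 10, add_assoc 10, h1, h2, h3]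
  split_ifs <;> simp_all

lemma wp_gatherEdges (hP : P.Fits) (hinb : inb.length ≤ P.space) (hX : Marks P X m) :
    wp P me inb .gatherEdges (fun m' o' => Marks P X m' ∧
      o' = o ++ (inb.filter fun w => w < P.verts * P.verts ∧ w / P.verts ∈ eligibleSet P X ∧
        w % P.verts ∈ eligibleSet P X).map
          fun w => (0, P.verts * P.verts + 3 * P.verts + w)) m o := by
  have h1 := hP.le_space
  have h2 := hP.space_le
  have h4 := hP.words_le
  refine wp_mono (wp_loop_emit (Marks P X)
    (fun i => if inb.getD i 0 < P.verts * P.verts ∧ inb.getD i 0 / P.verts ∈ eligibleSet P X ∧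
        inb.getD i 0 % P.verts ∈ eligibleSet P X then
      [(0, P.verts * P.verts + 3 * P.verts + inb.getD i 0)] else [])
    (by omega) (by simp; omega) hX (fun m' i h => h.update_of_lt (by omega) _) ?_) ?_
  · intro i hi m' o' hM hmi
    have hval : (Exp.op .lt (.inbox (.mem 1)) (.numVerts * .numVerts) *
      (Prog.eligible (.inbox (.mem 1) / .numVerts) *
        Prog.eligible (.inbox (.mem 1) % .numVerts))).val P me inb m' =
        if inb.getD i 0 < P.verts * P.verts ∧ inb.getD i 0 / P.verts ∈ eligibleSet P X ∧
          inb.getD i 0 % P.verts ∈ eligibleSet P X then 1 else 0 := by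
      simp only [Exp.val_mul, Exp.val_lt, Exp.val_inbox, Exp.val_mem, Exp.val_one, hmi,
        Exp.val_numVerts]
      by_cases hw : inb.getD i 0 < P.verts * P.verts
      · rw [val_eligible hM (v := inb.getD i 0 / P.verts)
          (by simp only [Exp.val_div, Exp.val_inbox, Exp.val_mem, Exp.val_one, hmi, Exp.val_numVerts])
          (Nat.div_lt_of_lt_mul hw),
          val_eligible hM (v := inb.getD i 0 % P.verts)
          (by simp only [Exp.val_mod, Exp.val_inbox, Exp.val_mem, Exp.val_one, hmi, Exp.val_numVerts])
          (Nat.mod_lt _ hP.verts_pos)]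
        split_ifs <;> simp_all
      · rw [if_neg hw, if_neg fun h => hw h.1, zero_mul]
    refine wp_ite (fun h => wp_send ?_ ⟨hM, ?_⟩) (fun h => wp_skip ⟨hM, ?_⟩)
    all_goals
      rw [hval] at h
      try simp only [Exp.val_add, Exp.val_inbox, Exp.val_mem, Exp.val_one, hmi, Exp.val_mul,
        Exp.val_numVerts, Exp.val_three, Exp.val_zero]
    · split_ifs at h with hc
      · omega
      · exact absurd rfl h
    · split_ifs at h ⊢
      · rfl
      · exact absurd rfl h
    · split_ifs at h ⊢
      simp
  · rintro m' o' ⟨hM, rfl⟩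
    refine ⟨hM, ?_⟩
    rw [Exp.val_inboxLen, flatMap_range_getD inb (fun w => if w < P.verts * P.verts ∧
      w / P.verts ∈ eligibleSet P X ∧ w % P.verts ∈ eligibleSet P X then
      [(0, P.verts * P.verts + 3 * P.verts + w)] else []), flatMap_ite_singleton]

end Specs

end MapReduce
end

/-! ### Correctness of the domination and greedy programs -/

noncomputable section

namespace MapReduce

section Specs

variable {P : Cluster} {me : ℕ} {inb : List ℕ} {m : ℕ → ℕ} {o : List (ℕ × ℕ)} {X : Finset ℕ}

/-- A loop over the inbox. -/
lemma wp_loop_inbox {x : ℕ} {p : Prog} (Inv : List ℕ → (ℕ → ℕ) → List (ℕ × ℕ) → Prop)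
    (hx : x < P.space) (hb : inb.length ≤ P.wordBound) (h0 : Inv [] m o)
    (hs : ∀ pre w i m' o', w ∈ inb → inb.getD i 0 = w → Inv pre m' o' →
      wp P me inb p (Inv (pre ++ [w])) (Function.update m' x i) o') :
    wp P me inb (.loop x .inboxLen p) (Inv inb) m o := by
  refine wp_loop (fun i m' o' => Inv (inb.take i) m' o') hx (by simpa using hb) (by simpa using h0)
    ?_ ?_
  · intro i hi m' o' h
    simp only [Exp.val_inboxLen] at hi
    rw [List.take_add_one, List.getElem?_eq_getElem hi, Option.toList_some]
    exact hs _ _ i _ _ (List.getElem_mem hi) (by simp [hi]) h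
  · intro m' o' h
    simpa using h

/-- Setting the mark `x` if the condition `c` holds. -/
lemma wp_markIf (hP : P.Fits) (hX : Marks P X m) {t a : Exp} {c : Prop} {x : ℕ}
    (ht : t.val P me inb m ≠ 0 ↔ c) (ha : a.val P me inb m = 10 + x) (hx : x < 3 * P.verts)
    {Q : (ℕ → ℕ) → List (ℕ × ℕ) → Prop}
    (h : ∀ m' Y, Marks P Y m' → (∀ y, y ∈ Y ↔ y ∈ X ∨ c ∧ y = x) → (∀ b < 10, m' b = m b) →
      Q m' o) :
    wp P me inb (.ite t (.store a 1) .skip) Q m o := by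
  have h1 := hP.le_space
  have h2 := hP.space_le
  refine wp_ite (fun hc => wp_store (by omega) (by simp; omega) ?_) (fun hc => wp_skip ?_)
  · rw [ha]
    refine h _ _ hX.set ?_ fun b hb => ?_
    · intro y
      simp [ht.1 hc, or_comm]
    · rw [Function.update_of_ne (by omega)]
  · refine h _ _ hX ?_ fun b hb => rfl
    intro y
    have hc' : ¬c := fun h' => ht.2 h' hc
    simp [hc']

/-- `Y` arises from `X` by marking the neighbours of the chosen vertices along the edges in the
list `l`. -/
def IsDominated (P : Cluster) (l : List ℕ) (X Y : Finset ℕ) : Prop :=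
  ∀ y, y ∈ Y ↔ y ∈ X ∨ ∃ w ∈ l, w < P.verts * P.verts ∧
    (w / P.verts ∈ X ∧ y = P.verts + w % P.verts ∨ w % P.verts ∈ X ∧ y = P.verts + w / P.verts)

lemma wp_dominate (hP : P.Fits) (hinb : inb.length ≤ P.space) (hX : Marks P X m) :
    wp P me inb .dominate
      (fun m' o' => ∃ Y, Marks P Y m' ∧ IsDominated P inb X Y ∧ o' = o) m o := by
  have h1 := hP.le_space
  have h2 := hP.space_le
  refine wp_loop_inbox (fun l m' o' => ∃ Y, Marks P Y m' ∧ IsDominated P l X Y ∧ o' = o)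
    (by omega) (by omega) ⟨X, hX, by simp [IsDominated], rfl⟩ ?_
  rintro pre w i m' o' hw hwi ⟨Y, hM, hY, rfl⟩
  have hM := hM.update_of_lt (show 1 < 10 by omega) i
  have hm1 : Function.update m' 1 i 1 = i := by simp
  generalize Function.update m' 1 i = m₁ at hM hm1
  refine wp_ite (fun h => wp_seq ?_) (fun h => wp_skip ⟨Y, hM, fun y => ?_, rfl⟩)
  all_goals
    simp only [Exp.val_lt, Exp.val_inbox, Exp.val_mem, Exp.val_one, hm1, Exp.val_mul,
      Exp.val_numVerts, hwi] at h
  · have hwn : w < P.verts * P.verts := by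
      by_contra hcon
      simp [hcon] at h
    have hu : w / P.verts < P.verts := Nat.div_lt_of_lt_mul hwn
    have hv : w % P.verts < P.verts := Nat.mod_lt _ hP.verts_pos
    -- The loop adds only domination marks, which are at least `n`. So testing whether an end is
    -- chosen in the current marks is the same as testing it in the original ones.
    have hlow : ∀ u < P.verts, u ∈ Y ↔ u ∈ X := by
      intro u hu
      rw [hY]
      constructor
      · rintro (h | ⟨w', _, _, ⟨_, h⟩ | ⟨_, h⟩⟩)
        · exact h
        all_goals exact absurd hu (by rw [h]; exact (Nat.le_add_right _ _).not_gt)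
      · exact Or.inl
    refine wp_markIf hP hM (c := w / P.verts ∈ X) (x := P.verts + w % P.verts) ?_ ?_ (by omega) ?_
    · simp only [Exp.val_inbox, Exp.val_mem, Exp.val_one, hm1, hwi, Exp.val_add, Exp.val_ten,
        Exp.val_div, Exp.val_numVerts]
      rw [hM _ (by omega), ← hlow _ hu]
      simp
    · simp only [Exp.val_inbox, Exp.val_mem, Exp.val_one, hm1, hwi, Exp.val_add, Exp.val_ten,
        Exp.val_mod, Exp.val_numVerts]
      omega
    intro m₂ Y₂ hM₂ hY₂ hc₂
    have hm2 : m₂ 1 = i := by rw [hc₂ 1 (by omega), hm1]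
    refine wp_markIf hP hM₂ (c := w % P.verts ∈ X) (x := P.verts + w / P.verts) ?_ ?_ (by omega) ?_
    · simp only [Exp.val_inbox, Exp.val_mem, Exp.val_one, hm2, hwi, Exp.val_add, Exp.val_ten,
        Exp.val_mod, Exp.val_numVerts]
      rw [hM₂ _ (by omega), ← hlow _ hv]
      have : w % P.verts ∈ Y₂ ↔ w % P.verts ∈ Y := by
        rw [hY₂]
        exact or_iff_left (by omega)
      simp [this]
    · simp only [Exp.val_inbox, Exp.val_mem, Exp.val_one, hm2, hwi, Exp.val_add, Exp.val_ten,
        Exp.val_div, Exp.val_numVerts]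
      omega
    intro m₃ Y₃ hM₃ hY₃ hc₃
    refine ⟨Y₃, hM₃, fun y => ?_, rfl⟩
    rw [hY₃, hY₂, hY]
    simp only [List.mem_append, List.mem_singleton, or_and_right, exists_or, exists_eq_left, hwn,
      true_and, or_assoc]
  · have hwn : ¬w < P.verts * P.verts := by
      by_contra hcon
      simp [hcon] at h
    rw [hY]
    simp only [List.mem_append, List.mem_singleton, or_and_right, exists_or, exists_eq_left, hwn,
      false_and, or_false]

/-- Adjacency along the gathered edges in the list `l`. -/
def GatheredAdj (P : Cluster) (l : List ℕ) (u v : ℕ) : Prop :=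
  ∃ w ∈ l, P.verts * P.verts + 3 * P.verts ≤ w ∧
    ((w - (P.verts * P.verts + 3 * P.verts)) / P.verts = u ∧
      (w - (P.verts * P.verts + 3 * P.verts)) % P.verts = v ∨
    (w - (P.verts * P.verts + 3 * P.verts)) % P.verts = u ∧
      (w - (P.verts * P.verts + 3 * P.verts)) / P.verts = v)

lemma gatheredAdj_append_singleton {l : List ℕ} {w u v : ℕ} :
    GatheredAdj P (l ++ [w]) u v ↔ GatheredAdj P l u v ∨
      P.verts * P.verts + 3 * P.verts ≤ w ∧
      ((w - (P.verts * P.verts + 3 * P.verts)) / P.verts = u ∧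
        (w - (P.verts * P.verts + 3 * P.verts)) % P.verts = v ∨
      (w - (P.verts * P.verts + 3 * P.verts)) % P.verts = u ∧
        (w - (P.verts * P.verts + 3 * P.verts)) / P.verts = v) := by
  simp only [GatheredAdj, List.mem_append, List.mem_singleton, or_and_right, exists_or,
    exists_eq_left]

open Classical in
/-- The vertices that the greedy algorithm on `U` with adjacency relation `R` has chosen after the
vertices below `i` have been processed. -/
def greedySet (R : ℕ → ℕ → Prop) (U : Finset ℕ) : ℕ → Finset ℕ
  | 0 => ∅
  | i + 1 => if i ∈ U ∧ ∀ u ∈ greedySet R U i, ¬R u i then insert i (greedySet R U i)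
      else greedySet R U i

lemma lt_of_mem_greedySet {R : ℕ → ℕ → Prop} {U : Finset ℕ} {i u : ℕ}
    (h : u ∈ greedySet R U i) : u < i := by
  induction i with
  | zero => simp [greedySet] at h
  | succ i ih =>
    rw [greedySet] at h
    split_ifs at h
    · rcases Finset.mem_insert.1 h with rfl | h
      · omega
      · have := ih h; omega
    · have := ih h; omega

/-- `Y` arises from `X` by marking the vertices in `J` as chosen and their neighbours with respect
to `R` as dominated. -/
def IsExtension (P : Cluster) (R : ℕ → ℕ → Prop) (J X Y : Finset ℕ) : Prop :=
  ∀ y, y ∈ Y ↔ y ∈ X ∨ y ∈ J ∨ ∃ v < P.verts, y = P.verts + v ∧ ∃ u ∈ J, R u v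

lemma wp_dominateAlong (hP : P.Fits) {Y : Finset ℕ} (hM : Marks P Y m) {i w : ℕ} {e : Exp}
    (he : ∀ m', (∀ b < 10, m' b = m b) → e.val P me inb m' = w) (hm1 : m 1 = i)
    (hwn : w < P.verts * P.verts) :
    wp P me inb (.dominateAlong e) (fun m' o' => (∃ Z, Marks P Z m' ∧ ∀ y, y ∈ Z ↔ y ∈ Y ∨
      ∃ v, y = P.verts + v ∧ (w / P.verts = i ∧ w % P.verts = v ∨
        w % P.verts = i ∧ w / P.verts = v)) ∧ m' 1 = i ∧ o' = o) m o := by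
  have hu : w / P.verts < P.verts := Nat.div_lt_of_lt_mul hwn
  have hv : w % P.verts < P.verts := Nat.mod_lt _ hP.verts_pos
  refine wp_seq (wp_markIf hP hM (c := w / P.verts = i) (x := P.verts + w % P.verts) ?_ ?_
    (by omega) fun m₂ Y₂ hM₂ hY₂ hc₂ => ?_)
  · simp [he m fun _ _ => rfl, hm1]
  · simp [he m fun _ _ => rfl, add_assoc]
  have hm2 : m₂ 1 = i := by rw [hc₂ 1 (by omega), hm1]
  refine wp_markIf hP hM₂ (c := w % P.verts = i) (x := P.verts + w / P.verts) ?_ ?_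
    (by omega) fun m₃ Y₃ hM₃ hY₃ hc₃ => ⟨⟨Y₃, hM₃, fun y => ?_⟩, ?_, rfl⟩
  · simp [he m₂ hc₂, hm2]
  · simp [he m₂ hc₂, add_assoc]
  · rw [hY₃, hY₂]
    constructor
    · rintro ((h | ⟨h, rfl⟩) | ⟨h, rfl⟩)
      · exact Or.inl h
      · exact Or.inr ⟨_, rfl, Or.inl ⟨h, rfl⟩⟩
      · exact Or.inr ⟨_, rfl, Or.inr ⟨h, rfl⟩⟩
    · rintro (h | ⟨v, rfl, ⟨h, rfl⟩ | ⟨h, rfl⟩⟩)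
      · exact Or.inl (Or.inl h)
      · exact Or.inl (Or.inr ⟨h, rfl⟩)
      · exact Or.inr ⟨h, rfl⟩
  · rw [hc₃ 1 (by omega), hm2]

lemma wp_greedy (hP : P.Fits) (hinb : inb.length ≤ P.space) (hX : Marks P X m)
    (hw : ∀ w ∈ inb, w < P.verts * P.verts + 3 * P.verts + P.verts * P.verts) :
    wp P me inb .greedy (fun m' o' => ∃ Y, Marks P Y m' ∧ IsExtension P (GatheredAdj P inb)
      (greedySet (GatheredAdj P inb) (eligibleSet P X) P.verts) X Y ∧ o' = o) m o := by
  have h1 := hP.le_space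
  have h2 := hP.space_le
  refine wp_loop (fun i m' o' => ∃ Y, Marks P Y m' ∧ IsExtension P (GatheredAdj P inb)
    (greedySet (GatheredAdj P inb) (eligibleSet P X) i) X Y ∧ o' = o) (by omega) (by simp; omega)
    ⟨X, hX, by simp [IsExtension, greedySet], rfl⟩ ?_ fun m' o' h => h
  rintro i hi m' o' ⟨Y, hM, hY, rfl⟩
  simp only [Exp.val_numVerts] at hi
  have hM := hM.update_of_lt (show 1 < 10 by omega) i
  have hm1 : Function.update m' 1 i 1 = i := by simp
  generalize Function.update m' 1 i = m₁ at hM hm1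
  -- The program's test on the current marks agrees with the abstract greedy rule: only vertices
  -- below `i` have been chosen so far, so the chosen and sampled marks of `i` are unchanged, and
  -- its domination mark records whether it was dominated before or has acquired a chosen neighbour.
  have hel : i ∈ eligibleSet P Y ↔ (i ∈ eligibleSet P X ∧
      ∀ u ∈ greedySet (GatheredAdj P inb) (eligibleSet P X) i, ¬GatheredAdj P inb u i) := by
    have ha : 2 * P.verts + i ∈ Y ↔ 2 * P.verts + i ∈ X := by
      rw [hY]
      refine or_iff_left ?_
      rintro (h | ⟨v, hv, h, -⟩)
      · have := lt_of_mem_greedySet h; omega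
      · omega
    have hb : i ∈ Y ↔ i ∈ X := by
      rw [hY]
      refine or_iff_left ?_
      rintro (h | ⟨v, hv, h, -⟩)
      · have := lt_of_mem_greedySet h; omega
      · omega
    have hc : P.verts + i ∈ Y ↔ P.verts + i ∈ X ∨
        ∃ u ∈ greedySet (GatheredAdj P inb) (eligibleSet P X) i, GatheredAdj P inb u i := by
      rw [hY]
      refine or_congr_right ⟨?_, ?_⟩
      · rintro (h | ⟨v, hv, h, h'⟩)
        · have := lt_of_mem_greedySet h; omega
        · obtain rfl : i = v := by omega
          exact h'
      · exact fun h => Or.inr ⟨i, hi, rfl, h⟩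
    simp only [eligibleSet, Finset.mem_filter, ha, hb, hc, not_or, not_exists, not_and]
    tauto
  have hval := val_eligible (me := me) (inb := inb) hM (e := .mem 1) (v := i) (by simp [hm1]) hi
  refine wp_ite (fun h => wp_seq (wp_store ?_ ?_ ?_)) (fun h => wp_skip ?_)
  · simp [hm1]; omega
  · simp; omega
  · have hi' : i ∈ eligibleSet P Y := by
      by_contra hcon
      simp [hval, hcon] at h
    simp only [Exp.val_add, Exp.val_ten, Exp.val_mem, Exp.val_one, hm1]
    have hM₂ := hM.set (x := i)
    have hm2 : Function.update m₁ (10 + i) 1 1 = i := by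
      rw [Function.update_of_ne (by omega), hm1]
    generalize Function.update m₁ (10 + i) 1 = m₂ at hM₂ hm2
    refine wp_mono (wp_loop_inbox (fun l m' o'' => (∃ Z, Marks P Z m' ∧ ∀ y, y ∈ Z ↔
      y ∈ insert i Y ∨ ∃ v, y = P.verts + v ∧ GatheredAdj P l i v) ∧ m' 1 = i ∧ o'' = o')
      (by omega) (by omega) ⟨⟨_, hM₂, by simp [GatheredAdj]⟩, hm2, rfl⟩ ?_) ?_
    · rintro pre w k m' o'' hwi hwk ⟨⟨Z, hMZ, hZ⟩, hm', rfl⟩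
      have hM₃ := hMZ.update_of_lt (show 2 < 10 by omega) k
      have hm3 : Function.update m' 2 k 1 = i := by rw [Function.update_of_ne (by omega), hm']
      have hm32 : Function.update m' 2 k 2 = k := by simp
      generalize Function.update m' 2 k = m₃ at hM₃ hm3 hm32
      refine wp_ite (fun hlt => wp_skip ⟨⟨Z, hM₃, fun y => ?_⟩, hm3, rfl⟩) (fun hlt => ?_)
      · have hlt' : ¬P.verts * P.verts + 3 * P.verts ≤ w := by
          simp only [Exp.val_lt, Exp.val_inbox, Exp.val_mem, Exp.val_two, Exp.val_three, hm32,
            Exp.val_mul, Exp.val_add, Exp.val_numVerts, hwk] at hlt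
          split_ifs at hlt
          · omega
          · exact absurd rfl hlt
        simp only [hZ, gatheredAdj_append_singleton, hlt', false_and, or_false]
      · have hlt' : P.verts * P.verts + 3 * P.verts ≤ w := by
          simp only [Exp.val_lt, Exp.val_inbox, Exp.val_mem, Exp.val_two, Exp.val_three, hm32,
            Exp.val_mul, Exp.val_add, Exp.val_numVerts, hwk] at hlt
          split_ifs at hlt
          omega
        refine wp_mono (wp_dominateAlong hP hM₃ (i := i)
          (w := w - (P.verts * P.verts + 3 * P.verts)) ?_ hm3 ?_) ?_
        · intro m₄ h₄
          simp only [Exp.val_sub, Exp.val_inbox, Exp.val_mem, Exp.val_two, Exp.val_three, hm32,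
            Exp.val_mul, Exp.val_add, Exp.val_numVerts, h₄ 2 (by omega), hwk]
        · have := hw w hwi; omega
        · rintro m₄ o₄ ⟨⟨Z₄, hM₄, hZ₄⟩, h₄, rfl⟩
          refine ⟨⟨Z₄, hM₄, fun y => ?_⟩, h₄, rfl⟩
          rw [hZ₄, hZ]
          simp only [gatheredAdj_append_singleton, hlt', true_and]
          rw [or_assoc, ← exists_or]
          simp only [and_or_left]
    · rintro m' o'' ⟨⟨Z, hMZ, hZ⟩, -, rfl⟩
      refine ⟨Z, hMZ, fun y => ?_, rfl⟩
      rw [hZ, greedySet, if_pos (hel.1 hi'), Finset.mem_insert, hY]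
      -- The bound on inbox words makes both ends of a gathered edge genuine vertices, as
      -- `IsExtension` requires.
      have hlt : ∀ v, GatheredAdj P inb i v → v < P.verts := by
        rintro v ⟨w, hwi, hle, ⟨-, rfl⟩ | ⟨-, rfl⟩⟩
        · exact Nat.mod_lt _ hP.verts_pos
        · exact Nat.div_lt_of_lt_mul (by have := hw w hwi; omega)
      constructor
      · rintro ((rfl | h | h | ⟨v, hv, rfl, u, hu, huv⟩) | ⟨v, rfl, hv⟩)
        · simp
        · exact Or.inl h
        · simp [h]
        · exact Or.inr (Or.inr ⟨v, hv, rfl, u, by simp [hu], huv⟩)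
        · exact Or.inr (Or.inr ⟨v, hlt v hv, rfl, i, by simp, hv⟩)
      · rintro (h | h | ⟨v, hv, rfl, u, hu, huv⟩)
        · exact Or.inl (Or.inr (Or.inl h))
        · rcases Finset.mem_insert.1 h with rfl | h
          · simp
          · exact Or.inl (Or.inr (Or.inr (Or.inl h)))
        · rcases Finset.mem_insert.1 hu with rfl | hu
          · exact Or.inr ⟨v, rfl, huv⟩
          · exact Or.inl (Or.inr (Or.inr (Or.inr ⟨v, hv, rfl, u, hu, huv⟩)))
  · have hi' : i ∉ eligibleSet P Y := by
      intro hcon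
      simp [hval, hcon] at h
    refine ⟨Y, hM, ?_, rfl⟩
    rw [greedySet, if_neg (fun h => hi' (hel.2 h))]
    exact hY

end Specs

end MapReduce
end

/-! ### Computing the sampling probability and flipping coins -/

noncomputable section

namespace MapReduce

/-- The square root, rounded up. -/
def ceilRoot (a : ℕ) : ℕ := Nat.find (⟨a, Nat.le_mul_self a⟩ : ∃ r, a ≤ r * r)

lemma le_ceilRoot_mul_self (a : ℕ) : a ≤ ceilRoot a * ceilRoot a :=
  Nat.find_spec (⟨a, Nat.le_mul_self a⟩ : ∃ r, a ≤ r * r)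

lemma mul_self_lt_iff_lt_ceilRoot {a r : ℕ} : r * r < a ↔ r < ceilRoot a := by
  rw [ceilRoot, Nat.lt_find_iff]
  constructor
  · intro h k hk hak
    have := Nat.mul_le_mul hk hk
    omega
  · intro h
    exact not_le.1 (h r le_rfl)

lemma ceilRoot_le_self (a : ℕ) : ceilRoot a ≤ a :=
  Nat.find_min' _ (Nat.le_mul_self a)

lemma ceilRoot_pos {a : ℕ} (ha : 0 < a) : 0 < ceilRoot a :=
  mul_self_lt_iff_lt_ceilRoot.1 (by simpa using ha)

lemma iterate_ceilRoot_le (k a : ℕ) : ceilRoot^[k] a ≤ a := by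
  induction k with
  | zero => simp
  | succ k ih =>
    rw [Function.iterate_succ_apply']
    exact (ceilRoot_le_self _).trans ih

lemma iterate_ceilRoot_pos (k : ℕ) {a : ℕ} (ha : 0 < a) : 0 < ceilRoot^[k] a := by
  induction k with
  | zero => simpa
  | succ k ih =>
    rw [Function.iterate_succ_apply']
    exact ceilRoot_pos ih

/-- The law of a random subset of `{0, …, k - 1}` that contains every element independently with
probability `1 / a`. -/
def coinSet (a k : ℕ) : PMF (Finset ℕ) :=
  iterate (fun i A => (uniformBelow a).map fun r => if r = 0 then insert i A else A) k ∅

/-- The sample that is recorded in the memory. -/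
def sampleOf (P : Cluster) (i : ℕ) (m : ℕ → ℕ) : Finset ℕ :=
  {v ∈ Finset.range i | m (10 + 2 * P.verts + v) = 1}

section Specs

variable {P : Cluster} {me : ℕ} {inb : List ℕ} {m : ℕ → ℕ} {o : List (ℕ × ℕ)} {X : Finset ℕ}

lemma wp_iteratedRoot (hP : P.Fits) (hX : Marks P X m) (k : ℕ) :
    wp P me inb (.iteratedRoot k)
      (fun m' o' => Marks P X m' ∧ m' 3 = ceilRoot^[k] P.machines ∧ o' = o) m o := by
  have h1 := hP.le_space
  have h2 := hP.space_le
  have h3 := hP.machines_le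
  induction k with
  | zero =>
    refine wp_store (by simp; omega) (by simp; omega) ⟨?_, by simp, rfl⟩
    exact hX.update_of_lt (by simp) _
  | succ k ih =>
    refine wp_seq (wp_mono ih ?_)
    rintro m' o' ⟨hM, hm3, rfl⟩
    set a := ceilRoot^[k] P.machines with ha
    have haM : a ≤ P.machines := iterate_ceilRoot_le _ _
    have haM' : ceilRoot a ≤ a := ceilRoot_le_self a
    refine wp_seq (wp_store (by simp; omega) (by simp; omega) ?_)
    simp only [Exp.val_four, Exp.val_zero]
    -- The counter in cell `4` grows exactly while its square is below `a`, so it stops at `ceilRoot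
    -- a`. As `ceilRoot a ≤ a`, as many passes as there are machines are enough.
    refine wp_seq (wp_loop (fun i m' o'' => Marks P X m' ∧ m' 3 = a ∧ m' 4 = min i (ceilRoot a) ∧
      o'' = o') (by omega) (by simp; omega)
      ⟨hM.update_of_lt (by omega) _, by simpa using hm3, by simp, rfl⟩ ?_ ?_)
    · rintro i hi m₁ o₁ ⟨hM₁, h13, h14, rfl⟩
      have hM₂ := hM₁.update_of_lt (show 1 < 10 by omega) i
      have h23 : Function.update m₁ 1 i 3 = a := by simpa using h13
      have h24 : Function.update m₁ 1 i 4 = min i (ceilRoot a) := by simpa using h14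
      generalize Function.update m₁ 1 i = m₂ at *
      have hval : (Exp.mem 4 + .op .lt (.mem 4 * .mem 4) (.mem 3)).val P me inb m₂ =
          min (i + 1) (ceilRoot a) := by
        simp only [Exp.val_add, Exp.val_mem, Exp.val_four, Exp.val_three, Exp.val_lt, Exp.val_mul,
          h23, h24, mul_self_lt_iff_lt_ceilRoot]
        split_ifs with h
        · omega
        · omega
      simp only [Exp.val_numMachines] at hi
      refine wp_store (by simp; omega) (by rw [hval]; omega) ?_
      rw [hval]
      exact ⟨hM₂.update_of_lt (by simp) _, by simpa using h23, by simp, rfl⟩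
    · rintro m₁ o₁ ⟨hM₁, h13, h14, rfl⟩
      simp only [Exp.val_numMachines] at h14
      have h14' : m₁ 4 = ceilRoot a := by rw [h14]; omega
      refine wp_store (by simp; omega) (by simp; omega) ⟨hM₁.update_of_lt (by simp) _, ?_, rfl⟩
      simp [h14', Function.iterate_succ_apply', ha]

/-- `Y` consists of `X` and the sample `A`. -/
def IsSampled (P : Cluster) (A X Y : Finset ℕ) : Prop :=
  ∀ y, y ∈ Y ↔ y ∈ X ∨ ∃ v ∈ A, y = 2 * P.verts + v

lemma wp_flipCoins (hP : P.Fits) (hX : Marks P X m) (hXlt : ∀ x ∈ X, x < 2 * P.verts)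
    (hm3 : m 3 ≤ P.machines) :
    wp P me inb .flipCoins (fun m' o' => (∃ Y, Marks P Y m' ∧
      IsSampled P (sampleOf P P.verts m') X Y) ∧ o' = o) m o := by
  have h1 := hP.le_space
  have h2 := hP.space_le
  have h3 := hP.machines_le
  refine wp_loop (fun i m' o' => (∃ Y, Marks P Y m' ∧ IsSampled P (sampleOf P i m') X Y) ∧
    m' 3 ≤ P.machines ∧ o' = o) (by omega) (by simp; omega)
    ⟨⟨X, hX, by simp [IsSampled, sampleOf]⟩, hm3, rfl⟩ ?_ fun m' o' h => ⟨h.1, h.2.2⟩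
  rintro i hi m' o' ⟨⟨Y, hM, hY⟩, h3', rfl⟩
  simp only [Exp.val_numVerts] at hi
  have hM₁ := hM.update_of_lt (show 1 < 10 by omega) i
  have h11 : Function.update m' 1 i 1 = i := by simp
  have h13 : Function.update m' 1 i 3 ≤ P.machines := by simpa using h3'
  have hA : sampleOf P i (Function.update m' 1 i) = sampleOf P i m' := by
    refine Finset.filter_congr fun v hv => ?_
    rw [Function.update_of_ne (by omega)]
  rw [← hA] at hY
  generalize Function.update m' 1 i = m₁ at *
  refine wp_seq (wp_rand (by simp [h11]; omega) (by simp; omega) fun r hr => ?_)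
  simp only [Exp.val_add, Exp.val_mul, Exp.val_ten, Exp.val_two, Exp.val_numVerts, Exp.val_mem,
    Exp.val_one, h11]
  refine wp_store ?_ ?_ ?_
  · simp [Function.update_of_ne (show 1 ≠ 10 + 2 * P.verts + i by omega), h11]; omega
  · refine lt_of_le_of_lt (b := 1) ?_ (by omega)
    rw [Exp.val_eq]
    split_ifs <;> omega
  · simp only [Exp.val_add, Exp.val_mul, Exp.val_ten, Exp.val_two, Exp.val_numVerts, Exp.val_mem,
      Exp.val_one, Exp.val_eq, Exp.val_zero,
      Function.update_of_ne (show 1 ≠ 10 + 2 * P.verts + i by omega), h11, Function.update_self,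
      Function.update_idem]
    refine ⟨?_, ?_, trivial⟩
    · have hsame : ∀ c, sampleOf P i (Function.update m₁ (10 + 2 * P.verts + i) c) =
          sampleOf P i m₁ := by
        intro c
        refine Finset.filter_congr fun v hv => ?_
        have := Finset.mem_range.1 hv
        rw [Function.update_of_ne (by omega)]
      -- The sample mark of `i` is still unset before pass `i`. Hence in the case `r ≠ 0`, where the
      -- cell ends up as `0`, the set of marks does not change.
      have hnotY : 2 * P.verts + i ∉ Y := by
        rw [hY]
        rintro (h | ⟨v, hv, h⟩)
        · have := hXlt _ h; omega
        · simp only [sampleOf, Finset.mem_filter, Finset.mem_range] at hv; omega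
      by_cases hr0 : r = 0
      · rw [if_pos hr0, add_assoc]
        refine ⟨_, hM₁.set, fun y => ?_⟩
        have : sampleOf P (i + 1) (Function.update m₁ (10 + (2 * P.verts + i)) 1) =
            insert i (sampleOf P i m₁) := by
          rw [← add_assoc, ← hsame 1, sampleOf, sampleOf, Finset.range_add_one,
            Finset.filter_insert, if_pos (by simp)]
        rw [this, Finset.mem_insert, hY]
        simp [or_left_comm]
      · rw [if_neg hr0]
        refine ⟨Y, fun x hx => ?_, fun y => ?_⟩
        · by_cases hxi : x = 2 * P.verts + i
          · subst hxi
            rw [← add_assoc, Function.update_self, if_neg hnotY]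
          · rw [Function.update_of_ne (by omega), hM₁ x hx]
        · have : sampleOf P (i + 1) (Function.update m₁ (10 + 2 * P.verts + i) 0) =
              sampleOf P i m₁ := by
            rw [← hsame 0, sampleOf, sampleOf, Finset.range_add_one, Finset.filter_insert,
              if_neg (by simp)]
          rw [this, hY]
    · rw [Function.update_of_ne (by omega)]; exact h13

/-- The law of the sample drawn by `Prog.flipCoins`. -/
lemma map_sampleOf_flipCoins (hP : P.Fits) {a : ℕ} (haM : a ≤ P.machines) (s : Local)
    (hs : s.mem 3 = a) :
    (Prog.flipCoins.exec P me inb s).map (fun s => sampleOf P P.verts s.mem) =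
      coinSet a P.verts := by
  have h1 := hP.le_space
  have h2 := hP.space_le
  have h3 := hP.machines_le
  have h0 := hP.verts_pos
  -- One pass in closed form, as the image of a uniform variable. With it, recording the sample
  -- turns the loop into the iteration that defines `coinSet`.
  have hstep : ∀ i < P.verts, ∀ s : Local, s.mem 3 = a →
      (Prog.exec P me inb (.seq (.rand (10 + 2 * .numVerts + .mem 1) (.mem 3))
        (.store (10 + 2 * .numVerts + .mem 1) (.op .eq (.mem (10 + 2 * .numVerts + .mem 1)) 0)))
        ((s.write P 1 i).tick 1)) = (uniformBelow a).map fun r =>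
          (⟨Function.update (Function.update (Function.update s.mem 1 i) (10 + 2 * P.verts + i)
            (r % P.wordBound)) (10 + 2 * P.verts + i) (if r % P.wordBound = 0 then 1 else 0),
            s.out, s.time + 1 + ((10 + 2 * Exp.numVerts + .mem 1).cost + (Exp.mem 3).cost + 1) +
            ((10 + 2 * Exp.numVerts + .mem 1).cost +
              (Exp.op .eq (.mem (10 + 2 * .numVerts + .mem 1)) 0).cost + 1)⟩ : Local) := by
    intro i hi s hs
    have hw : (s.write P 1 i).tick 1 = ⟨Function.update s.mem 1 i, s.out, s.time + 1⟩ := by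
      simp [Local.write, Local.tick, show 1 < P.space by omega,
        Nat.mod_eq_of_lt (show i < P.wordBound by omega)]
    rw [hw, Prog.exec, Prog.exec, PMF.bind_map]
    simp only [Function.comp_def, Prog.exec]
    rw [← PMF.bind_pure_comp]
    simp only [Exp.eval_eq_val, Exp.val_add, Exp.val_mul, Exp.val_ten, Exp.val_two,
      Exp.val_numVerts, Exp.val_mem, Exp.val_one, Exp.val_three, Exp.val_eq, Exp.val_zero]
    have e3 : Function.update s.mem 1 i 3 = a := by simpa using hs
    have hlt : 10 + 2 * P.verts + i < P.space := by omega
    have hif : ∀ c : Prop, ∀ _ : Decidable c, (if c then 1 else 0) % P.wordBound =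
        if c then 1 else 0 := by
      intro c _; split_ifs
      · exact Nat.mod_eq_of_lt (by omega)
      · exact Nat.zero_mod _
    simp only [e3, Function.update_self, Local.write, hlt, if_true, Local.tick,
      Function.update_of_ne (show 1 ≠ 10 + 2 * P.verts + i by omega), Function.comp_def, hif]
  have key := map_iterate (fun i s' => Prog.exec P me inb
    (.seq (.rand (10 + 2 * .numVerts + .mem 1) (.mem 3))
      (.store (10 + 2 * .numVerts + .mem 1) (.op .eq (.mem (10 + 2 * .numVerts + .mem 1)) 0)))
        ((s'.write P 1 i).tick 1))
    (fun i A => (uniformBelow a).map fun r => if r = 0 then insert i A else A)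
    (fun i s => sampleOf P i s.mem) (fun _ s => s.mem 3 = a) P.verts ?_ ?_
    (s.tick (Exp.numVerts.cost + 1)) (by simpa [Local.tick] using hs)
  · have h0' : sampleOf P 0 (s.tick (Exp.numVerts.cost + 1)).mem = ∅ := by simp [sampleOf]
    rw [h0'] at key
    exact key
  · intro i hi s hs s' hs'
    rw [hstep i hi s hs, PMF.mem_support_map_iff] at hs'
    obtain ⟨r, -, rfl⟩ := hs'
    dsimp only
    rw [Function.update_of_ne (by omega), Function.update_of_ne (by omega),
      Function.update_of_ne (by omega), hs]
  · intro i hi s hs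
    rw [hstep i hi s hs, PMF.map_comp]
    refine PMF.map_congr_support _ fun r hr => ?_
    rw [mem_support_uniformBelow] at hr
    have hrw : r % P.wordBound = r := Nat.mod_eq_of_lt (by omega)
    simp only [Function.comp_def, hrw, Function.update_idem]
    have hsame : ∀ c, sampleOf P i (Function.update (Function.update s.mem 1 i)
        (10 + 2 * P.verts + i) c) = sampleOf P i s.mem := by
      intro c
      refine Finset.filter_congr fun v hv => ?_
      have := Finset.mem_range.1 hv
      rw [Function.update_of_ne (by omega), Function.update_of_ne (by omega)]
    split_ifs with hr0
    · rw [← hsame 1, sampleOf, sampleOf, Finset.range_add_one, Finset.filter_insert,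
        if_pos (by simp)]
    · rw [← hsame 0, sampleOf, sampleOf, Finset.range_add_one, Finset.filter_insert,
        if_neg (by simp)]

end Specs

end MapReduce
end

noncomputable section

/-! ### Communication -/

namespace MapReduce

lemma mem_support_sampleAll_finRange {M : ℕ} {f : Fin M → PMF Local} {ls : List Local}
    (h : ls ∈ (sampleAll ((List.finRange M).map f)).support) :
    ∃ L : Fin M → Local, ls = (List.finRange M).map L ∧ ∀ j, L j ∈ (f j).support := by
  rw [mem_support_sampleAll, List.forall₂_iff_get] at h
  obtain ⟨hlen, h⟩ := h
  simp only [List.length_map, List.length_finRange] at hlen h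
  refine ⟨fun j => ls.get ⟨j, by omega⟩, ?_, fun j => ?_⟩
  · refine List.ext_get (by simp [hlen]) fun i h1 h2 => ?_
    simp
  · simpa using h j j.2 (by omega)

lemma length_eq_sum_filter {M : ℕ} (l : List (ℕ × ℕ)) (hl : ∀ p ∈ l, p.1 < M) :
    l.length = ∑ i ∈ Finset.range M, (l.filter (·.1 = i)).length := by
  induction l with
  | nil => simp
  | cons p l ih =>
    have hp : p.1 < M := hl p (by simp)
    rw [List.length_cons, ih fun q hq => hl q (by simp [hq])]
    have : ∀ i, ((p :: l).filter (·.1 = i)).length =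
        (l.filter (·.1 = i)).length + if p.1 = i then 1 else 0 := by
      intro i
      by_cases h : p.1 = i <;> simp [h]
    simp only [this, Finset.sum_add_distrib, Finset.sum_ite_eq, Finset.mem_range, hp, if_true]

/-- Once the residue `x % N % M` is fixed, `x` is determined by its tag `x / N` and the quotient `x
% N / M`. -/
lemma length_filter_mod_le {N M : ℕ} (hN : 0 < N) {tags : ℕ} (ht : tags ≤ 3) (c : ℕ)
    (q : ℕ → Prop) [DecidablePred q] :
    ((List.range (tags * N)).filter fun x => q x ∧ x % N % M = c).length ≤ 3 * (N / M + 1) := by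
  have h1 : ((List.range (tags * N)).filter fun x => q x ∧ x % N % M = c).length =
      ((Finset.range (tags * N)).filter fun x => q x ∧ x % N % M = c).card := by
    rw [← List.toFinset_card_of_nodup (List.nodup_range.filter _)]
    congr 1
    ext x; simp
  have h2 : 3 * (N / M + 1) = ((Finset.range 3) ×ˢ (Finset.range (N / M + 1))).card := by simp
  rw [h1, h2]
  refine Finset.card_le_card_of_injOn (fun x => (x / N, x % N / M)) ?_ ?_
  · intro x hx
    simp only [Finset.coe_filter, Finset.mem_range, Set.mem_ofPred_eq] at hx
    simp only [Finset.coe_product, Finset.coe_range, Set.mem_prod, Set.mem_Iio]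
    constructor
    · have := Nat.div_lt_of_lt_mul (mul_comm tags N ▸ hx.1); omega
    · have : x % N / M ≤ N / M := Nat.div_le_div_right (Nat.mod_lt _ hN).le
      omega
  · intro x hx y hy hxy
    simp only [Finset.coe_filter, Finset.mem_range, Set.mem_ofPred_eq] at hx hy
    simp only [Prod.mk.injEq] at hxy
    have h3 : x % N = y % N := by
      rw [← Nat.div_add_mod (x % N) M, ← Nat.div_add_mod (y % N) M, hxy.2, hx.2.2, hy.2.2]
    rw [← Nat.div_add_mod x N, ← Nat.div_add_mod y N, hxy.1, h3]

section Deliver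

variable {P : Cluster}

lemma filter_markMessages (b tags : ℕ) (χ : ℕ → ℕ) (X : Finset ℕ) {i : ℕ} (hi : i < P.machines) :
    ((markMessages P b tags χ X).filter (·.1 = i)).map Prod.snd =
      ((List.range (tags * P.verts)).filter fun x => x ∈ X ∧ x % P.verts % P.machines = χ i).map
        (b + ·) := by
  rw [markMessages, List.filter_flatMap, List.map_flatMap, ← flatMap_ite_singleton]
  refine List.flatMap_congr fun x _ => ?_
  by_cases hx : x ∈ X
  · simp only [hx, if_true, true_and]
    rw [flatMap_ite_singleton (List.range P.machines) (fun j => x % P.verts % P.machines = χ j)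
      fun j => (j, b + x), List.filter_map, List.map_map]
    have h1 : (List.range P.machines).filter ((fun p : ℕ × ℕ => decide (p.1 = i)) ∘
        fun j => (j, b + x)) = [i] := by
      have : ((fun p : ℕ × ℕ => decide (p.1 = i)) ∘ fun j => (j, b + x)) = fun j => j == i := by
        ext j; simp [beq_eq_decide]
      rw [this, List.filter_beq, List.count_eq_one_of_mem List.nodup_range (List.mem_range.2 hi)]
      rfl
    rw [List.filter_filter, ← List.filter_filter, List.filter_comm, h1]
    by_cases hc : x % P.verts % P.machines = χ i <;> simp [hc]
  · simp [hx]

lemma fst_lt_of_mem_markMessages {b tags : ℕ} {χ : ℕ → ℕ} {X : Finset ℕ} {p : ℕ × ℕ}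
    (hp : p ∈ markMessages P b tags χ X) : p.1 < P.machines := by
  simp only [markMessages, List.mem_flatMap, List.mem_range] at hp
  obtain ⟨x, -, hp⟩ := hp
  split_ifs at hp
  · simp only [List.mem_flatMap, List.mem_range] at hp
    obtain ⟨j, hj, hp⟩ := hp
    split_ifs at hp
    · simp only [List.mem_singleton] at hp
      subst hp; exact hj
    · simp at hp
  · simp at hp

/-- Having at most as many machines as vertices makes the rounding terms, one per machine, cost no
more than `3 n` in total. -/
lemma machines_mul_le (hP : P.Fits) : P.machines * (3 * (P.verts / P.machines + 1)) ≤
    6 * P.verts := by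
  have h1 := Nat.mul_div_le P.verts P.machines
  have h2 := hP.machines_le
  calc P.machines * (3 * (P.verts / P.machines + 1))
      = 3 * (P.machines * (P.verts / P.machines)) + 3 * P.machines := by ring
    _ ≤ _ := by omega

/-- Each destination gets only marks from one residue class, so the sum over destinations is linear
in `n`. This is the point of the two-round broadcast: a direct one could cost `3 n` words per
destination. -/
lemma length_markMessages_le (hP : P.Fits) (b : ℕ) {tags : ℕ} (ht : tags ≤ 3) (χ : ℕ → ℕ)
    (X : Finset ℕ) : (markMessages P b tags χ X).length ≤ 6 * P.verts := by
  rw [length_eq_sum_filter _ fun p hp => fst_lt_of_mem_markMessages hp]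
  refine (Finset.sum_le_card_nsmul _ _ (3 * (P.verts / P.machines + 1)) fun i hi => ?_).trans ?_
  · rw [← List.length_map (f := Prod.snd), filter_markMessages b tags χ X (Finset.mem_range.1 hi),
      List.length_map]
    exact length_filter_mod_le hP.verts_pos ht _ _
  · rw [Finset.card_range, smul_eq_mul]
    exact machines_mul_le hP

/-- The messages of a machine: marks, its own edges, and edges for machine `0`. -/
def messages (P : Cluster) (b tags : ℕ) (χ : ℕ → ℕ) (X : Finset ℕ) (j : ℕ) (E F : List ℕ) :
    List (ℕ × ℕ) :=
  markMessages P b tags χ X ++ E.map (fun w => (j, w)) ++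
    F.map fun w => (0, P.verts * P.verts + 3 * P.verts + w)

/-- What machine `i` receives. -/
lemma deliver_messages {L : Fin P.machines → Local} {b tags : ℕ} {χ : Fin P.machines → ℕ → ℕ}
    {Y : Fin P.machines → Finset ℕ} {E F : Fin P.machines → List ℕ}
    (hL : ∀ j, (L j).out = messages P b tags (χ j) (Y j) j (E j) (F j)) (i : Fin P.machines) :
    deliver P ((List.finRange P.machines).map L) i = (List.finRange P.machines).flatMap fun j =>
      ((List.range (tags * P.verts)).filter fun x =>
        x ∈ Y j ∧ x % P.verts % P.machines = χ j i).map (b + ·) ++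
      (if j = i then E j else []) ++
      (if (i : ℕ) = 0 then (F j).map (P.verts * P.verts + 3 * P.verts + ·) else []) := by
  rw [deliver, List.flatMap_map]
  refine List.flatMap_congr fun j _ => ?_
  rw [hL, messages, List.filter_append, List.filter_append, List.map_append, List.map_append,
    filter_markMessages b tags (χ j) (Y j) i.2]
  congr 1
  · congr 1
    by_cases h : j = i
    · subst h; simp [List.filter_map, Function.comp_def]
    · have : ¬(j : ℕ) = i := fun h' => h (Fin.ext h')
      simp [List.filter_map, Function.comp_def, h, this]
  · by_cases h : (i : ℕ) = 0
    · simp [List.filter_map, Function.comp_def, h]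
    · have : ¬0 = (i : ℕ) := fun h' => h h'.symm
      simp [List.filter_map, Function.comp_def, h, this]

lemma flatMap_ite_eq {M : ℕ} (E : Fin M → List ℕ) (i : Fin M) :
    ((List.finRange M).flatMap fun j => if j = i then E j else []) = E i := by
  have h : ∀ l : List (Fin M), l.Nodup → (l.flatMap fun j => if j = i then E j else []) =
      if i ∈ l then E i else [] := by
    intro l hl
    induction l with
    | nil => simp
    | cons a l ih =>
      rw [List.nodup_cons] at hl
      rw [List.flatMap_cons, ih hl.2]
      by_cases ha : a = i
      · subst ha; simp [hl.1]
      · simp [ha, Ne.symm ha]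
  rw [h _ (List.nodup_finRange M), if_pos (List.mem_finRange i)]

lemma length_flatMap_finRange_le {M : ℕ} (l : Fin M → List ℕ) (f : Fin M → ℕ)
    (h : ∀ j, (l j).length ≤ f j) : ((List.finRange M).flatMap l).length ≤ ∑ j, f j := by
  rw [List.length_flatMap]
  have : ((List.finRange M).map fun a => (l a).length).sum = ∑ j, (l j).length := by
    rw [← List.ofFn_eq_map, List.sum_ofFn]
  rw [this]
  exact Finset.sum_le_sum fun j _ => h j

/-- The bound on marks is taken per sender and then summed, so the same mark may arrive from many
machines. The sum over the lists `F` is charged to every receiver, although only machine `0` gets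
them. -/
lemma length_deliver_le (hP : P.Fits) {L : Fin P.machines → Local} {b tags : ℕ} (ht : tags ≤ 3)
    {χ : Fin P.machines → ℕ → ℕ}
    {Y : Fin P.machines → Finset ℕ} {E F : Fin P.machines → List ℕ}
    (hL : ∀ j, (L j).out = messages P b tags (χ j) (Y j) j (E j) (F j)) (i : Fin P.machines) :
    (deliver P ((List.finRange P.machines).map L) i).length ≤
      6 * P.verts + (E i).length + ∑ j, (F j).length := by
  rw [deliver_messages hL]
  refine (length_flatMap_finRange_le _ (fun j => 3 * (P.verts / P.machines + 1) +
    (if j = i then (E j).length else 0) + (F j).length) fun j => ?_).trans ?_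
  · rw [List.length_append, List.length_append, List.length_map]
    gcongr
    · exact length_filter_mod_le hP.verts_pos ht _ _
    · split_ifs <;> simp
    · split_ifs <;> simp
  · rw [Finset.sum_add_distrib, Finset.sum_add_distrib, Finset.sum_ite_eq' Finset.univ i,
      if_pos (Finset.mem_univ i), Finset.sum_const, Finset.card_univ, Fintype.card_fin, smul_eq_mul]
    exact add_le_add (add_le_add (machines_mul_le hP) le_rfl) le_rfl

/-- The communication succeeds. -/
lemma shuffle_messages (hP : P.Fits) {L : Fin P.machines → Local} {b tags : ℕ} (ht : tags ≤ 3)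
    {χ : Fin P.machines → ℕ → ℕ}
    {Y : Fin P.machines → Finset ℕ} {E F : Fin P.machines → List ℕ}
    (hL : ∀ j, (L j).out = messages P b tags (χ j) (Y j) j (E j) (F j))
    (htime : ∀ j, (L j).time ≤ P.steps)
    (hspace : ∀ j, 6 * P.verts + (E j).length + ∑ j, (F j).length ≤ P.space) :
    shuffle P ((List.finRange P.machines).map L) =
      some (deliver P ((List.finRange P.machines).map L)) := by
  rw [shuffle, if_pos]
  refine ⟨?_, fun j => (length_deliver_le hP ht hL j).trans (hspace j)⟩
  intro s hs
  rw [List.mem_map] at hs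
  obtain ⟨j, -, rfl⟩ := hs
  refine ⟨htime j, le_trans ?_ (hspace j)⟩
  rw [hL, messages, List.length_append, List.length_append, List.length_map, List.length_map]
  have h1 := length_markMessages_le hP b ht (χ j) (Y j)
  have h2 : (F j).length ≤ ∑ j, (F j).length :=
    Finset.single_le_sum (f := fun j => (F j).length) (fun _ _ => Nat.zero_le _) (Finset.mem_univ j)
  omega

/-- In the configuration `cfg`, machine `j` holds the edges `E j` and the marks `K j`. -/
structure Holds (P : Cluster) (E : Fin P.machines → List ℕ) (K : Fin P.machines → Finset ℕ)
    (cfg : Config P) : Prop where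
  length_le : ∀ j, (cfg j).length ≤ P.space
  edges : ∀ j, (cfg j).filter (· < P.verts * P.verts) = E j
  marks : ∀ j, inboxMarks P (cfg j) = K j

lemma mem_deliver_messages {L : Fin P.machines → Local} {tags b : ℕ}
    {χ : Fin P.machines → ℕ → ℕ} {Y : Fin P.machines → Finset ℕ} {E F : Fin P.machines → List ℕ}
    (hL : ∀ j, (L j).out = messages P b tags (χ j) (Y j) j (E j) (F j))
    (i : Fin P.machines) (w : ℕ) :
    w ∈ deliver P ((List.finRange P.machines).map L) i ↔
      (∃ j, ∃ x < tags * P.verts, x ∈ Y j ∧ x % P.verts % P.machines = χ j i ∧ w = b + x) ∨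
      w ∈ E i ∨ ((i : ℕ) = 0 ∧ ∃ j, ∃ e ∈ F j, w = P.verts * P.verts + 3 * P.verts + e) := by
  rw [deliver_messages hL]
  simp only [List.mem_flatMap, List.mem_finRange, true_and, List.mem_append, List.mem_map,
    List.mem_filter, List.mem_range, decide_eq_true_eq]
  constructor
  · rintro ⟨j, (⟨x, ⟨hx, hxY, hxi⟩, rfl⟩ | h) | h⟩
    · exact Or.inl ⟨j, x, hx, hxY, hxi, rfl⟩
    · split_ifs at h with hj
      · subst hj; exact Or.inr (Or.inl h)
      · simp at h
    · split_ifs at h with hj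
      · rw [List.mem_map] at h
        obtain ⟨e, he, rfl⟩ := h
        exact Or.inr (Or.inr ⟨hj, j, e, he, rfl⟩)
      · simp at h
  · rintro (⟨j, x, hx, hxY, hxi, rfl⟩ | h | ⟨hi, j, e, he, rfl⟩)
    · exact ⟨j, Or.inl (Or.inl ⟨x, ⟨hx, hxY, hxi⟩, rfl⟩)⟩
    · exact ⟨i, Or.inl (Or.inr (by simpa using h))⟩
    · exact ⟨j, Or.inr (by rw [if_pos hi]; exact List.mem_map.2 ⟨e, he, rfl⟩)⟩

/-- The marks of machine `i` after the communication. -/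
def receivedMarks (P : Cluster) (tags : ℕ) (χ : Fin P.machines → ℕ → ℕ)
    (Y : Fin P.machines → Finset ℕ) (i : Fin P.machines) : Finset ℕ :=
  {x ∈ Finset.range (tags * P.verts) | ∃ j, x ∈ Y j ∧ x % P.verts % P.machines = χ j i}

/-- Input edges, marks and gathered edges occupy disjoint ranges of words, so they can be told apart
in the inbox. -/
lemma holds_deliver (hP : P.Fits) {L : Fin P.machines → Local} {tags : ℕ} (ht : tags ≤ 3)
    {χ : Fin P.machines → ℕ → ℕ}
    {Y : Fin P.machines → Finset ℕ} {E F : Fin P.machines → List ℕ}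
    (hE : ∀ j, ∀ w ∈ E j, w < P.verts * P.verts)
    (hL : ∀ j, (L j).out = messages P (P.verts * P.verts) tags (χ j) (Y j) j (E j) (F j))
    (hspace : ∀ j, 6 * P.verts + (E j).length + ∑ j, (F j).length ≤ P.space) :
    Holds P E (receivedMarks P tags χ Y) (deliver P ((List.finRange P.machines).map L)) := by
  have htn : tags * P.verts ≤ 3 * P.verts := by gcongr
  refine ⟨fun j => (length_deliver_le hP ht hL j).trans (hspace j), fun i => ?_, fun i => ?_⟩
  · rw [deliver_messages hL, List.filter_flatMap, ← flatMap_ite_eq E i]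
    refine List.flatMap_congr fun j _ => ?_
    rw [List.filter_append, List.filter_append]
    have h1 : (((List.range (tags * P.verts)).filter fun x =>
        x ∈ Y j ∧ x % P.verts % P.machines = χ j i).map (P.verts * P.verts + ·)).filter
        (· < P.verts * P.verts) = [] := by
      rw [List.filter_eq_nil_iff]
      intro w hw
      rw [List.mem_map] at hw
      obtain ⟨x, -, rfl⟩ := hw
      simp
    have h2 : (if (i : ℕ) = 0 then (F j).map (P.verts * P.verts + 3 * P.verts + ·) else []).filter
        (· < P.verts * P.verts) = [] := by
      rw [List.filter_eq_nil_iff]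
      intro w hw
      split_ifs at hw
      · rw [List.mem_map] at hw
        obtain ⟨x, -, rfl⟩ := hw
        simp only [decide_eq_true_eq]; omega
      · simp at hw
    rw [h1, h2, List.nil_append, List.append_nil]
    refine List.filter_eq_self.2 fun w hw => ?_
    split_ifs at hw
    · simpa using hE j w hw
    · simp at hw
  · ext x
    simp only [inboxMarks, receivedMarks, Finset.mem_filter, Finset.mem_range,
      mem_deliver_messages hL]
    constructor
    · rintro ⟨hx, ⟨j, y, hy, hyY, hyi, h⟩ | h | ⟨hi, j, e, he, h⟩⟩
      · obtain rfl : x = y := by omega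
        exact ⟨hy, j, hyY, hyi⟩
      · have := hE i _ h; omega
      · omega
    · rintro ⟨hx, j, hxY, hxi⟩
      exact ⟨by omega, Or.inl ⟨j, x, hx, hxY, hxi, rfl⟩⟩

end Deliver

end MapReduce
end

noncomputable section

/-! ### The rounds of the algorithm -/

namespace MapReduce

namespace Prog

/-- Machine `0` samples vertices; `prep` computes the inverse of the sampling probability. -/
def sampleRound (prep : Prog) : Prog :=
  .seq (.seq load prep) (.seq (.ite .self .skip flipCoins)
    (.seq (emitMarks (.numVerts * .numVerts) 3 (.mem 2)) keepEdges))

/-- Every machine forwards the marks that it is responsible for to all machines. -/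
def forwardRound : Prog :=
  .seq load (.seq (emitMarks (.numVerts * .numVerts) 3 .self) keepEdges)

/-- The edges between eligible vertices are sent to machine `0`. -/
def gatherRound : Prog :=
  .seq load (.seq (emitMarks (.numVerts * .numVerts) 3 .self) (.seq keepEdges gatherEdges))

/-- Machine `0` runs the greedy algorithm. -/
def greedyRound : Prog :=
  .seq load (.seq (.ite .self .skip greedy)
    (.seq (emitMarks (.numVerts * .numVerts) 3 (.mem 2)) keepEdges))

/-- All machines mark neighbours of chosen vertices as dominated. -/
def dominateRound : Prog :=
  .seq load (.seq dominate (.seq (emitMarks (.numVerts * .numVerts) 2 (.mem 2)) keepEdges))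

/-- Machine `0` runs the greedy algorithm, and the chosen vertices are written out. -/
def outputRound : Prog :=
  .seq load (.seq (.ite .self .skip greedy) (emitMarks 0 1 (.mem 2)))

/-- Machines with inboxes of length at most `space` run the program in time. -/
def Timely (P : Cluster) (p : Prog) : Prop :=
  (∀ me inb, inb.length ≤ P.space → p.BoundedBy P me inb P.space) ∧ P.space ^ p.weight ≤ P.steps

end Prog

variable {P : Cluster}

/-- Lifts a specification of each single machine to all possible outcomes of the parallel
computation, together with the time limit. -/
lemma support_sampleAll_exec {p : Prog} (hP : P.Fits) (hp : p.Timely P) {cfg : Config P}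
    (hlen : ∀ j, (cfg j).length ≤ P.space)
    {Post : Fin P.machines → (ℕ → ℕ) → List (ℕ × ℕ) → Prop}
    (h : ∀ j : Fin P.machines, wp P j (cfg j) p (Post j) (fun _ => 0) []) :
    ∀ ls ∈ (sampleAll ((List.finRange P.machines).map fun j : Fin P.machines =>
      p.exec P (j : ℕ) (cfg j) Local.init)).support, ∃ L : Fin P.machines → Local,
      (∀ j, Post j (L j).mem (L j).out ∧ (L j).time ≤ P.steps) ∧
        ls = (List.finRange P.machines).map L := by
  intro ls hls
  obtain ⟨L, rfl, hL⟩ := mem_support_sampleAll_finRange hls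
  refine ⟨L, fun j => ⟨h j _ rfl rfl _ (hL j), ?_⟩, rfl⟩
  have := time_exec_le (by have := hP.le_space; omega) p (hp.1 j (cfg j) (hlen j)) _ _ (hL j)
  simp only [Local.init, zero_add] at this
  exact this.trans hp.2

lemma support_round {p : Prog} (hP : P.Fits) (hp : p.Timely P) {cfg : Config P}
    (hlen : ∀ j, (cfg j).length ≤ P.space) {Post : Fin P.machines → List (ℕ × ℕ) → Prop}
    (h : ∀ j : Fin P.machines, wp P j (cfg j) p (fun _ o => Post j o) (fun _ => 0) []) :
    ∀ r ∈ (round P p cfg).support, ∃ L : Fin P.machines → Local,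
      (∀ j, Post j (L j).out ∧ (L j).time ≤ P.steps) ∧
        r = shuffle P ((List.finRange P.machines).map L) := by
  intro r hr
  rw [round, PMF.mem_support_map_iff] at hr
  obtain ⟨ls, hls, rfl⟩ := hr
  obtain ⟨L, hL, rfl⟩ := support_sampleAll_exec hP hp hlen h ls hls
  exact ⟨L, hL, rfl⟩

/-- The marks `x < tags * n` in `Z` that machine `i` is responsible for. -/
def scattered (P : Cluster) (tags : ℕ) (Z : Finset ℕ) (i : Fin P.machines) : Finset ℕ :=
  {x ∈ Finset.range (tags * P.verts) | x ∈ Z ∧ x % P.verts % P.machines = i}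

/-- The specification of the computation of machine `me` in a round. -/
lemma wp_emit_keep (hP : P.Fits) {me : ℕ} {inb : List ℕ} (hinb : inb.length ≤ P.space)
    {m : ℕ → ℕ} {X : Finset ℕ} (hX : Marks P X m) {χ : Exp} {c : ℕ → ℕ} {tags : ℕ}
    (ht : tags ≤ 3) (hχ : ∀ m, χ.val P me inb m = c (m 2)) :
    wp P me inb (.seq (.emitMarks (.numVerts * .numVerts) tags χ) .keepEdges)
      (fun m' o' => Marks P X m' ∧ o' = messages P (P.verts * P.verts) tags c X me
        (inb.filter (· < P.verts * P.verts)) []) m [] := by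
  refine wp_seq (wp_mono (wp_emitMarks hP hX ht (le_refl (P.verts * P.verts)) (fun m => by simp) hχ)
    ?_)
  rintro m' o' ⟨hM, rfl⟩
  refine wp_mono (wp_keepEdges hP hinb hM) ?_
  rintro m' o' ⟨hM, rfl⟩
  exact ⟨hM, by simp [messages]⟩

section Transitions

variable (hP : P.Fits) {E : Fin P.machines → List ℕ} {cfg : Config P} {g : ℕ}
  (hspace : ∀ j, 6 * P.verts + (E j).length + g ≤ P.space)
include hP hspace

omit hP hspace in
lemma Holds.edge_lt {K : Fin P.machines → Finset ℕ} (h : Holds P E K cfg) :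
    ∀ j, ∀ w ∈ E j, w < P.verts * P.verts := by
  intro j w hw
  rw [← h.edges j] at hw
  simpa using (List.mem_filter.1 hw).2

omit hspace in
lemma Holds.wp_load {K : Fin P.machines → Finset ℕ} (h : Holds P E K cfg) (j : Fin P.machines) :
    wp P j (cfg j) .load (fun m' o' => Marks P (K j) m' ∧ o' = []) (fun _ => 0) [] := by
  rw [← h.marks j]
  exact MapReduce.wp_load hP (h.length_le j) fun _ _ => rfl

/-- With `id` as selector, every machine sends a mark to the machine responsible for it, so the
responsible machines together hold the union `Z` of all marks. -/
lemma shuffle_scattered {K : Fin P.machines → Finset ℕ} (h : Holds P E K cfg) {tags : ℕ}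
    (ht : tags ≤ 3) {L : Fin P.machines → Local} {Y : Fin P.machines → Finset ℕ}
    (hout : ∀ j, (L j).out = messages P (P.verts * P.verts) tags id (Y j) j (E j) [])
    (htime : ∀ j, (L j).time ≤ P.steps) :
    ∃ cfg', shuffle P ((List.finRange P.machines).map L) = some cfg' ∧
      ∀ Z, (∀ x < tags * P.verts, x ∈ Z ↔ ∃ j, x ∈ Y j) → Holds P E (scattered P tags Z) cfg' := by
  have hsp : ∀ j, 6 * P.verts + (E j).length +
      ∑ j : Fin P.machines, ([] : List ℕ).length ≤ P.space := by
    intro j; have := hspace j; simp; omega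
  refine ⟨_, shuffle_messages hP ht hout htime hsp, ?_⟩
  intro Z hZ
  have := holds_deliver hP ht h.edge_lt hout hsp
  have hK : receivedMarks P tags (fun _ => id) Y = scattered P tags Z := by
    ext i x
    simp only [receivedMarks, scattered, Finset.mem_filter, Finset.mem_range, id]
    refine and_congr_right fun hx => ?_
    rw [hZ x hx, exists_and_right]
  rwa [hK] at this

/-- A round in which every machine sends its marks `Y j` to the responsible machines. -/
lemma scatter_transition {p : Prog} (hp : p.Timely P) {K : Fin P.machines → Finset ℕ}
    (h : Holds P E K cfg) {tags : ℕ} (ht : tags ≤ 3) {R : Fin P.machines → Finset ℕ → Prop}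
    (hw : ∀ j : Fin P.machines, wp P j (cfg j) p (fun _ o => ∃ Y, R j Y ∧
      o = messages P (P.verts * P.verts) tags id Y j (E j) []) (fun _ => 0) []) :
    ∀ r ∈ (round P p cfg).support, ∃ Y : Fin P.machines → Finset ℕ, (∀ j, R j (Y j)) ∧
      ∃ cfg', r = some cfg' ∧ ∀ Z, (∀ x < tags * P.verts, x ∈ Z ↔ ∃ j, x ∈ Y j) →
        Holds P E (scattered P tags Z) cfg' := by
  intro r hr
  obtain ⟨L, hL, rfl⟩ := support_round hP hp h.length_le hw r hr
  choose Y hY using fun j => (hL j).1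
  exact ⟨Y, fun j => (hY j).1, shuffle_scattered hP hspace h ht (fun j => (hY j).2)
    fun j => (hL j).2⟩

omit hspace in
lemma wp_forward_marks {K : Fin P.machines → Finset ℕ} (h : Holds P E K cfg)
    (j : Fin P.machines) : wp P j (cfg j) .forwardRound (fun _ o =>
      o = messages P (P.verts * P.verts) 3 (fun _ => j) (K j) j (E j) []) (fun _ => 0) [] := by
  refine wp_seq (wp_mono (h.wp_load hP j) ?_)
  rintro m o ⟨hM, rfl⟩
  have := wp_emit_keep hP (me := j) (h.length_le j) hM (χ := .self) (c := fun _ => (j : ℕ)) le_rfl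
    (fun m => rfl)
  rw [h.edges j] at this
  exact wp_mono this fun m' o' h => h.2

/-- After scattering and forwarding, all machines hold the same marks. -/
lemma forward_transition (hp : Prog.forwardRound.Timely P) {tags : ℕ} (ht : tags ≤ 3)
    {Z : Finset ℕ} (h : Holds P E (scattered P tags Z) cfg) :
    ∀ r ∈ (round P .forwardRound cfg).support, ∃ cfg', r = some cfg' ∧
      Holds P E (fun _ => {x ∈ Finset.range (tags * P.verts) | x ∈ Z}) cfg' := by
  intro r hr
  have htn : tags * P.verts ≤ 3 * P.verts := by gcongr
  obtain ⟨L, hL, rfl⟩ := support_round hP hp h.length_le (wp_forward_marks hP h) r hr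
  have hsp : ∀ j, 6 * P.verts + (E j).length +
      ∑ j : Fin P.machines, ([] : List ℕ).length ≤ P.space := by
    intro j; have := hspace j; simp; omega
  refine ⟨_, shuffle_messages hP le_rfl (fun j => (hL j).1) (fun j => (hL j).2) hsp, ?_⟩
  have := holds_deliver hP le_rfl h.edge_lt (fun j => (hL j).1) hsp
  have hK : receivedMarks P 3 (fun j _ => (j : ℕ)) (scattered P tags Z) =
      fun _ => {x ∈ Finset.range (tags * P.verts) | x ∈ Z} := by
    ext i x
    simp only [receivedMarks, scattered, Finset.mem_filter, Finset.mem_range]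
    constructor
    · rintro ⟨-, j, ⟨hx, hxZ, -⟩, -⟩
      exact ⟨hx, hxZ⟩
    · rintro ⟨hx, hxZ⟩
      -- The sender is the machine responsible for `x`.
      exact ⟨by omega, ⟨x % P.verts % P.machines, Nat.mod_lt _ hP.machines_pos⟩, ⟨hx, hxZ, rfl⟩, rfl⟩
  rwa [hK] at this

/-- Machine `0` has received the edges between eligible vertices. -/
structure Gathered (P : Cluster) (E : Fin P.machines → List ℕ) (Z : Finset ℕ)
    (cfg : Config P) : Prop where
  holds : Holds P E (fun _ => Z) cfg
  gathered : ∀ i : Fin P.machines, (i : ℕ) = 0 → ∀ e,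
    P.verts * P.verts + 3 * P.verts + e ∈ cfg i ↔
    (∃ j, e ∈ E j) ∧ e / P.verts ∈ eligibleSet P Z ∧ e % P.verts ∈ eligibleSet P Z
  lt : ∀ j, ∀ w ∈ cfg j, w < P.verts * P.verts + 3 * P.verts + P.verts * P.verts

/-- All machines already hold all marks; each rebroadcasts its share, because nothing but messages
survives the round. The hypothesis `hg` is what keeps the inbox of machine `0` within its space. -/
lemma gather_transition (hp : Prog.gatherRound.Timely P) {Z : Finset ℕ}
    (h : Holds P E (fun _ => Z) cfg)
    (hg : ∑ j, ((E j).filter fun w => w / P.verts ∈ eligibleSet P Z ∧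
      w % P.verts ∈ eligibleSet P Z).length ≤ g) :
    ∀ r ∈ (round P .gatherRound cfg).support, ∃ cfg', r = some cfg' ∧ Gathered P E Z cfg' := by
  intro r hr
  have h0 := hP.verts_pos
  have hw : ∀ j : Fin P.machines, wp P j (cfg j) .gatherRound (fun _ o =>
      o = messages P (P.verts * P.verts) 3 (fun _ => j) Z j (E j)
        ((E j).filter fun w => w / P.verts ∈ eligibleSet P Z ∧
      w % P.verts ∈ eligibleSet P Z)) (fun _ => 0) [] := by
    intro j
    refine wp_seq (wp_mono (h.wp_load hP j) ?_)
    rintro m o ⟨hM, rfl⟩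
    refine wp_seq (wp_mono (wp_emitMarks hP hM (c := fun _ => (j : ℕ)) le_rfl
      (le_refl (P.verts * P.verts)) (fun m => by simp) (fun m => rfl)) ?_)
    rintro m' o' ⟨hM, rfl⟩
    refine wp_seq (wp_mono (wp_keepEdges hP (h.length_le j) hM) ?_)
    rintro m' o' ⟨hM, rfl⟩
    refine wp_mono (wp_gatherEdges hP (h.length_le j) hM) ?_
    rintro m' o' ⟨hM, rfl⟩
    rw [messages, h.edges j, List.nil_append]
    congr 2
    rw [← h.edges j, List.filter_filter]
    refine List.filter_congr fun w _ => ?_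
    simp only [Bool.decide_and, Bool.and_comm]
  obtain ⟨L, hL, rfl⟩ := support_round hP hp h.length_le hw r hr
  have hsp : ∀ j, 6 * P.verts + (E j).length + ∑ j, ((E j).filter fun w =>
      w / P.verts ∈ eligibleSet P Z ∧ w % P.verts ∈ eligibleSet P Z).length ≤ P.space := by
    intro j; have := hspace j; omega
  refine ⟨_, shuffle_messages hP le_rfl (fun j => (hL j).1) (fun j => (hL j).2) hsp, ?_, ?_, ?_⟩
  · have := holds_deliver hP le_rfl h.edge_lt (fun j => (hL j).1) hsp
    have hK : receivedMarks P 3 (fun j _ => (j : ℕ)) (fun _ => Z) = fun _ => Z := by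
      have hZ : ∀ x ∈ Z, x < 3 * P.verts := by
        intro x hx
        rw [← h.marks ⟨0, hP.machines_pos⟩] at hx
        exact Finset.mem_range.1 (Finset.mem_filter.1 hx).1
      ext i x
      simp only [receivedMarks, Finset.mem_filter, Finset.mem_range]
      constructor
      · rintro ⟨-, j, hx, -⟩
        exact hx
      · intro hx
        exact ⟨hZ x hx, ⟨x % P.verts % P.machines, Nat.mod_lt _ hP.machines_pos⟩, hx, rfl⟩
    rwa [hK] at this
  · intro i hi e
    rw [mem_deliver_messages (fun j => (hL j).1)]
    constructor
    · rintro (⟨j, x, hx, -, -, h'⟩ | h' | ⟨-, j, e', he', h'⟩)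
      · omega
      · have := h.edge_lt i _ h'; omega
      · obtain rfl : e = e' := by omega
        rw [List.mem_filter, decide_eq_true_eq] at he'
        exact ⟨⟨j, he'.1⟩, he'.2⟩
    · rintro ⟨⟨j, hj⟩, he⟩
      exact Or.inr (Or.inr ⟨hi, j, e, List.mem_filter.2 ⟨hj, by simpa using he⟩, rfl⟩)
  · intro i w hw
    rw [mem_deliver_messages (fun j => (hL j).1)] at hw
    rcases hw with ⟨j, x, hx, -, -, h'⟩ | h' | ⟨-, j, e, he, h'⟩
    · nlinarith
    · have := h.edge_lt i _ h'; omega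
    · have := h.edge_lt j _ (List.mem_filter.1 he).1; omega

/-- Adjacency along the edges that the machines hold. -/
def HeldAdj (P : Cluster) (E : Fin P.machines → List ℕ) (u v : ℕ) : Prop :=
  ∃ j, ∃ e ∈ E j, e / P.verts = u ∧ e % P.verts = v ∨ e % P.verts = u ∧ e / P.verts = v

-- Gathering keeps all held edges between eligible vertices and no others, so the adjacency seen by
-- machine `0` is the held adjacency restricted to eligible vertices.
omit hP hspace in
lemma gatheredAdj_iff {Z : Finset ℕ} (h : Gathered P E Z cfg)
    {i : Fin P.machines} (hi : (i : ℕ) = 0) {u v : ℕ} : GatheredAdj P (cfg i) u v ↔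
      u ∈ eligibleSet P Z ∧ v ∈ eligibleSet P Z ∧ HeldAdj P E u v := by
  constructor
  · rintro ⟨w, hw, hle, h'⟩
    obtain ⟨e, rfl⟩ := Nat.exists_eq_add_of_le hle
    rw [h.gathered i hi] at hw
    rw [Nat.add_sub_cancel_left] at h'
    obtain ⟨⟨j, hj⟩, h1, h2⟩ := hw
    rcases h' with ⟨rfl, rfl⟩ | ⟨rfl, rfl⟩
    · exact ⟨h1, h2, j, e, hj, Or.inl ⟨rfl, rfl⟩⟩
    · exact ⟨h2, h1, j, e, hj, Or.inr ⟨rfl, rfl⟩⟩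
  · rintro ⟨hu, hv, j, e, hj, h'⟩
    refine ⟨_, (h.gathered i hi e).2 ⟨⟨j, hj⟩, ?_⟩, Nat.le_add_right _ _, ?_⟩
    · rcases h' with ⟨rfl, rfl⟩ | ⟨rfl, rfl⟩
      · exact ⟨hu, hv⟩
      · exact ⟨hv, hu⟩
    · rw [Nat.add_sub_cancel_left]; exact h'

/-- The vertices that the greedy algorithm chooses from the eligible ones. -/
def chosen (P : Cluster) (E : Fin P.machines → List ℕ) (Z : Finset ℕ) : Finset ℕ :=
  greedySet (fun u v => u ∈ eligibleSet P Z ∧ v ∈ eligibleSet P Z ∧ HeldAdj P E u v)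
    (eligibleSet P Z) P.verts

omit hspace in
lemma wp_ite_self_greedy {Z : Finset ℕ} (h : Gathered P E Z cfg) (j : Fin P.machines) {m : ℕ → ℕ}
    (hM : Marks P Z m) : wp P j (cfg j) (.ite .self .skip .greedy)
      (fun m' o' => ∃ Y, Marks P Y m' ∧ ((j : ℕ) = 0 → IsExtension P (fun u v =>
        u ∈ eligibleSet P Z ∧ v ∈ eligibleSet P Z ∧ HeldAdj P E u v) (chosen P E Z) Z Y) ∧
        ((j : ℕ) ≠ 0 → Y = Z) ∧ o' = []) m [] := by
  refine wp_ite (fun hj => wp_skip ⟨Z, hM, fun h0 => absurd h0 hj, fun _ => rfl, rfl⟩) fun hj => ?_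
  have hj : (j : ℕ) = 0 := hj
  refine wp_mono (wp_greedy hP (h.holds.length_le j) hM (h.lt j)) ?_
  rintro m' o' ⟨Y, hM', hY, rfl⟩
  refine ⟨Y, hM', fun _ => ?_, fun h0 => absurd hj h0, rfl⟩
  have : GatheredAdj P (cfg j) = fun u v =>
      u ∈ eligibleSet P Z ∧ v ∈ eligibleSet P Z ∧ HeldAdj P E u v := by
    ext u v; exact gatheredAdj_iff h hj
  rw [this] at hY
  exact hY

lemma greedy_transition (hp : Prog.greedyRound.Timely P) {Z : Finset ℕ} (h : Gathered P E Z cfg) :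
    ∀ r ∈ (round P .greedyRound cfg).support, ∃ cfg', r = some cfg' ∧
      ∃ Y, IsExtension P (fun u v => u ∈ eligibleSet P Z ∧ v ∈ eligibleSet P Z ∧ HeldAdj P E u v)
        (chosen P E Z) Z Y ∧ Holds P E (scattered P 3 Y) cfg' := by
  intro r hr
  have hw : ∀ j : Fin P.machines, wp P j (cfg j) .greedyRound (fun _ o => ∃ Y,
      (((j : ℕ) = 0 → IsExtension P (fun u v => u ∈ eligibleSet P Z ∧
      v ∈ eligibleSet P Z ∧ HeldAdj P E u v) (chosen P E Z) Z Y) ∧ ((j : ℕ) ≠ 0 → Y = Z)) ∧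
      o = messages P (P.verts * P.verts) 3 id Y j (E j) []) (fun _ => 0) [] := by
    intro j
    refine wp_seq (wp_mono (h.holds.wp_load hP j) ?_)
    rintro m o ⟨hM, rfl⟩
    refine wp_seq (wp_mono (wp_ite_self_greedy hP h j hM) ?_)
    rintro m o ⟨Y, hM, h1, h2, rfl⟩
    have := wp_emit_keep hP (me := j) (h.holds.length_le j) hM (χ := .mem 2) (c := id) le_rfl
      (fun m => rfl)
    rw [h.holds.edges j] at this
    exact wp_mono this fun m' o' h => ⟨Y, ⟨h1, h2⟩, h.2⟩
  obtain ⟨Y, hY, cfg', rfl, hcfg'⟩ := scatter_transition hP hspace hp h.holds le_rfl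
    (R := fun j Y => ((j : ℕ) = 0 → IsExtension P (fun u v => u ∈ eligibleSet P Z ∧
      v ∈ eligibleSet P Z ∧ HeldAdj P E u v) (chosen P E Z) Z Y) ∧ ((j : ℕ) ≠ 0 → Y = Z)) hw r hr
  -- The union of all marks is the set of machine `0`: the others still hold `Z`, which machine `0`
  -- has only extended.
  refine ⟨cfg', rfl, Y ⟨0, hP.machines_pos⟩, (hY _).1 rfl, hcfg' _ fun x _ => ?_⟩
  refine ⟨fun hx => ⟨_, hx⟩, ?_⟩
  rintro ⟨j, hj⟩
  by_cases hj0 : (j : ℕ) = 0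
  · rwa [show j = ⟨0, hP.machines_pos⟩ from Fin.ext hj0] at hj
  · rw [(hY j).2 hj0] at hj
    exact ((hY ⟨0, hP.machines_pos⟩).1 rfl x).2 (Or.inl hj)

/-- Each machine sees only its own edges, but every edge lies on some machine, so the union of their
marks contains all neighbours of chosen vertices. Only two tags are emitted, which erases the
sample. -/
lemma dominate_transition (hp : Prog.dominateRound.Timely P) {X : Finset ℕ}
    (h : Holds P E (fun _ => X) cfg) :
    ∀ r ∈ (round P .dominateRound cfg).support, ∃ cfg', r = some cfg' ∧
      ∀ Z, (∀ x < 2 * P.verts, x ∈ Z ↔ x ∈ X ∨ ∃ u v, u ∈ X ∧ HeldAdj P E u v ∧ x = P.verts + v) →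
        Holds P E (scattered P 2 Z) cfg' := by
  intro r hr
  have hw : ∀ j : Fin P.machines, wp P j (cfg j) .dominateRound (fun _ o => ∃ Y,
      IsDominated P (cfg j) X Y ∧
      o = messages P (P.verts * P.verts) 2 id Y j (E j) []) (fun _ => 0) [] := by
    intro j
    refine wp_seq (wp_mono (h.wp_load hP j) ?_)
    rintro m o ⟨hM, rfl⟩
    refine wp_seq (wp_mono (wp_dominate hP (h.length_le j) hM) ?_)
    rintro m o ⟨Y, hM, hY, rfl⟩
    have := wp_emit_keep hP (me := j) (h.length_le j) hM (χ := .mem 2) (c := id) (tags := 2)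
      (by omega) (fun m => rfl)
    rw [h.edges j] at this
    exact wp_mono this fun m' o' h => ⟨Y, hY, h.2⟩
  obtain ⟨Y, hY, cfg', rfl, hcfg'⟩ := scatter_transition hP hspace hp h (tags := 2) (by omega)
    (R := fun j Y => IsDominated P (cfg j) X Y) hw r hr
  refine ⟨cfg', rfl, fun Z hZ => hcfg' _ fun x hx => ?_⟩
  rw [hZ x hx]
  constructor
  · rintro (hx | ⟨u, v, hu, ⟨j, e, he, h'⟩, rfl⟩)
    · exact ⟨⟨0, hP.machines_pos⟩, (hY _ _).2 (Or.inl hx)⟩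
    · refine ⟨j, (hY j _).2 (Or.inr ⟨e, ?_, h.edge_lt j e he, ?_⟩)⟩
      · rw [← h.edges j] at he
        exact (List.mem_filter.1 he).1
      · rcases h' with ⟨rfl, rfl⟩ | ⟨rfl, rfl⟩
        · exact Or.inl ⟨hu, rfl⟩
        · exact Or.inr ⟨hu, rfl⟩
  · rintro ⟨j, hj⟩
    rcases (hY j x).1 hj with hj | ⟨w, hw, hlt, h'⟩
    · exact Or.inl hj
    · have hwE : w ∈ E j := by
        rw [← h.edges j]; exact List.mem_filter.2 ⟨hw, by simpa using hlt⟩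
      rcases h' with ⟨hu, rfl⟩ | ⟨hu, rfl⟩
      · exact Or.inr ⟨_, _, hu, ⟨j, w, hwE, Or.inl ⟨rfl, rfl⟩⟩, rfl⟩
      · exact Or.inr ⟨_, _, hu, ⟨j, w, hwE, Or.inr ⟨rfl, rfl⟩⟩, rfl⟩

/-- The last round writes the chosen vertices. -/
lemma output_transition (hp : Prog.outputRound.Timely P) {Z : Finset ℕ} (h : Gathered P E Z cfg) :
    ∀ r ∈ (round P .outputRound cfg).support, ∃ cfg', r = some cfg' ∧
      ∀ v < P.verts, (∃ j, v ∈ cfg' j) ↔ v ∈ Z ∨ v ∈ chosen P E Z := by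
  intro r hr
  have hw : ∀ j : Fin P.machines, wp P j (cfg j) .outputRound (fun _ o => ∃ Y,
      (((j : ℕ) = 0 → IsExtension P (fun u v => u ∈ eligibleSet P Z ∧
      v ∈ eligibleSet P Z ∧ HeldAdj P E u v) (chosen P E Z) Z Y) ∧ ((j : ℕ) ≠ 0 → Y = Z)) ∧
      o = messages P 0 1 id Y j [] []) (fun _ => 0) [] := by
    intro j
    refine wp_seq (wp_mono (h.holds.wp_load hP j) ?_)
    rintro m o ⟨hM, rfl⟩
    refine wp_seq (wp_mono (wp_ite_self_greedy hP h j hM) ?_)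
    rintro m o ⟨Y, hM, h1, h2, rfl⟩
    refine wp_mono (wp_emitMarks hP hM (b := 0) (c := id) (by omega) (Nat.zero_le _) (fun m => rfl)
      (fun m => rfl)) ?_
    rintro m' o' ⟨-, rfl⟩
    exact ⟨Y, ⟨h1, h2⟩, by simp [messages]⟩
  obtain ⟨L, hL, rfl⟩ := support_round hP hp h.holds.length_le hw r hr
  choose Y hY hout using fun j => (hL j).1
  have hsp : ∀ j : Fin P.machines, 6 * P.verts + ([] : List ℕ).length +
      ∑ j : Fin P.machines, ([] : List ℕ).length ≤ P.space := by
    intro j; have := hspace j; simp; omega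
  refine ⟨_, shuffle_messages hP (E := fun _ => []) (F := fun _ => []) (by omega) hout
    (fun j => (hL j).2) hsp, fun v hv => ?_⟩
  have hmem := fun i => mem_deliver_messages (E := fun _ => []) (F := fun _ => []) hout i v
  constructor
  · rintro ⟨i, hi⟩
    rcases (hmem i).1 hi with ⟨j, x, hx, hxY, -, h'⟩ | h' | ⟨-, j, e, he, -⟩
    · obtain rfl : v = x := by omega
      by_cases hj0 : (j : ℕ) = 0
      · rcases ((hY j).1 hj0 v).1 hxY with h1 | h1 | ⟨v', hv', h1, -⟩
        · exact Or.inl h1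
        · exact Or.inr h1
        · omega
      · rw [(hY j).2 hj0] at hxY
        exact Or.inl hxY
    · simp at h'
    · simp at he
  · intro h'
    refine ⟨⟨v % P.verts % P.machines, Nat.mod_lt _ hP.machines_pos⟩, (hmem _).2 (Or.inl
      ⟨⟨0, hP.machines_pos⟩, v, by omega, ((hY _).1 rfl v).2 ?_, rfl, by omega⟩)⟩
    rcases h' with h' | h'
    · exact Or.inl h'
    · exact Or.inr (Or.inl h')

end Transitions

end MapReduce
end

noncomputable section

/-! ### Random samples and the greedy algorithm -/

namespace MapReduce

lemma expect_uniformBelow {a : ℕ} (ha : 0 < a) (x y : ℝ≥0∞) :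
    ((uniformBelow a).expect fun r => if r = 0 then x else y) =
      ENNReal.ofReal (1 / a) * x + ENNReal.ofReal (1 - 1 / a) * y := by
  obtain ⟨b, rfl⟩ := Nat.exists_eq_succ_of_ne_zero ha.ne'
  have hmax : max (b + 1) 1 = b + 1 := by omega
  have hval : ∀ r, uniformBelow (b + 1) r = if r < b + 1 then ((b + 1 : ℕ) : ℝ≥0∞)⁻¹ else 0 := by
    intro r
    refine (PMF.uniformOfFinset_apply _ r).trans ?_
    rw [Finset.card_range]
    simp only [Finset.mem_range, hmax]
  have hb : (0 : ℝ) < (b + 1 : ℕ) := by positivity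
  rw [PMF.expect, tsum_eq_sum (s := Finset.range (b + 1))]
  · rw [Finset.sum_range_succ', add_comm]
    have h1 : ∀ r ∈ Finset.range b, uniformBelow (b + 1) (r + 1) *
        (if r + 1 = 0 then x else y) = ((b + 1 : ℕ) : ℝ≥0∞)⁻¹ * y := by
      intro r hr
      have : r + 1 < b + 1 := by have := Finset.mem_range.1 hr; omega
      rw [hval, if_pos this, if_neg (by omega)]
    rw [Finset.sum_congr rfl h1, hval, if_pos (by omega), if_pos rfl, Finset.sum_const,
      Finset.card_range, nsmul_eq_mul, ← mul_assoc]
    congr 2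
    · rw [one_div, ENNReal.ofReal_inv_of_pos hb, ENNReal.ofReal_natCast]
    · rw [one_sub_div hb.ne', ENNReal.ofReal_div_of_pos hb, ENNReal.ofReal_natCast, div_eq_mul_inv]
      congr 1
      push_cast
      rw [add_sub_cancel_right, ENNReal.ofReal_natCast]
  · intro r hr
    rw [hval, if_neg (by simpa using hr), zero_mul]

/-- A potential on samples that does not increase in expectation. -/
lemma expect_coinSet_le {a : ℕ} (ha : 0 < a) (Φ : ℕ → Finset ℕ → ℝ) (k : ℕ)
    (hΦ : ∀ i A, 0 ≤ Φ i A)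
    (h : ∀ i < k, ∀ A, 1 / a * Φ (i + 1) (insert i A) + (1 - 1 / a) * Φ (i + 1) A ≤ Φ i A) :
    (coinSet a k).expect (fun A => ENNReal.ofReal (Φ k A)) ≤ ENNReal.ofReal (Φ 0 ∅) := by
  have ha' : (1 : ℝ) ≤ a := by exact_mod_cast ha
  have h1 : (0 : ℝ) ≤ 1 - 1 / a := by
    rw [sub_nonneg, div_le_one (by linarith)]; exact ha'
  refine expect_iterate_le _ (fun i A => ENNReal.ofReal (Φ i A)) k ?_ ∅
  intro i hi A
  rw [PMF.expect_map]
  have : ((fun A => ENNReal.ofReal (Φ (i + 1) A)) ∘ fun r => if r = 0 then insert i A else A) =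
      fun r => if r = 0 then ENNReal.ofReal (Φ (i + 1) (insert i A))
        else ENNReal.ofReal (Φ (i + 1) A) := by
    ext r; simp only [Function.comp_apply]; split_ifs <;> rfl
  rw [this, expect_uniformBelow ha, ← ENNReal.ofReal_mul (by positivity),
    ← ENNReal.ofReal_mul h1, ← ENNReal.ofReal_add (mul_nonneg (by positivity) (hΦ _ _))
      (mul_nonneg h1 (hΦ _ _))]
  exact ENNReal.ofReal_le_ofReal (h i hi A)

/-- Markov's inequality for exponential potentials. -/
lemma toOuterMeasure_coinSet_le {a : ℕ} (ha : 0 < a) (Φ : ℕ → Finset ℕ → ℝ) (k : ℕ) (t : ℝ)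
    (hΦ : ∀ i A, 0 ≤ Φ i A) (h0 : Φ 0 ∅ ≤ 1)
    (h : ∀ i < k, ∀ A, 1 / a * Φ (i + 1) (insert i A) + (1 - 1 / a) * Φ (i + 1) A ≤ Φ i A)
    (B : Finset ℕ → Prop) (hB : ∀ A, B A → Real.exp t ≤ Φ k A) :
    (coinSet a k).toOuterMeasure {A | B A} ≤ ENNReal.ofReal (Real.exp (-t)) := by
  have h1 := (PMF.mul_toOuterMeasure_le_expect (coinSet a k) {A | B A}
    (ENNReal.ofReal (Real.exp t)) (Φ := fun A => ENNReal.ofReal (Φ k A))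
    fun A hA => ENNReal.ofReal_le_ofReal (hB A hA)).trans (expect_coinSet_le ha Φ k hΦ h)
  have h2 := h1.trans (ENNReal.ofReal_le_ofReal h0)
  rw [ENNReal.ofReal_one] at h2
  have h3 : ENNReal.ofReal (Real.exp (-t)) * ENNReal.ofReal (Real.exp t) = 1 := by
    rw [← ENNReal.ofReal_mul (Real.exp_pos _).le, ← Real.exp_add]; simp
  calc (coinSet a k).toOuterMeasure {A | B A}
      = ENNReal.ofReal (Real.exp (-t)) * (ENNReal.ofReal (Real.exp t) *
        (coinSet a k).toOuterMeasure {A | B A}) := by rw [← mul_assoc, h3, one_mul]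
    _ ≤ ENNReal.ofReal (Real.exp (-t)) * 1 := by gcongr
    _ = _ := mul_one _

/-- For `x ≤ 1 / 2` use `exp x ≤ 1 / (1 - x)`; beyond that, use the chord from `0` to `1`, whose
slope is `e - 1 < 2`. -/
lemma exp_le_one_add_two_mul {x : ℝ} (h0 : 0 ≤ x) (h1 : x ≤ 1) : Real.exp x ≤ 1 + 2 * x := by
  by_cases hx : x ≤ 1 / 2
  · have h2 : Real.exp x ≤ 1 / (1 - x) := Real.exp_bound_div_one_sub_of_interval h0 (by linarith)
    refine h2.trans ?_
    rw [div_le_iff₀ (by linarith)]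
    nlinarith
  · have h3 := convexOn_exp.2 (Set.mem_univ 0) (Set.mem_univ 1) (sub_nonneg.2 h1) h0 (by ring)
    simp only [smul_eq_mul, mul_zero, mul_one, zero_add, Real.exp_zero] at h3
    have := Real.exp_one_lt_d9
    nlinarith

/-- A Chernoff bound for the weight of a random sample. -/
lemma toOuterMeasure_weight_le {a : ℕ} (ha : 0 < a) (w : ℕ → ℝ) (hw0 : ∀ u, 0 ≤ w u)
    (hw1 : ∀ u, w u ≤ 1) (k : ℕ) (t : ℝ) :
    (coinSet a k).toOuterMeasure
      {A | ¬∑ u ∈ A, w u ≤ 2 / a * ∑ u ∈ Finset.range k, w u + t} ≤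
      ENNReal.ofReal (Real.exp (-t)) := by
  have ha' : (1 : ℝ) ≤ a := by exact_mod_cast ha
  -- An exponential supermartingale: coin `i` is compensated by twice its mean weight `w i / a`.
  refine toOuterMeasure_coinSet_le ha (fun i A => Real.exp (∑ u ∈ A, w u -
    2 / a * ∑ u ∈ Finset.range i, w u)) k t (fun _ _ => (Real.exp_pos _).le) (by simp) ?_ _ ?_
  · intro i hi A
    -- The potential inequality is required for every state `A`, including those that already
    -- contain `i`; an inequality suffices.
    have h1 : ∑ u ∈ insert i A, w u ≤ ∑ u ∈ A, w u + w i := by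
      by_cases h : i ∈ A
      · rw [Finset.insert_eq_of_mem h]; linarith [hw0 i]
      · rw [Finset.sum_insert h]; linarith
    rw [Finset.sum_range_succ]
    set s := ∑ u ∈ A, w u
    set c := ∑ u ∈ Finset.range i, w u
    have h2 : Real.exp (∑ u ∈ insert i A, w u - 2 / a * (c + w i)) ≤
        Real.exp (s - 2 / a * c) * (Real.exp (-(2 / a * w i)) * Real.exp (w i)) := by
      rw [← Real.exp_add, ← Real.exp_add]
      apply Real.exp_le_exp.2
      linarith
    have h3 : Real.exp (s - 2 / a * (c + w i)) =
        Real.exp (s - 2 / a * c) * Real.exp (-(2 / a * w i)) := by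
      rw [← Real.exp_add]; congr 1; ring
    have h4 : 1 / (a : ℝ) * Real.exp (w i) + (1 - 1 / a) ≤ Real.exp (2 / a * w i) := by
      have := exp_le_one_add_two_mul (hw0 i) (hw1 i)
      calc 1 / (a : ℝ) * Real.exp (w i) + (1 - 1 / a)
          ≤ 1 / (a : ℝ) * (1 + 2 * w i) + (1 - 1 / a) := by gcongr
        _ = 2 / a * w i + 1 := by ring
        _ ≤ _ := Real.add_one_le_exp _
    have h5 : Real.exp (-(2 / a * w i)) * Real.exp (2 / a * w i) = 1 := by
      rw [← Real.exp_add]; simp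
    rw [h3]
    calc 1 / (a : ℝ) * Real.exp (∑ u ∈ insert i A, w u - 2 / a * (c + w i)) +
          (1 - 1 / a) * (Real.exp (s - 2 / a * c) * Real.exp (-(2 / a * w i)))
        ≤ 1 / (a : ℝ) * (Real.exp (s - 2 / a * c) * (Real.exp (-(2 / a * w i)) * Real.exp (w i))) +
          (1 - 1 / a) * (Real.exp (s - 2 / a * c) * Real.exp (-(2 / a * w i))) := by gcongr
      _ = Real.exp (s - 2 / a * c) * (Real.exp (-(2 / a * w i)) *
          (1 / (a : ℝ) * Real.exp (w i) + (1 - 1 / a))) := by ring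
      _ ≤ Real.exp (s - 2 / a * c) * (Real.exp (-(2 / a * w i)) * Real.exp (2 / a * w i)) := by
          gcongr
      _ = Real.exp (s - 2 / a * c) := by rw [h5, mul_one]
  · intro A hA
    apply Real.exp_le_exp.2
    linarith [not_le.1 hA]

/-! ### Sequential greedy on a random sample -/

section Greedy

open Classical

variable (H : SimpleGraph ℕ) (N : ℕ)

/-- The vertices outside `J` without a neighbour in `J`. -/
def alive (J : Finset ℕ) : Finset ℕ := {v ∈ Finset.range N | v ∉ J ∧ ∀ u ∈ J, ¬H.Adj u v}

/-- The number of neighbours outside the closed neighbourhood of `J`. -/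
def aliveDeg (J : Finset ℕ) (v : ℕ) : ℕ := {u ∈ alive H N J | H.Adj v u}.card

/-- The sum of the degrees in the graph induced by the vertices outside the closed neighbourhood. -/
def aliveDegSum (J : Finset ℕ) : ℕ := ∑ v ∈ alive H N J, aliveDeg H N J v

/-- The greedy algorithm on the vertices in `A`, started with `J`. -/
def seqGreedy (A J : Finset ℕ) : ℕ → Finset ℕ
  | 0 => J
  | i + 1 => if i ∈ A ∧ i ∈ alive H N (seqGreedy A J i) then insert i (seqGreedy A J i)
      else seqGreedy A J i

variable {H N}

lemma alive_anti {I J : Finset ℕ} (h : I ⊆ J) : alive H N J ⊆ alive H N I := by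
  intro v hv
  simp only [alive, Finset.mem_filter] at hv ⊢
  exact ⟨hv.1, fun hI => hv.2.1 (h hI), fun u hu => hv.2.2 u (h hu)⟩

lemma subset_seqGreedy_succ (A J : Finset ℕ) (i : ℕ) :
    seqGreedy H N A J i ⊆ seqGreedy H N A J (i + 1) := by
  rw [seqGreedy]
  split_ifs
  · exact Finset.subset_insert _ _
  · exact subset_rfl

lemma seqGreedy_mono (A J : Finset ℕ) : Monotone (seqGreedy H N A J) :=
  monotone_nat_of_le_succ (subset_seqGreedy_succ A J)

/-- Causality: the first `k` steps consult the sample only below `k`. This lets the coins be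
revealed one by one along the greedy run. -/
lemma seqGreedy_insert_of_le (A J : Finset ℕ) {i k : ℕ} (hk : k ≤ i) :
    seqGreedy H N (insert i A) J k = seqGreedy H N A J k := by
  induction k with
  | zero => rfl
  | succ k ih =>
    rw [seqGreedy, seqGreedy, ih (by omega)]
    have : k ∈ insert i A ↔ k ∈ A := by
      rw [Finset.mem_insert]; exact or_iff_right (by omega)
    simp only [this]

/-- The number of neighbours of `v` below `i` that were not dominated at their time. -/
def testCount (H : SimpleGraph ℕ) (N : ℕ) (A J : Finset ℕ) (v i : ℕ) : ℕ :=
  {u ∈ Finset.range i | H.Adj v u ∧ u ∈ alive H N (seqGreedy H N A J u)}.card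

lemma testCount_insert (A J : Finset ℕ) (v i : ℕ) :
    testCount H N (insert i A) J v i = testCount H N A J v i := by
  unfold testCount
  congr 1
  refine Finset.filter_congr fun u hu => ?_
  rw [seqGreedy_insert_of_le A J (Finset.mem_range.1 hu).le]

lemma testCount_succ (A J : Finset ℕ) (v i : ℕ) :
    testCount H N A J v (i + 1) = testCount H N A J v i +
      if H.Adj v i ∧ i ∈ alive H N (seqGreedy H N A J i) then 1 else 0 := by
  unfold testCount
  rw [Finset.range_add_one, Finset.filter_insert]
  split_ifs
  · rw [Finset.card_insert_of_notMem (by simp)]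
  · rfl

/-- A neighbour that is alive at the end was alive at its own turn, hence was counted as a test. -/
lemma aliveDeg_le_testCount (A J : Finset ℕ) (v : ℕ) :
    aliveDeg H N (seqGreedy H N A J N) v ≤ testCount H N A J v N := by
  refine Finset.card_le_card fun u hu => ?_
  simp only [Finset.mem_filter] at hu ⊢
  have hN : u ∈ Finset.range N := (Finset.mem_filter.1 hu.1).1
  exact ⟨hN, hu.2, alive_anti (seqGreedy_mono A J (Finset.mem_range.1 hN).le) hu.1⟩

/-- With high probability, after the greedy algorithm has processed a random sample, a vertex is
dominated or has few undominated neighbours. -/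
lemma toOuterMeasure_aliveDeg_le {a : ℕ} (ha : 0 < a) (J : Finset ℕ) (v : ℕ) (t : ℝ) :
    (coinSet a N).toOuterMeasure {A | ¬(v ∈ alive H N (seqGreedy H N A J N) →
      (aliveDeg H N (seqGreedy H N A J N) v : ℝ) ≤ a * t)} ≤ ENNReal.ofReal (Real.exp (-t)) := by
  have ha' : (1 : ℝ) ≤ a := by exact_mod_cast ha
  have ha1 : (0 : ℝ) ≤ 1 - 1 / a := by
    rw [sub_nonneg, div_le_one (by linarith)]; exact ha'
  -- The potential is `exp (tests / a)` while `v` is alive and `0` afterwards. A test kills `v` with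
  -- probability `1 / a` and otherwise multiplies the potential by `exp (1 / a)`; since `(1 - 1 / a)
  -- * exp (1 / a) ≤ 1`, it does not grow in expectation.
  refine toOuterMeasure_coinSet_le ha (fun i A => if v ∈ alive H N (seqGreedy H N A J i) then
    Real.exp (1 / a * testCount H N A J v i) else 0) N t ?_ ?_ ?_ _ ?_
  · intro i A; positivity
  · simp only [testCount, Finset.range_zero, Finset.filter_empty, Finset.card_empty]
    split_ifs <;> simp
  · intro i hi A
    by_cases hv : v ∈ alive H N (seqGreedy H N A J i)
    · rw [if_pos hv]
      by_cases hvi : H.Adj v i ∧ i ∈ alive H N (seqGreedy H N A J i)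
      · have h1 : v ∉ alive H N (seqGreedy H N (insert i A) J (i + 1)) := by
          rw [seqGreedy, seqGreedy_insert_of_le A J le_rfl, if_pos ⟨by simp, hvi.2⟩]
          intro h
          exact (Finset.mem_filter.1 h).2.2 i (by simp) hvi.1.symm
        rw [if_neg h1, mul_zero, zero_add, testCount_succ, if_pos hvi]
        have h2 : (1 - 1 / (a : ℝ)) * Real.exp (1 / a) ≤ 1 := by
          have := Real.add_one_le_exp (-(1 / (a : ℝ)))
          calc (1 - 1 / (a : ℝ)) * Real.exp (1 / a)
              ≤ Real.exp (-(1 / (a : ℝ))) * Real.exp (1 / a) := by gcongr; linarith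
            _ = 1 := by rw [← Real.exp_add]; simp
        calc (1 - 1 / (a : ℝ)) * (if v ∈ alive H N (seqGreedy H N A J (i + 1)) then
              Real.exp (1 / a * ((testCount H N A J v i + 1 : ℕ) : ℝ)) else 0)
            ≤ (1 - 1 / (a : ℝ)) * Real.exp (1 / a * ((testCount H N A J v i + 1 : ℕ) : ℝ)) := by
              gcongr
              split_ifs
              · exact le_rfl
              · positivity
          _ = ((1 - 1 / (a : ℝ)) * Real.exp (1 / a)) * Real.exp (1 / a * testCount H N A J v i) := by
              rw [mul_assoc, ← Real.exp_add]; congr 2; push_cast; ring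
          _ ≤ 1 * Real.exp (1 / a * testCount H N A J v i) := by gcongr
          _ = _ := one_mul _
      · have h1 : ∀ B : Finset ℕ, testCount H N B J v i = testCount H N A J v i →
            seqGreedy H N B J i = seqGreedy H N A J i →
            (if v ∈ alive H N (seqGreedy H N B J (i + 1)) then
              Real.exp (1 / a * testCount H N B J v (i + 1)) else 0) ≤
              Real.exp (1 / a * testCount H N A J v i) := by
          intro B hB hB'
          rw [testCount_succ, hB, hB', if_neg hvi, add_zero]
          split_ifs
          · exact le_rfl
          · positivity
        have h2 := h1 (insert i A) (testCount_insert A J v i) (seqGreedy_insert_of_le A J le_rfl)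
        have h3 := h1 A rfl rfl
        calc _ ≤ 1 / (a : ℝ) * Real.exp (1 / a * testCount H N A J v i) +
              (1 - 1 / a) * Real.exp (1 / a * testCount H N A J v i) := by gcongr
          _ = _ := by ring
    · have h1 : v ∉ alive H N (seqGreedy H N A J (i + 1)) := fun h =>
        hv (alive_anti (subset_seqGreedy_succ A J i) h)
      have h2 : v ∉ alive H N (seqGreedy H N (insert i A) J (i + 1)) := fun h => by
        have := alive_anti (subset_seqGreedy_succ (insert i A) J i) h
        rw [seqGreedy_insert_of_le A J le_rfl] at this
        exact hv this
      rw [if_neg hv, if_neg h1, if_neg h2]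
      simp
  · intro A hA
    rw [Classical.not_imp] at hA
    rw [if_pos hA.1]
    apply Real.exp_le_exp.2
    have h1 : (aliveDeg H N (seqGreedy H N A J N) v : ℝ) ≤ testCount H N A J v N := by
      exact_mod_cast aliveDeg_le_testCount A J v
    rw [one_div, inv_mul_eq_div, le_div_iff₀ (by linarith)]
    linarith [not_le.1 hA.2]

/-- The number of pairs of adjacent undominated vertices in the sample. -/
def samplePairs (H : SimpleGraph ℕ) (N : ℕ) (J A : Finset ℕ) : ℕ :=
  ∑ v ∈ A ∩ alive H N J, {u ∈ A ∩ alive H N J | H.Adj v u}.card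

/-- The event that the sample spans few edges, and the greedy algorithm makes progress. -/
structure GoodSample (H : SimpleGraph ℕ) (N a : ℕ) (t : ℝ) (J A : Finset ℕ) : Prop where
  pairs_le : (samplePairs H N J A : ℝ) ≤ 4 / a ^ 2 * aliveDegSum H N J + 3 * N * t
  degSum_le : (aliveDegSum H N (seqGreedy H N A J N) : ℝ) ≤ N * (a * t)

lemma toOuterMeasure_goodSample_le {a : ℕ} (ha : 0 < a) (hN : 0 < N) (J : Finset ℕ) {t : ℝ}
    (ht : 0 ≤ t) :
    (coinSet a N).toOuterMeasure {A | ¬(A ⊆ Finset.range N → GoodSample H N a t J A)} ≤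
      ENNReal.ofReal ((2 * N + 1) * Real.exp (-t)) := by
  have ha' : (1 : ℝ) ≤ a := by exact_mod_cast ha
  have hN' : (0 : ℝ) < N := by exact_mod_cast hN
  -- Two kinds of weights: `w v` counts sampled alive neighbours of `v`, and `w'` is the degree of a
  -- sampled alive vertex, divided by `N` so that the Chernoff bound for weights in `[0, 1]`
  -- applies. The first bounds each row of sampled pairs by `2 / a` times the degree plus `t`, the
  -- second bounds the sum of degrees over the sample; together they yield the factor `4 / a ^ 2`,
  -- although the two ends of a pair come from the same sample.
  set w : ℕ → ℕ → ℝ := fun v u => if u ∈ alive H N J ∧ H.Adj v u then 1 else 0 with hw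
  set w' : ℕ → ℝ := fun u => if u ∈ alive H N J then aliveDeg H N J u / N else 0 with hw'
  have hdeg : ∀ v, ∑ u ∈ Finset.range N, w v u = aliveDeg H N J v := by
    intro v
    rw [hw, aliveDeg, ← Finset.sum_filter, Finset.sum_const, nsmul_eq_mul, mul_one]
    congr 2
    ext u
    simp only [Finset.mem_filter, alive]
    tauto
  have hdegsum : ∑ u ∈ Finset.range N, w' u = aliveDegSum H N J / N := by
    rw [hw', ← Finset.sum_filter, ← Finset.sum_div]
    congr 1
    rw [aliveDegSum, Nat.cast_sum]
    refine Finset.sum_congr ?_ fun _ _ => rfl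
    ext u
    simp only [Finset.mem_filter, alive]
    tauto
  have hdegle : ∀ v, (aliveDeg H N J v : ℝ) ≤ N := by
    intro v
    have : aliveDeg H N J v ≤ (Finset.range N).card :=
      Finset.card_le_card fun u hu => (Finset.mem_filter.1 (Finset.mem_filter.1 hu).1).1
    rw [Finset.card_range] at this
    exact_mod_cast this
  have e1 := PMF.toOuterMeasure_exists_le (coinSet a N) (Finset.range N)
    (fun v A => ¬∑ u ∈ A, w v u ≤ 2 / a * ∑ u ∈ Finset.range N, w v u + t)
    fun v _ => toOuterMeasure_weight_le ha (w v) (fun u => by simp only [hw]; split_ifs <;> simp)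
      (fun u => by simp only [hw]; split_ifs <;> simp) N t
  have e2 := toOuterMeasure_weight_le ha w'
    (fun u => by simp only [hw']; split_ifs <;> positivity)
    (fun u => by
      simp only [hw']; split_ifs
      · rw [div_le_one hN']; exact hdegle u
      · simp) N t
  have e3 := PMF.toOuterMeasure_exists_le (coinSet a N) (Finset.range N)
    (fun v A => ¬(v ∈ alive H N (seqGreedy H N A J N) →
      (aliveDeg H N (seqGreedy H N A J N) v : ℝ) ≤ a * t))
    fun v _ => toOuterMeasure_aliveDeg_le ha J v t
  have hsub : {A | ¬(A ⊆ Finset.range N → GoodSample H N a t J A)} ⊆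
      ({A | ∃ v ∈ Finset.range N, ¬∑ u ∈ A, w v u ≤ 2 / a * ∑ u ∈ Finset.range N, w v u + t} ∪
      {A | ¬∑ u ∈ A, w' u ≤ 2 / a * ∑ u ∈ Finset.range N, w' u + t}) ∪
      {A | ∃ v ∈ Finset.range N, ¬(v ∈ alive H N (seqGreedy H N A J N) →
      (aliveDeg H N (seqGreedy H N A J N) v : ℝ) ≤ a * t)} := by
    intro A hA
    by_contra hcon
    simp only [Set.mem_union, Set.mem_ofPred_eq, not_or, not_exists, not_and, not_not] at hcon hA
    obtain ⟨⟨h1, h2⟩, h3⟩ := hcon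
    refine hA fun hAN => ⟨?_, ?_⟩
    · have h4 : ∀ v ∈ A ∩ alive H N J, (({u ∈ A ∩ alive H N J | H.Adj v u}.card : ℕ) : ℝ) ≤
          2 / a * aliveDeg H N J v + t := by
        intro v hv
        have hvA := Finset.mem_of_mem_inter_left hv
        have := h1 v (hAN hvA)
        rw [hdeg] at this
        refine le_trans (le_of_eq ?_) this
        rw [hw, ← Finset.sum_filter, Finset.sum_const, nsmul_eq_mul, mul_one]
        congr 2
        ext u
        simp only [Finset.mem_filter, Finset.mem_inter, and_assoc]
      have h5 : ∑ v ∈ A ∩ alive H N J, (aliveDeg H N J v : ℝ) ≤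
          2 / a * aliveDegSum H N J + N * t := by
        have h6 : ∑ u ∈ A, w' u = (∑ v ∈ A ∩ alive H N J, (aliveDeg H N J v : ℝ)) / N := by
          rw [hw', ← Finset.sum_filter, ← Finset.sum_div, Finset.filter_mem_eq_inter]
        rw [h6, hdegsum, div_le_iff₀ hN'] at h2
        refine h2.trans (le_of_eq ?_)
        field_simp
      have h7 : ((A ∩ alive H N J).card : ℝ) ≤ N := by
        have := Finset.card_le_card ((Finset.inter_subset_left (s₂ := alive H N J)).trans hAN)
        rw [Finset.card_range] at this
        exact_mod_cast this
      rw [samplePairs, Nat.cast_sum]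
      calc _ ≤ ∑ v ∈ A ∩ alive H N J, (2 / a * (aliveDeg H N J v : ℝ) + t) :=
            Finset.sum_le_sum h4
        _ = 2 / a * ∑ v ∈ A ∩ alive H N J, (aliveDeg H N J v : ℝ) + (A ∩ alive H N J).card * t := by
            rw [Finset.sum_add_distrib, ← Finset.mul_sum, Finset.sum_const, nsmul_eq_mul]
        _ ≤ 2 / a * (2 / a * aliveDegSum H N J + N * t) + N * t := by gcongr
        _ = 4 / a ^ 2 * aliveDegSum H N J + 2 / a * (N * t) + N * t := by ring
        _ ≤ 4 / a ^ 2 * aliveDegSum H N J + 2 * (N * t) + N * t := by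
            gcongr
            exact div_le_self (by norm_num) ha'
        _ = _ := by ring
    · rw [aliveDegSum, Nat.cast_sum]
      refine (Finset.sum_le_card_nsmul _ _ (a * t) fun v hv => ?_).trans ?_
      · exact h3 v (Finset.mem_filter.1 hv).1 hv
      · rw [nsmul_eq_mul]
        have : (alive H N (seqGreedy H N A J N)).card ≤ (Finset.range N).card :=
          Finset.card_le_card (Finset.filter_subset _ _)
        rw [Finset.card_range] at this
        gcongr
  -- `2 * N + 1` events: one row bound and one survival bound for each vertex, and a single bound
  -- for the total degree.
  refine (MeasureTheory.OuterMeasure.mono _ hsub).trans ((PMF.toOuterMeasure_union_le _ _ _).trans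
    ((add_le_add_left (PMF.toOuterMeasure_union_le _ _ _) _).trans ?_))
  refine (add_le_add (add_le_add e1 e2) e3).trans (le_of_eq ?_)
  rw [Finset.card_range, ENNReal.ofReal_mul (by positivity), ENNReal.ofReal_add (by positivity)
    zero_le_one, ENNReal.ofReal_mul (by norm_num), ENNReal.ofReal_natCast, ENNReal.ofReal_one]
  rw [ENNReal.ofReal_ofNat]
  ring

/-- This makes the last phase a sampling phase with `a = 1`, so the same rounds can be reused. -/
lemma support_coinSet_one (k : ℕ) : ∀ A ∈ (coinSet 1 k).support, A = Finset.range k := by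
  refine support_iterate _ (fun i A => A = Finset.range i) k ?_ ∅ rfl
  rintro i - A rfl A' hA'
  rw [PMF.mem_support_map_iff] at hA'
  obtain ⟨r, hr, rfl⟩ := hA'
  rw [mem_support_uniformBelow] at hr
  rw [if_pos (by omega), Finset.range_add_one]

end Greedy

end MapReduce
end

noncomputable section

/-! ### The sampling round -/

lemma PMF.map_eq_pure {α β : Type} (p : PMF α) {f : α → β} {b : β}
    (h : ∀ x ∈ p.support, f x = b) : p.map f = PMF.pure b := by
  rw [PMF.map_congr_support p (g := Function.const α b) h, PMF.map_const]

lemma PMF.bind_eq_of_support {α β : Type} (p : PMF α) {f : α → PMF β} {q : PMF β}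
    (h : ∀ x ∈ p.support, f x = q) : p.bind f = q := by
  rw [PMF.bind_congr_support p (g := fun _ => q) h, PMF.bind_const]

namespace MapReduce

/-- The event concerns only the first entry, that is, machine `0`, the only one that flips coins. -/
lemma toOuterMeasure_sampleAll_finRange_le {α : Type} {M : ℕ} (hM : 0 < M) (f : Fin M → PMF α)
    (s : Set α) : (sampleAll ((List.finRange M).map f)).toOuterMeasure
      {xs | ∃ x ∈ xs.head?, x ∈ s} ≤ (f ⟨0, hM⟩).toOuterMeasure s := by
  obtain ⟨k, rfl⟩ := Nat.exists_eq_succ_of_ne_zero hM.ne'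
  rw [List.finRange_succ, List.map_cons, sampleAll]
  refine (PMF.toOuterMeasure_bind_le _ _ s _ (ε := 0) fun x _ hx => ?_).trans (by simp)
  rw [PMF.toOuterMeasure_map_apply]
  have : (fun xs => x :: xs) ⁻¹' {xs | ∃ x ∈ xs.head?, x ∈ s} = ∅ := by
    ext xs; simpa using hx
  rw [this]
  exact (MeasureTheory.measure_empty (μ := PMF.toOuterMeasure _)).le

section Sampling

variable {P : Cluster}

lemma Marks.sampleOf_eq {Y : Finset ℕ} {m : ℕ → ℕ} (h : Marks P Y m) :
    sampleOf P P.verts m = {v ∈ Finset.range P.verts | 2 * P.verts + v ∈ Y} := by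
  refine Finset.filter_congr fun v hv => ?_
  have := Finset.mem_range.1 hv
  rw [add_assoc, h _ (by omega)]
  simp

/-- The program `prep` writes `a` to cell `3`. -/
def Prog.Computes (P : Cluster) (prep : Prog) (a : ℕ) : Prop :=
  ∀ me inb m o X, Marks P X m →
    wp P me inb prep (fun m' o' => Marks P X m' ∧ m' 3 = a ∧ o' = o) m o

variable (hP : P.Fits) {E : Fin P.machines → List ℕ} {cfg : Config P} {prep : Prog} {a : ℕ}
  (hprep : prep.Computes P a) (ha : a ≤ P.machines) {X : Finset ℕ} (hX : ∀ x ∈ X, x < 2 * P.verts)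
  (h : Holds P E (fun _ => X) cfg)
include hP hprep ha hX h

omit ha hX in
lemma wp_load_prep (j : Fin P.machines) : wp P j (cfg j) (.seq .load prep)
    (fun m o => Marks P X m ∧ m 3 = a ∧ o = []) (fun _ => 0) [] := by
  refine wp_seq (wp_mono (h.wp_load hP j) ?_)
  rintro m o ⟨hM, rfl⟩
  exact hprep _ _ _ _ _ hM

omit hprep ha hX in
lemma wp_emit_sample (j : Fin P.machines) {Y : Finset ℕ} {m : ℕ → ℕ} (hM : Marks P Y m) :
    wp P j (cfg j) (.seq (.emitMarks (.numVerts * .numVerts) 3 (.mem 2)) .keepEdges)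
      (fun m' o => (Marks P Y m' ∧ sampleOf P P.verts m' = sampleOf P P.verts m) ∧
        o = messages P (P.verts * P.verts) 3 id Y j (E j) []) m [] := by
  have := wp_emit_keep hP (me := j) (h.length_le j) hM (χ := .mem 2) (c := id) le_rfl
    (fun m => rfl)
  rw [h.edges j] at this
  exact wp_mono this fun m' o' h => ⟨⟨h.1, by rw [h.1.sampleOf_eq, hM.sampleOf_eq]⟩, h.2⟩

lemma wp_sampleRound (j : Fin P.machines) : wp P j (cfg j) (.sampleRound prep) (fun m o => ∃ Y,
    Marks P Y m ∧ ((j : ℕ) = 0 → IsSampled P (sampleOf P P.verts m) X Y) ∧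
    ((j : ℕ) ≠ 0 → Y = X) ∧ o = messages P (P.verts * P.verts) 3 id Y j (E j) [])
    (fun _ => 0) [] := by
  refine wp_seq (wp_mono (wp_load_prep hP hprep h j) ?_)
  rintro m o ⟨hM, hm3, rfl⟩
  refine wp_seq (wp_ite (fun hj => wp_skip ?_) fun hj => ?_)
  · exact wp_mono (wp_emit_sample hP h j hM) fun m' o' h' =>
      ⟨X, h'.1.1, fun h0 => absurd h0 hj, fun _ => rfl, h'.2⟩
  · have hj : (j : ℕ) = 0 := hj
    refine wp_mono (wp_flipCoins hP hM hX (by omega)) ?_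
    rintro m' o' ⟨⟨Y, hM', hY⟩, rfl⟩
    refine wp_mono (wp_emit_sample hP h j hM') fun m'' o' h' =>
      ⟨Y, h'.1.1, fun _ => ?_, fun h0 => absurd hj h0, h'.2⟩
    rw [h'.1.2]
    exact hY

/-- Whatever state `load` and `prep` produce, cell `3` contains `a`, and emitting messages leaves
the sample marks alone; so the law is that of `flipCoins`. -/
lemma map_sampleOf_sampleRound (j : Fin P.machines) (hj : (j : ℕ) = 0) :
    ((Prog.sampleRound prep).exec P j (cfg j) Local.init).map
      (fun s => sampleOf P P.verts s.mem) = coinSet a P.verts := by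
  rw [Prog.sampleRound, Prog.exec, PMF.map_bind]
  refine PMF.bind_eq_of_support _ fun s hs => ?_
  obtain ⟨hM, hs3, ho⟩ := wp_load_prep hP hprep h j _ rfl rfl s hs
  rw [Prog.exec, PMF.map_bind, Prog.exec, if_neg (by simpa [Exp.eval] using hj)]
  rw [← map_sampleOf_flipCoins hP ha (s.tick (Exp.self.cost + 1)) hs3, PMF.map]
  refine PMF.bind_congr_support _ fun t ht => PMF.map_eq_pure _ fun s' hs' => ?_
  obtain ⟨⟨Y, hM', hY⟩, ho'⟩ := wp_flipCoins hP hM hX (by omega) (s.tick (Exp.self.cost + 1)) rfl ho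
    t ht
  exact (wp_emit_sample hP h j hM' t rfl ho' s' hs').1.2

/-- The bridge from programs to probability: for any desired property `B` of the sample, the round
fails only if an abstract random subset violates `B`. The shuffle itself never fails. -/
lemma sample_transition {g : ℕ} (hspace : ∀ j, 6 * P.verts + (E j).length + g ≤ P.space)
    (hp : (Prog.sampleRound prep).Timely P) (B : Finset ℕ → Prop) :
    (round P (.sampleRound prep) cfg).toOuterMeasure {r | ¬∃ cfg', r = some cfg' ∧
      ∃ A ⊆ Finset.range P.verts, B A ∧
        Holds P E (scattered P 3 (X ∪ A.image (2 * P.verts + ·))) cfg'} ≤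
      (coinSet a P.verts).toOuterMeasure {A | ¬B A} := by
  have h0 := hP.machines_pos
  rw [← map_sampleOf_sampleRound hP hprep ha hX h ⟨0, h0⟩ rfl, PMF.toOuterMeasure_map_apply, round,
    PMF.toOuterMeasure_map_apply]
  refine le_trans (PMF.toOuterMeasure_mono _ ?_) (toOuterMeasure_sampleAll_finRange_le h0
    (fun j : Fin P.machines => (Prog.sampleRound prep).exec P j (cfg j) Local.init) _)
  rintro ls ⟨hbad, hls⟩
  obtain ⟨L, hL, rfl⟩ := support_sampleAll_exec hP hp h.length_le
    (wp_sampleRound hP hprep ha hX h) ls hls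
  choose Y hM hY hYX hout using fun j => (hL j).1
  obtain ⟨cfg', hcfg', hZ⟩ := shuffle_scattered hP hspace h le_rfl hout fun j => (hL j).2
  set A := sampleOf P P.verts (L ⟨0, h0⟩).mem with hA
  have hhead : L ⟨0, h0⟩ ∈ ((List.finRange P.machines).map L).head? := by
    have : (List.finRange P.machines).head? = some ⟨0, h0⟩ := by
      rw [List.head?_eq_getElem?]
      simp [h0]
    rw [List.head?_map, this]
    rfl
  refine ⟨_, hhead, fun hB => hbad ⟨cfg', hcfg', A, Finset.filter_subset _ _, hB, hZ _ ?_⟩⟩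
  intro x _
  rw [Finset.mem_union, Finset.mem_image]
  have h1 : x ∈ Y ⟨0, h0⟩ ↔ x ∈ X ∨ ∃ v ∈ A, 2 * P.verts + v = x := by
    rw [hY ⟨0, h0⟩ rfl x, ← hA]
    simp only [eq_comm]
  rw [← h1]
  refine ⟨fun hx => ⟨_, hx⟩, ?_⟩
  rintro ⟨j, hj⟩
  by_cases hj0 : (j : ℕ) = 0
  · rwa [show j = ⟨0, h0⟩ from Fin.ext hj0] at hj
  · rw [hYX j hj0] at hj
    exact h1.2 (Or.inl hj)

end Sampling

end MapReduce
end

noncomputable section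

/-! ### Phases of the algorithm -/

namespace MapReduce

/-- Started in a configuration with `Pre`, the algorithm `ps` reaches a configuration with `Post`,
except with probability at most `ε`. -/
def Ensures (P : Cluster) (ps : Algorithm) (Pre Post : Config P → Prop) (ε : ℝ≥0∞) : Prop :=
  ∀ cfg, Pre cfg → (run P ps cfg).toOuterMeasure {r | ¬∃ cfg', r = some cfg' ∧ Post cfg'} ≤ ε

section Ensures

variable {P : Cluster} {p : Prog} {ps : Algorithm} {Pre Mid Post : Config P → Prop} {ε δ : ℝ≥0∞}

lemma Ensures.cons (h₁ : ∀ cfg, Pre cfg →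
      (round P p cfg).toOuterMeasure {r | ¬∃ cfg', r = some cfg' ∧ Mid cfg'} ≤ δ)
    (h₂ : Ensures P ps Mid Post ε) : Ensures P (p :: ps) Pre Post (δ + ε) := by
  intro cfg hcfg
  refine (PMF.toOuterMeasure_bind_le _ _ {r | ¬∃ cfg', r = some cfg' ∧ Mid cfg'} _ ?_).trans
    (add_le_add (h₁ cfg hcfg) le_rfl)
  rintro r - hr
  obtain ⟨cfg', rfl, h⟩ := not_not.1 hr
  exact h₂ cfg' h

lemma Ensures.cons_of_support (h₁ : ∀ cfg, Pre cfg → ∀ r ∈ (round P p cfg).support,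
      ∃ cfg', r = some cfg' ∧ Mid cfg')
    (h₂ : Ensures P ps Mid Post ε) : Ensures P (p :: ps) Pre Post ε := by
  rw [← zero_add ε]
  refine Ensures.cons (fun cfg hcfg => ?_) h₂
  refine ((PMF.toOuterMeasure_apply_eq_zero_iff _ _).2 ?_).le
  exact Set.disjoint_left.2 fun r hr hr' => hr' (h₁ cfg hcfg r hr)

lemma Ensures.nil (h : ∀ cfg, Pre cfg → Post cfg) : Ensures P [] Pre Post 0 := by
  intro cfg hcfg
  refine ((PMF.toOuterMeasure_apply_eq_zero_iff _ _).2 ?_).le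
  refine Set.disjoint_left.2 fun r hr hr' => hr' ?_
  simp only [run, PMF.support_pure, Set.mem_singleton_iff] at hr
  exact ⟨cfg, hr, h cfg hcfg⟩

end Ensures

/-- One phase: sampling, the greedy algorithm on the sample, and marking the dominated vertices. -/
def Prog.phase (prep : Prog) : Algorithm :=
  [sampleRound prep, forwardRound, gatherRound, greedyRound, forwardRound, dominateRound,
    forwardRound]

/-- The greedy algorithm on all remaining vertices. -/
def Prog.lastPhase : Algorithm :=
  [sampleRound (.store 3 1), forwardRound, gatherRound, outputRound]

open Classical in
/-- The marks for the set `J` and its neighbours. -/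
def markSet (H : SimpleGraph ℕ) (N : ℕ) (J : Finset ℕ) : Finset ℕ :=
  {x ∈ Finset.range (2 * N) | x ∈ J ∨ ∃ v < N, x = N + v ∧ ∃ u ∈ J, H.Adj u v}

/-- The machines hold every edge of the graph `H` once. -/
structure Represents (P : Cluster) (E : Fin P.machines → List ℕ) (H : SimpleGraph ℕ) : Prop where
  adj_iff : ∀ u v, HeldAdj P E u v ↔ H.Adj u v
  lt : ∀ j, ∀ w ∈ E j, w < P.verts * P.verts
  nodup : ((List.finRange P.machines).flatMap E).Nodup

section Phases

open Classical

variable {P : Cluster} {E : Fin P.machines → List ℕ} {H : SimpleGraph ℕ} {J A : Finset ℕ}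

lemma Represents.lt_of_adj (hH : Represents P E H) {u v : ℕ} (h : H.Adj u v) : v < P.verts := by
  obtain ⟨j, e, he, h⟩ := (hH.adj_iff u v).2 h
  have h1 := hH.lt j e he
  have h2 : 0 < P.verts := Nat.pos_of_ne_zero fun h0 => by simp [h0] at h1
  rcases h with ⟨-, rfl⟩ | ⟨-, rfl⟩
  · exact Nat.mod_lt _ h2
  · exact Nat.div_lt_of_lt_mul h1

/-- Map each edge word to the ordered pair of its ends. This is injective, and since no edge is
stored twice, lengths of lists are cardinalities. -/
lemma sum_length_filter_le (hH : Represents P E H) (U : Finset ℕ) :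
    ∑ j, ((E j).filter fun w => w / P.verts ∈ U ∧ w % P.verts ∈ U).length ≤
      ∑ v ∈ U, {u ∈ U | H.Adj v u}.card := by
  have h1 : ∑ j, ((E j).filter fun w => w / P.verts ∈ U ∧ w % P.verts ∈ U).length =
      (((List.finRange P.machines).flatMap E).filter
        fun w => w / P.verts ∈ U ∧ w % P.verts ∈ U).length := by
    rw [List.filter_flatMap, List.length_flatMap, ← List.ofFn_eq_map, List.sum_ofFn]
  rw [h1, ← List.toFinset_card_of_nodup (hH.nodup.filter _), ← Finset.card_sigma]
  refine Finset.card_le_card_of_injOn (fun w => ⟨w / P.verts, w % P.verts⟩) ?_ ?_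
  · intro w hw
    simp only [List.coe_toFinset, List.mem_filter, List.mem_flatMap, List.mem_finRange, true_and,
      decide_eq_true_eq, Set.mem_ofPred_eq] at hw
    obtain ⟨⟨j, hj⟩, h1, h2⟩ := hw
    simp only [Finset.coe_sigma, Set.mem_sigma_iff, Finset.mem_coe, Finset.mem_filter]
    exact ⟨h1, h2, (hH.adj_iff _ _).1 ⟨j, w, hj, Or.inl ⟨rfl, rfl⟩⟩⟩
  · intro w _ w' _ h
    simp only [Sigma.mk.injEq, heq_eq_eq] at h
    rw [← Nat.div_add_mod w P.verts, ← Nat.div_add_mod w' P.verts, h.1, h.2]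

lemma mem_markSet {N x : ℕ} : x ∈ markSet H N J ↔
    x < 2 * N ∧ (x ∈ J ∨ ∃ v < N, x = N + v ∧ ∃ u ∈ J, H.Adj u v) := by
  simp [markSet]

lemma eligibleSet_markSet (hJ : J ⊆ Finset.range P.verts) :
    eligibleSet P (markSet H P.verts J ∪ A.image (2 * P.verts + ·)) = A ∩ alive H P.verts J := by
  ext v
  simp only [eligibleSet, Finset.mem_filter, Finset.mem_range, Finset.mem_union, Finset.mem_image,
    Finset.mem_inter, alive, mem_markSet]
  constructor
  · rintro ⟨hv, h1, h2, h3⟩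
    push Not at h2 h3
    refine ⟨?_, hv, (h2.1 (by omega)).1, fun u hu huv => ?_⟩
    · rcases h1 with h1 | ⟨w, hw, h1⟩
      · omega
      · obtain rfl : w = v := by omega
        exact hw
    · exact (h3.1 (by omega)).2 v hv rfl u hu huv
  · rintro ⟨hvA, hv, hvJ, hvn⟩
    refine ⟨hv, Or.inr ⟨v, hvA, rfl⟩, ?_, ?_⟩
    · rintro (⟨-, h | ⟨w, hw, h, -⟩⟩ | ⟨w, -, h⟩)
      · exact hvJ h
      · omega
      · omega
    · rintro (⟨-, h | ⟨w, hw, h, u, hu, huw⟩⟩ | ⟨w, -, h⟩)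
      · have := Finset.mem_range.1 (hJ h); omega
      · obtain rfl : v = w := by omega
        exact hvn u hu huw
      · omega

/-- Vertices of `U` have no neighbour in `J`, and all newly chosen vertices lie in `U`. So checking
conflicts only against new vertices along edges inside `U`, which is all that machine `0` can see,
agrees with the greedy run that continues from `J` in the whole graph. -/
lemma union_greedySet (U A J : Finset ℕ) (N : ℕ) (hU : U = A ∩ alive H N J) (i : ℕ) :
    J ∪ greedySet (fun u v => u ∈ U ∧ v ∈ U ∧ H.Adj u v) U i = seqGreedy H N A J i ∧
      greedySet (fun u v => u ∈ U ∧ v ∈ U ∧ H.Adj u v) U i ⊆ U := by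
  induction i with
  | zero => simp [greedySet, seqGreedy]
  | succ i ih =>
    obtain ⟨ih, hsub⟩ := ih
    have hlt : i ∉ greedySet (fun u v => u ∈ U ∧ v ∈ U ∧ H.Adj u v) U i := fun h =>
      (lt_of_mem_greedySet h).false
    have hiff : (i ∈ U ∧ ∀ u ∈ greedySet (fun u v => u ∈ U ∧ v ∈ U ∧ H.Adj u v) U i,
        ¬(u ∈ U ∧ i ∈ U ∧ H.Adj u i)) ↔ i ∈ A ∧ i ∈ alive H N (seqGreedy H N A J i) := by
      generalize greedySet (fun u v => u ∈ U ∧ v ∈ U ∧ H.Adj u v) U i = g at hlt hsub ih ⊢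
      rw [← ih]
      subst hU
      simp only [Finset.mem_inter, alive, Finset.mem_filter, Finset.mem_range, Finset.mem_union]
      constructor
      · rintro ⟨⟨h1, h2, h3, h4⟩, h5⟩
        refine ⟨h1, h2, by tauto, ?_⟩
        rintro u (hu | hu) huv
        · exact h4 u hu huv
        · have := hsub hu
          simp only [Finset.mem_inter, alive, Finset.mem_filter, Finset.mem_range] at this
          exact h5 u hu ⟨this, ⟨h1, h2, h3, h4⟩, huv⟩
      · rintro ⟨h1, h2, h3, h4⟩
        exact ⟨⟨h1, h2, by tauto, fun u hu => h4 u (Or.inl hu)⟩,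
          fun u hu h => h4 u (Or.inr hu) h.2.2⟩
    rw [greedySet, seqGreedy]
    by_cases h : i ∈ A ∧ i ∈ alive H N (seqGreedy H N A J i)
    · rw [if_pos h, if_pos (hiff.2 h), Finset.union_insert, ih]
      exact ⟨rfl, Finset.insert_subset (hiff.2 h).1 hsub⟩
    · rw [if_neg h, if_neg fun h' => h (hiff.1 h')]
      exact ⟨ih, hsub⟩

lemma chosen_eq (hH : Represents P E H) (hJ : J ⊆ Finset.range P.verts) :
    J ∪ chosen P E (markSet H P.verts J ∪ A.image (2 * P.verts + ·)) =
      seqGreedy H P.verts A J P.verts ∧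
    chosen P E (markSet H P.verts J ∪ A.image (2 * P.verts + ·)) ⊆ A ∩ alive H P.verts J := by
  rw [chosen, eligibleSet_markSet hJ]
  simp only [hH.adj_iff]
  exact union_greedySet _ A J P.verts rfl P.verts

lemma seqGreedy_subset {N : ℕ} (hJ : J ⊆ Finset.range N) (A : Finset ℕ) (i : ℕ) :
    seqGreedy H N A J i ⊆ Finset.range N := by
  induction i with
  | zero => exact hJ
  | succ i ih =>
    rw [seqGreedy]
    split_ifs with h
    · exact Finset.insert_subset (Finset.mem_filter.1 h.2).1 ih
    · exact ih

lemma seqGreedy_indep {N : ℕ} (hJ : ∀ u ∈ J, ∀ v ∈ J, ¬H.Adj u v) (A : Finset ℕ) (i : ℕ) :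
    ∀ u ∈ seqGreedy H N A J i, ∀ v ∈ seqGreedy H N A J i, ¬H.Adj u v := by
  induction i with
  | zero => exact hJ
  | succ i ih =>
    rw [seqGreedy]
    split_ifs with h
    · have h2 := (Finset.mem_filter.1 h.2).2.2
      intro u hu v hv
      rw [Finset.mem_insert] at hu hv
      rcases hu with rfl | hu <;> rcases hv with rfl | hv
      · exact H.loopless.irrefl _
      · exact fun h => h2 v hv h.symm
      · exact h2 u hu
      · exact ih u hu v hv
    · exact ih

/-- A vertex undominated at the end was alive at its own turn and would have been chosen then. -/
lemma seqGreedy_dominates {N v : ℕ} (hv : v < N) : v ∈ seqGreedy H N (Finset.range N) J N ∨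
    ∃ u ∈ seqGreedy H N (Finset.range N) J N, H.Adj u v := by
  by_contra hcon
  push Not at hcon
  have h1 : v ∈ alive H N (seqGreedy H N (Finset.range N) J v) :=
    alive_anti (seqGreedy_mono _ J hv.le) (Finset.mem_filter.2 ⟨Finset.mem_range.2 hv, hcon⟩)
  refine hcon.1 (seqGreedy_mono _ J (show v + 1 ≤ N from hv) ?_)
  rw [seqGreedy, if_pos ⟨Finset.mem_range.2 hv, h1⟩]
  exact Finset.mem_insert_self _ _

lemma samplePairs_range (N : ℕ) : samplePairs H N J (Finset.range N) = aliveDegSum H N J := by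
  have : Finset.range N ∩ alive H N J = alive H N J :=
    Finset.inter_eq_right.2 (Finset.filter_subset _ _)
  rw [samplePairs, this]
  rfl

variable (hP : P.Fits) {g : ℕ} (hspace : ∀ j, 6 * P.verts + (E j).length + g ≤ P.space)
  (hH : Represents P E H) (hJ : J ⊆ Finset.range P.verts)
include hP hspace hH hJ

/-- The first three rounds of a phase. -/
lemma Ensures.gather {prep : Prog} {a : ℕ} (hprep : prep.Computes P a) (ha : a ≤ P.machines)
    (ht : (Prog.sampleRound prep).Timely P) (ht2 : Prog.forwardRound.Timely P)
    (ht3 : Prog.gatherRound.Timely P) {B : Finset ℕ → Prop}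
    (hB : ∀ A ⊆ Finset.range P.verts, B A → samplePairs H P.verts J A ≤ g)
    {rest : Algorithm} {Post : Config P → Prop} {ε : ℝ≥0∞}
    (hrest : Ensures P rest (fun cfg => ∃ A ⊆ Finset.range P.verts, B A ∧
      Gathered P E (markSet H P.verts J ∪ A.image (2 * P.verts + ·)) cfg) Post ε) :
    Ensures P (.sampleRound prep :: .forwardRound :: .gatherRound :: rest)
      (Holds P E fun _ => markSet H P.verts J) Post
      ((coinSet a P.verts).toOuterMeasure {A | ¬B A} + ε) := by
  refine Ensures.cons (fun cfg h => sample_transition hP hprep ha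
    (fun x hx => (mem_markSet.1 hx).1) h hspace ht B) ?_
  refine Ensures.cons_of_support (Mid := fun cfg => ∃ A ⊆ Finset.range P.verts, B A ∧
    Holds P E (fun _ => markSet H P.verts J ∪ A.image (2 * P.verts + ·)) cfg) ?_ ?_
  · rintro cfg ⟨A, hA, hBA, h⟩ r hr
    obtain ⟨cfg', rfl, h'⟩ := forward_transition hP hspace ht2 le_rfl h r hr
    refine ⟨cfg', rfl, A, hA, hBA, ?_⟩
    convert h' using 2 with j
    rw [Finset.filter_mem_eq_inter, eq_comm, Finset.inter_eq_right]
    intro x hx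
    rw [Finset.mem_union, mem_markSet, Finset.mem_image] at hx
    rw [Finset.mem_range]
    rcases hx with ⟨h, -⟩ | ⟨v, hv, rfl⟩
    · omega
    · have := Finset.mem_range.1 (hA hv); omega
  · refine Ensures.cons_of_support ?_ hrest
    rintro cfg ⟨A, hA, hBA, h⟩ r hr
    have hg := (sum_length_filter_le hH _).trans (hB A hA hBA)
    rw [← eligibleSet_markSet hJ] at hg
    obtain ⟨cfg', rfl, h'⟩ := gather_transition hP hspace ht3 h hg r hr
    exact ⟨cfg', rfl, A, hA, hBA, h'⟩

/-- The greedy round marks dominated vertices only along gathered edges. The domination round then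
uses all input edges, so the marks become exactly those of the enlarged set, without the sample. -/
lemma Ensures.phase {prep : Prog} {a : ℕ} (hprep : prep.Computes P a) (ha : a ≤ P.machines)
    (ht : ∀ p ∈ Prog.phase prep, p.Timely P) {B : Finset ℕ → Prop}
    (hB : ∀ A ⊆ Finset.range P.verts, B A → samplePairs H P.verts J A ≤ g)
    {rest : Algorithm} {Post : Config P → Prop} {ε : ℝ≥0∞}
    (hrest : ∀ A ⊆ Finset.range P.verts, B A → Ensures P rest
      (Holds P E fun _ => markSet H P.verts (seqGreedy H P.verts A J P.verts)) Post ε) :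
    Ensures P (Prog.phase prep ++ rest) (Holds P E fun _ => markSet H P.verts J) Post
      ((coinSet a P.verts).toOuterMeasure {A | ¬B A} + ε) := by
  simp only [Prog.phase, List.mem_cons, List.not_mem_nil, or_false, forall_eq_or_imp,
    forall_eq] at ht
  obtain ⟨ht1, ht2, ht3, ht4, -, ht5, -⟩ := ht
  refine Ensures.gather hP hspace hH hJ hprep ha ht1 ht2 ht3 hB ?_
  have hrest' : Ensures P rest (fun cfg => ∃ A ⊆ Finset.range P.verts, B A ∧
      Holds P E (fun _ => markSet H P.verts (seqGreedy H P.verts A J P.verts)) cfg) Post ε :=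
    fun cfg ⟨A, hA, hBA, h⟩ => hrest A hA hBA cfg h
  refine Ensures.cons_of_support (Mid := fun cfg => ∃ A ⊆ Finset.range P.verts, B A ∧
    ∃ Y, IsExtension P
      (fun u v => (u ∈ A ∩ alive H P.verts J ∧ v ∈ A ∩ alive H P.verts J ∧ HeldAdj P E u v))
      (chosen P E (markSet H P.verts J ∪ A.image (2 * P.verts + ·)))
      (markSet H P.verts J ∪ A.image (2 * P.verts + ·)) Y ∧ Holds P E (scattered P 3 Y) cfg) ?_
    (Ensures.cons_of_support (Mid := fun cfg => ∃ A ⊆ Finset.range P.verts, B A ∧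
    ∃ Y, IsExtension P
      (fun u v => (u ∈ A ∩ alive H P.verts J ∧ v ∈ A ∩ alive H P.verts J ∧ HeldAdj P E u v))
      (chosen P E (markSet H P.verts J ∪ A.image (2 * P.verts + ·)))
      (markSet H P.verts J ∪ A.image (2 * P.verts + ·)) Y ∧
      Holds P E (fun _ => {x ∈ Finset.range (3 * P.verts) | x ∈ Y}) cfg) ?_
    (Ensures.cons_of_support (Mid := fun cfg => ∃ A ⊆ Finset.range P.verts, B A ∧
      Holds P E (scattered P 2 (markSet H P.verts (seqGreedy H P.verts A J P.verts))) cfg) ?_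
    (Ensures.cons_of_support ?_ hrest')))
  · rintro cfg ⟨A, hA, hBA, h⟩ r hr
    obtain ⟨cfg', rfl, Y, hY, h'⟩ := greedy_transition hP hspace ht4 h r hr
    rw [eligibleSet_markSet hJ] at hY
    exact ⟨cfg', rfl, A, hA, hBA, Y, hY, h'⟩
  · rintro cfg ⟨A, hA, hBA, Y, hY, h⟩ r hr
    obtain ⟨cfg', rfl, h'⟩ := forward_transition hP hspace ht2 le_rfl h r hr
    exact ⟨cfg', rfl, A, hA, hBA, Y, hY, h'⟩
  · rintro cfg ⟨A, hA, hBA, Y, hY, h⟩ r hr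
    obtain ⟨cfg', rfl, h'⟩ := dominate_transition hP hspace ht5 h r hr
    refine ⟨cfg', rfl, A, hA, hBA, h' _ fun x hx => ?_⟩
    obtain ⟨hc1, hc2⟩ := chosen_eq (A := A) hH hJ
    set C := chosen P E (markSet H P.verts J ∪ A.image (2 * P.verts + ·)) with hC
    have hCN : ∀ u ∈ C, u < P.verts := fun u hu =>
      Finset.mem_range.1 (hA (Finset.mem_of_mem_inter_left (hc2 hu)))
    have hJN : ∀ u ∈ J, u < P.verts := fun u hu => Finset.mem_range.1 (hJ hu)
    have hmem : ∀ y, y ∈ (Finset.range (3 * P.verts)).filter (· ∈ Y) ↔ y < 3 * P.verts ∧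
        ((y ∈ markSet H P.verts J ∨ ∃ v ∈ A, 2 * P.verts + v = y) ∨ y ∈ C ∨ ∃ v < P.verts,
          y = P.verts + v ∧ ∃ u ∈ C, (u ∈ A ∩ alive H P.verts J ∧ v ∈ A ∩ alive H P.verts J ∧
            HeldAdj P E u v)) := by
      intro y
      rw [Finset.mem_filter, Finset.mem_range, hY, Finset.mem_union, Finset.mem_image]
    have hlow : ∀ u < P.verts, (u ∈ (Finset.range (3 * P.verts)).filter (· ∈ Y) ↔
        u ∈ J ∨ u ∈ C) := by
      intro u hu
      rw [hmem, mem_markSet]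
      constructor
      · rintro ⟨-, (⟨-, h | ⟨v, hv, h, -⟩⟩ | ⟨v, -, h⟩) | h | ⟨v, -, h, -⟩⟩
        · exact Or.inl h
        · omega
        · omega
        · exact Or.inr h
        · omega
      · rintro (h | h)
        · exact ⟨by omega, Or.inl (Or.inl ⟨by omega, Or.inl h⟩)⟩
        · exact ⟨by omega, Or.inr (Or.inl h)⟩
    rw [mem_markSet, ← hc1]
    simp only [hH.adj_iff]
    constructor
    · rintro ⟨-, h | ⟨v, hv, rfl, u, hu, huv⟩⟩
      · rw [Finset.mem_union] at h
        left
        have : x < P.verts := h.elim (hJN x) (hCN x)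
        exact (hlow x this).2 h
      · right
        rw [Finset.mem_union] at hu
        exact ⟨u, v, (hlow u (hu.elim (hJN u) (hCN u))).2 hu, huv, rfl⟩
    · rintro (h | ⟨u, v, hu, huv, rfl⟩)
      · refine ⟨hx, ?_⟩
        by_cases hxN : x < P.verts
        · left
          exact Finset.mem_union.2 ((hlow x hxN).1 h)
        · right
          rw [hmem, mem_markSet] at h
          obtain ⟨-, (⟨-, h | ⟨v, hv, h, u, hu, huv⟩⟩ | ⟨v, -, h⟩) | h |
            ⟨v, hv, h, u, hu, -, -, huv⟩⟩ := h
          · exact absurd (hJN x h) hxN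
          · exact ⟨v, hv, h, u, Finset.mem_union_left _ hu, huv⟩
          · omega
          · exact absurd (hCN x h) hxN
          · exact ⟨v, hv, h, u, Finset.mem_union_right _ hu, (hH.adj_iff _ _).1 huv⟩
      · refine ⟨hx, Or.inr ⟨v, hH.lt_of_adj huv, rfl, u, ?_, huv⟩⟩
        exact Finset.mem_union.2 ((hlow u (hH.lt_of_adj huv.symm)).1 hu)
  · rintro cfg ⟨A, hA, hBA, h⟩ r hr
    obtain ⟨cfg', rfl, h'⟩ := forward_transition hP hspace ht2 (by omega) h r hr
    refine ⟨cfg', rfl, A, hA, hBA, ?_⟩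
    convert h' using 2 with j
    rw [Finset.filter_mem_eq_inter, eq_comm, Finset.inter_eq_right]
    exact fun x hx => Finset.mem_range.2 (mem_markSet.1 hx).1

/-- With `a = 1` the sample is the whole vertex set, so the sampled pairs are all alive pairs, and
no failure probability arises. -/
lemma Ensures.lastPhase (ht : ∀ p ∈ Prog.lastPhase, p.Timely P)
    (hg : aliveDegSum H P.verts J ≤ g) :
    Ensures P Prog.lastPhase (Holds P E fun _ => markSet H P.verts J)
      (fun cfg => ∀ v < P.verts, (∃ j, v ∈ cfg j) ↔
        v ∈ seqGreedy H P.verts (Finset.range P.verts) J P.verts) 0 := by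
  simp only [Prog.lastPhase, List.mem_cons, List.not_mem_nil, or_false, forall_eq_or_imp,
    forall_eq] at ht
  obtain ⟨ht1, ht2, ht3, ht4⟩ := ht
  have h1 : (coinSet 1 P.verts).toOuterMeasure {A | ¬A = Finset.range P.verts} = 0 :=
    (PMF.toOuterMeasure_apply_eq_zero_iff _ _).2
      (Set.disjoint_left.2 fun A hA hA' => hA' (support_coinSet_one _ A hA))
  suffices h : Ensures P Prog.lastPhase (Holds P E fun _ => markSet H P.verts J)
      (fun cfg => ∀ v < P.verts, (∃ j, v ∈ cfg j) ↔
        v ∈ seqGreedy H P.verts (Finset.range P.verts) J P.verts)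
      ((coinSet 1 P.verts).toOuterMeasure {A | ¬A = Finset.range P.verts} + 0) by
    rwa [h1, add_zero] at h
  refine Ensures.gather hP hspace hH hJ ?_ hP.machines_pos ht1 ht2 ht3 ?_ ?_
  · intro me inb m o X hM
    have h2 := hP.le_space
    have h3 := hP.space_le
    refine wp_store (by simp; omega) (by simp; omega) ⟨hM.update_of_lt (by simp) _, by simp, rfl⟩
  · rintro A - rfl
    rwa [samplePairs_range]
  · refine Ensures.cons_of_support ?_ (Ensures.nil fun _ h => h)
    rintro cfg ⟨A, hA, rfl, h⟩ r hr
    obtain ⟨cfg', rfl, h'⟩ := output_transition hP hspace ht4 h r hr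
    refine ⟨cfg', rfl, fun v hv => (h' v hv).trans ?_⟩
    rw [← (chosen_eq (A := Finset.range P.verts) hH hJ).1, Finset.mem_union, Finset.mem_union, mem_markSet, Finset.mem_image]
    constructor
    · rintro ((⟨-, h | ⟨w, -, h, -⟩⟩ | ⟨w, -, h⟩) | h)
      · exact Or.inl h
      · omega
      · omega
      · exact Or.inr h
    · rintro (h | h)
      · exact Or.inl (Or.inl ⟨by omega, Or.inl h⟩)
      · exact Or.inr h

end Phases

end MapReduce
end

noncomputable section

/-! ### The algorithm -/

namespace MapReduce

/-- The phases with sampling probabilities `1 / a k, 1 / a (k + 1), …`, where `a k` is the `k`-fold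
rounded-up square root of the number of machines, and the last phase. -/
def Prog.phases : ℕ → ℕ → Algorithm
  | 0, _ => lastPhase
  | r + 1, k => phase (iteratedRoot k) ++ phases r (k + 1)

lemma Prog.length_phases (r k : ℕ) : (phases r k).length = 7 * r + 4 := by
  induction r generalizing k with
  | zero => rfl
  | succ r ih =>
    rw [phases, List.length_append, ih]
    simp only [phase, List.length_cons, List.length_nil]
    omega

lemma Prog.boundedBy_iteratedRoot {P : Cluster} (hP : P.Fits) (me : ℕ) (inb : List ℕ) (k : ℕ) :
    (iteratedRoot k).BoundedBy P me inb P.space := by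
  have h1 := hP.le_space
  have h2 := hP.machines_le
  induction k with
  | zero => simp [iteratedRoot, BoundedBy]
  | succ k ih =>
    refine ⟨ih, ?_⟩
    simp only [BoundedBy, Exp.val_numMachines, true_and, and_true]
    omega

lemma Prog.boundedBy_of_mem_phase {P : Cluster} (hP : P.Fits) {me : ℕ} {inb : List ℕ}
    (hinb : inb.length ≤ P.space) {prep : Prog} (hprep : prep.BoundedBy P me inb P.space) :
    ∀ p ∈ phase prep, p.BoundedBy P me inb P.space := by
  have h1 := hP.le_space
  have h2 := hP.machines_le
  simp only [phase, List.mem_cons, List.not_mem_nil, or_false, forall_eq_or_imp, forall_eq]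
  simp only [sampleRound, forwardRound, gatherRound, greedyRound, dominateRound, load, flipCoins,
    emitMarks, keepEdges, gatherEdges, greedy, dominateAlong, dominate, BoundedBy, hprep,
    Exp.val_numMachines, Exp.val_inboxLen, Exp.val_mul, Exp.val_const, Exp.val_numVerts,
    true_and, and_true, forall_const, hinb]
  omega

lemma Prog.boundedBy_of_mem_phases {P : Cluster} (hP : P.Fits) {me : ℕ} {inb : List ℕ}
    (hinb : inb.length ≤ P.space) (r k : ℕ) : ∀ p ∈ phases r k, p.BoundedBy P me inb P.space := by
  induction r generalizing k with
  | zero =>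
    have h1 := hP.le_space
    have h2 := hP.machines_le
    simp only [phases, lastPhase, List.mem_cons, List.not_mem_nil, or_false, forall_eq_or_imp,
      forall_eq]
    simp only [sampleRound, forwardRound, gatherRound, outputRound, load, flipCoins,
      emitMarks, keepEdges, gatherEdges, greedy, dominateAlong, BoundedBy,
      Exp.val_numMachines, Exp.val_inboxLen, Exp.val_mul, Exp.val_const, Exp.val_numVerts,
      true_and, and_true, forall_const, hinb]
    omega
  | succ r ih =>
    intro p hp
    rw [phases, List.mem_append] at hp
    rcases hp with hp | hp
    · exact boundedBy_of_mem_phase hP hinb (boundedBy_iteratedRoot hP me inb k) p hp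
    · exact ih (k + 1) p hp

/-- The event that the configuration lists a maximal independent set of the graph `H`. -/
def ListsMIS (P : Cluster) (H : SimpleGraph ℕ) (cfg : Config P) : Prop :=
  ∃ J : Finset ℕ, (∀ v < P.verts, (∃ j, v ∈ cfg j) ↔ v ∈ J) ∧ (∀ u ∈ J, ∀ v ∈ J, ¬H.Adj u v) ∧
    ∀ v < P.verts, v ∈ J ∨ ∃ u ∈ J, H.Adj u v

/-! ### The invariant that links the phases -/

section Algorithm

variable {P : Cluster} {E : Fin P.machines → List ℕ} {H : SimpleGraph ℕ}

lemma le_mul_iterate_ceilRoot {M : ℕ} (k : ℕ) :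
    ((ceilRoot^[k] M : ℕ) : ℝ) ≤ ((ceilRoot^[k + 1] M : ℕ) : ℝ) ^ 2 := by
  rw [Function.iterate_succ_apply', sq]
  exact_mod_cast le_ceilRoot_mul_self _

/-- The phases find a maximal independent set. -/
lemma ensures_phases (hP : P.Fits) {g T : ℕ} {X t : ℝ}
    (hspace : ∀ j, 6 * P.verts + (E j).length + g ≤ P.space) (hH : Represents P E H) (ht : 0 ≤ t)
    (hX : P.verts * t ≤ X) (hg : 11 * X ≤ g)
    (hT : P.verts * ((ceilRoot^[T] P.machines : ℕ) * t) ≤ g) (r : ℕ) :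
    ∀ k (J : Finset ℕ), (∀ p ∈ Prog.phases r k, p.Timely P) → k + r = T + 1 →
      J ⊆ Finset.range P.verts → (∀ u ∈ J, ∀ v ∈ J, ¬H.Adj u v) →
      (aliveDegSum H P.verts J : ℝ) ≤ 2 * X * ((ceilRoot^[k] P.machines : ℕ) : ℝ) ^ 2 →
      (r = 0 → aliveDegSum H P.verts J ≤ g) →
      Ensures P (Prog.phases r k) (Holds P E fun _ => markSet H P.verts J) (ListsMIS P H)
        (r * ENNReal.ofReal ((2 * P.verts + 1) * Real.exp (-t))) := by
  have hX0 : 0 ≤ X := le_trans (by positivity) hX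
  induction r with
  | zero =>
    intro k J htime _ hJ hind _ h0 cfg hcfg
    rw [Nat.cast_zero, zero_mul]
    refine le_trans (PMF.toOuterMeasure_mono _ ?_)
      (Ensures.lastPhase hP hspace hH hJ htime (h0 rfl) cfg hcfg)
    rintro x ⟨hx, -⟩ ⟨cfg', rfl, h⟩
    exact hx ⟨cfg', rfl, _, h, seqGreedy_indep hind _ _, fun v hv => seqGreedy_dominates hv⟩
  | succ r ih =>
    intro k J htime hk hJ hind hds _
    set a := ceilRoot^[k] P.machines with ha
    have ha0 : 0 < a := iterate_ceilRoot_pos k hP.machines_pos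
    have ha0' : (0 : ℝ) < a := by exact_mod_cast ha0
    have hcast : (((r + 1 : ℕ) : ℝ≥0∞)) * ENNReal.ofReal ((2 * P.verts + 1) * Real.exp (-t)) =
        ENNReal.ofReal ((2 * P.verts + 1) * Real.exp (-t)) +
        r * ENNReal.ofReal ((2 * P.verts + 1) * Real.exp (-t)) := by push_cast; ring
    rw [hcast]
    rw [Prog.phases] at htime ⊢
    have key := Ensures.phase hP hspace hH hJ (prep := .iteratedRoot k) (a := a)
      (B := fun A => A ⊆ Finset.range P.verts → GoodSample H P.verts a t J A)
      (rest := Prog.phases r (k + 1)) (Post := ListsMIS P H)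
      (ε := r * ENNReal.ofReal ((2 * P.verts + 1) * Real.exp (-t)))
      (fun me inb m o X hM => wp_iteratedRoot hP hM k) (iterate_ceilRoot_le _ _)
      (fun p hp => htime p (List.mem_append_left _ hp)) ?_ ?_
    · exact fun cfg hcfg => (key cfg hcfg).trans
        (add_le_add (toOuterMeasure_goodSample_le ha0 hP.verts_pos J ht) le_rfl)
    · intro A hA hB
      have h1 := (hB hA).pairs_le
      have h2 : 4 / (a : ℝ) ^ 2 * aliveDegSum H P.verts J ≤ 4 / (a : ℝ) ^ 2 * (2 * X * a ^ 2) := by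
        gcongr
      -- The invariant on the degree sum contributes `8 * X` and the deviation `3 * n * t` at most
      -- `3 * X`, whence the `11` in `hg`.
      have h3 : 4 / (a : ℝ) ^ 2 * (2 * X * a ^ 2) = 8 * X := by field_simp; ring
      have h4 : (samplePairs H P.verts J A : ℝ) ≤ g := by linarith
      exact_mod_cast h4
    · intro A hA hB
      have h1 := (hB hA).degSum_le
      refine ih (k + 1) _ (fun p hp => htime p (List.mem_append_right _ hp)) (by omega)
        (seqGreedy_subset hJ _ _) (seqGreedy_indep hind _ _) ?_ ?_
      · have h2 := le_mul_iterate_ceilRoot (M := P.machines) k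
        rw [← ha] at h2
        calc (aliveDegSum H P.verts (seqGreedy H P.verts A J P.verts) : ℝ)
            ≤ P.verts * t * a := by linarith
          _ ≤ X * ((ceilRoot^[k + 1] P.machines : ℕ) : ℝ) ^ 2 := by gcongr
          -- The factor `2` is slack here; only the initial degree sum, twice the number of edges,
          -- needs it.
          _ ≤ 2 * X * ((ceilRoot^[k + 1] P.machines : ℕ) : ℝ) ^ 2 := by
            gcongr; linarith
      -- The phase just analysed was the last sampling phase, with index `T`, so its progress bound
      -- is the one that `hT` compares with the capacity `g`.
      · rintro rfl
        have hkT : k = T := by omega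
        rw [ha, hkT] at h1
        exact_mod_cast h1.trans hT

end Algorithm

/-! ### From the input graph to marks, and from the output to a maximal independent set -/

section Input

variable {P : Cluster} {G : SimpleGraph (Fin P.verts)}
  {place : Fin P.machines → List (Fin P.verts × Fin P.verts)} {cap : ℕ}

lemma represents_inputConfig (h : IsPlacement G cap place) :
    Represents P (inputConfig P place) (G.map Fin.valEmbedding) := by
  have hlt : ∀ j, ∀ w ∈ inputConfig P place j, w < P.verts * P.verts := by
    intro j w hw
    simp only [inputConfig, List.mem_map] at hw
    obtain ⟨p, -, rfl⟩ := hw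
    nlinarith [p.1.2, p.2.2]
  have hdiv : ∀ p : Fin P.verts × Fin P.verts, ((p.1 : ℕ) * P.verts + p.2) / P.verts = p.1 ∧
      ((p.1 : ℕ) * P.verts + p.2) % P.verts = p.2 := by
    intro p
    have hp := p.2.2
    have h0 : 0 < P.verts := by omega
    rw [mul_comm, Nat.mul_add_div h0, Nat.mul_add_mod, Nat.div_eq_of_lt hp, Nat.mod_eq_of_lt hp]
    exact ⟨rfl, rfl⟩
  have hmem : ∀ u v : Fin P.verts, G.Adj u v ↔ ∃ j, ∃ p ∈ place j, s(p.1, p.2) = s(u, v) := by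
    intro u v
    rw [← SimpleGraph.mem_edgeSet, ← h.2.2, List.mem_map]
    simp only [List.mem_flatten, List.mem_ofFn]
    constructor
    · rintro ⟨p, ⟨l, ⟨j, rfl⟩, hp⟩, h⟩; exact ⟨j, p, hp, h⟩
    · rintro ⟨j, p, hp, h⟩; exact ⟨p, ⟨_, ⟨j, rfl⟩, hp⟩, h⟩
  refine ⟨fun u v => ?_, hlt, ?_⟩
  · rw [SimpleGraph.map_adj]
    constructor
    · rintro ⟨j, e, he, h'⟩
      simp only [inputConfig, List.mem_map] at he
      obtain ⟨p, hp, rfl⟩ := he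
      rw [(hdiv p).1, (hdiv p).2] at h'
      have hadj := (hmem p.1 p.2).2 ⟨j, p, hp, rfl⟩
      rcases h' with ⟨rfl, rfl⟩ | ⟨rfl, rfl⟩
      · exact ⟨_, _, hadj, rfl, rfl⟩
      · exact ⟨_, _, hadj.symm, rfl, rfl⟩
    · rintro ⟨u, v, huv, rfl, rfl⟩
      obtain ⟨j, p, hp, h'⟩ := (hmem u v).1 huv
      refine ⟨j, _, List.mem_map.2 ⟨p, hp, rfl⟩, ?_⟩
      rw [(hdiv p).1, (hdiv p).2]
      rw [Sym2.eq_iff] at h'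
      rcases h' with ⟨rfl, rfl⟩ | ⟨rfl, rfl⟩
      · exact Or.inl ⟨rfl, rfl⟩
      · exact Or.inr ⟨rfl, rfl⟩
  · have h1 : (List.finRange P.machines).flatMap (inputConfig P place) =
        (List.ofFn place).flatten.map fun p => (p.1 : ℕ) * P.verts + p.2 := by
      rw [List.ofFn_eq_map, List.flatMap, List.map_flatten, List.map_map]
      rfl
    rw [h1]
    refine List.Nodup.map_on ?_ (List.Nodup.of_map _ h.2.1)
    intro p _ q _ hpq
    have h2 := hdiv p
    rw [hpq, (hdiv q).1, (hdiv q).2] at h2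
    exact Prod.ext (Fin.ext h2.1.symm) (Fin.ext h2.2.symm)

/-- All input words lie below `n * n`, so initially there are no marks, as it should be for the
empty independent set. -/
lemma holds_inputConfig (h : IsPlacement G cap place) (hcap : cap ≤ P.space) :
    Holds P (inputConfig P place) (fun _ => markSet (G.map Fin.valEmbedding) P.verts ∅)
      (inputConfig P place) := by
  have hlt := (represents_inputConfig h).lt
  refine ⟨fun j => ?_, fun j => ?_, fun j => ?_⟩
  · simpa [inputConfig] using (h.1 j).trans hcap
  · exact List.filter_eq_self.2 fun w hw => by simpa using hlt j w hw
  · ext x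
    simp only [inboxMarks, markSet, Finset.mem_filter, Finset.notMem_empty, false_and, and_false,
      exists_false, or_false, iff_false, not_and]
    intro _ hx
    have := hlt j _ hx
    omega

lemma aliveDegSum_empty_le (G : SimpleGraph (Fin P.verts)) :
    aliveDegSum (G.map Fin.valEmbedding) P.verts ∅ ≤ 2 * G.edgeSet.ncard := by
  classical
  have h1 : alive (G.map Fin.valEmbedding) P.verts ∅ = Finset.range P.verts := by
    simp [alive]
  have h2 : G.edgeSet.ncard = G.edgeFinset.card := by
    rw [← SimpleGraph.coe_edgeFinset, Set.ncard_coe_finset]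
  rw [h2, ← SimpleGraph.sum_degrees_eq_twice_card_edges, aliveDegSum, h1, Finset.sum_range]
  refine Finset.sum_le_sum fun v _ => ?_
  rw [aliveDeg, h1, ← SimpleGraph.card_neighborFinset_eq_degree,
    ← Finset.card_map Fin.valEmbedding]
  refine Finset.card_le_card fun u hu => ?_
  obtain ⟨v', u', h, hv, rfl⟩ := (SimpleGraph.map_adj _ _ _ _).1 ((@Finset.mem_filter _ _ (_) _ _).1 hu).2
  rw [Finset.mem_map]
  refine ⟨u', ?_, rfl⟩
  rw [SimpleGraph.mem_neighborFinset]
  rwa [Fin.valEmbedding.injective (a₁ := v') (a₂ := v) hv] at h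

lemma maximal_outputSet {cfg : Config P} (h : ListsMIS P (G.map Fin.valEmbedding) cfg) :
    Maximal G.IsIndepSet (outputSet P cfg) := by
  obtain ⟨J, hout, hind, hdom⟩ := h
  have hmem : ∀ v : Fin P.verts, v ∈ outputSet P cfg ↔ (v : ℕ) ∈ J := fun v => hout v v.2
  have hadj : ∀ u v : Fin P.verts, (G.map Fin.valEmbedding).Adj u v ↔ G.Adj u v := fun u v =>
    SimpleGraph.map_adj_apply
  refine ⟨fun u hu v hv _ huv => ?_, fun s hs hle v hv => ?_⟩
  · exact hind u ((hmem u).1 hu) v ((hmem v).1 hv) ((hadj u v).2 huv)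
  · rcases hdom v v.2 with h | ⟨u, hu, huv⟩
    · exact (hmem v).2 h
    · obtain ⟨u', v', h', rfl, h2⟩ := (SimpleGraph.map_adj _ _ _ _).1 huv
      have hvv : v' = v := Fin.valEmbedding.injective h2
      subst hvv
      exact absurd h' (hs (hle ((hmem u').2 hu)) hv h'.ne)

/-- The algorithm finds a maximal independent set. -/
lemma findsMIS_phases (hP : P.Fits) {g T : ℕ} {X t ε : ℝ} (h : IsPlacement G cap place)
    (hspace : 6 * P.verts + cap + g ≤ P.space) (ht : 0 ≤ t) (hX : P.verts * t ≤ X)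
    (hg : 11 * X ≤ g) (hT : P.verts * ((ceilRoot^[T] P.machines : ℕ) * t) ≤ g) (hT0 : 0 < T)
    (hm : (G.edgeSet.ncard : ℝ) ≤ X * P.machines)
    (hsteps : ∀ p ∈ Prog.phases T 1, P.space ^ p.weight ≤ P.steps)
    (hε : T * ((2 * P.verts + 1) * Real.exp (-t)) ≤ ε) :
    ENNReal.ofReal (1 - ε) ≤
      (run P (Prog.phases T 1) (inputConfig P place)).toOuterMeasure (FindsMIS P G) := by
  have hX0 : 0 ≤ X := le_trans (by positivity) hX
  have hlen : ∀ j, (inputConfig P place j).length ≤ cap := fun j => by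
    simpa [inputConfig] using h.1 j
  have hds : (aliveDegSum (G.map Fin.valEmbedding) P.verts ∅ : ℝ) ≤
      2 * X * ((ceilRoot^[1] P.machines : ℕ) : ℝ) ^ 2 := by
    have h1 : (aliveDegSum (G.map Fin.valEmbedding) P.verts ∅ : ℝ) ≤ 2 * G.edgeSet.ncard := by
      exact_mod_cast aliveDegSum_empty_le G
    -- The phases start at index `1`: the number of edges is at most `X * M`, and `M` is at most the
    -- square of its rounded-up root.
    have h2 := le_mul_iterate_ceilRoot (M := P.machines) 0
    simp only [Function.iterate_zero, id, zero_add] at h2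
    calc (aliveDegSum (G.map Fin.valEmbedding) P.verts ∅ : ℝ) ≤ 2 * (X * P.machines) := by linarith
      _ = 2 * X * P.machines := by ring
      _ ≤ _ := by gcongr
  have key := ensures_phases hP (E := inputConfig P place) (g := g) (T := T)
    (fun j => by have := hlen j; omega) (represents_inputConfig h) ht hX hg hT T 1 ∅
    (fun p hp => ⟨fun me inb hinb => Prog.boundedBy_of_mem_phases hP hinb T 1 p hp, hsteps p hp⟩)
    (by omega) (by simp) (by simp) hds (by omega) _ (holds_inputConfig h (by omega))
  refine PMF.ofReal_one_sub_le _ _ (hε := le_trans (by positivity) hε) (t := {r | ¬∃ cfg', r = some cfg' ∧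
    ListsMIS P (G.map Fin.valEmbedding) cfg'}) (hst := ?_) (h := key.trans ?_)
  · rintro r ⟨hr, -⟩ ⟨cfg', rfl, h'⟩
    exact hr ⟨cfg', rfl, maximal_outputSet h'⟩
  · rw [← ENNReal.ofReal_natCast, ← ENNReal.ofReal_mul (by positivity)]
    exact ENNReal.ofReal_le_ofReal hε

end Input

end MapReduce
end

noncomputable section

/-! ### Parameters -/

namespace MapReduce

lemma ceilRoot_le_sqrt_add_one {a : ℕ} {x : ℝ} (hx : 0 ≤ x) (h : (a : ℝ) ≤ x ^ 2) :
    (ceilRoot a : ℝ) ≤ x + 1 := by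
  by_contra hcon
  have h1 : ⌊x⌋₊ + 1 < ceilRoot a := by
    have h2 := Nat.floor_le hx
    have : ((⌊x⌋₊ + 1 : ℕ) : ℝ) < ceilRoot a := by push_cast; linarith
    exact_mod_cast this
  have h3 := mul_self_lt_iff_lt_ceilRoot.2 h1
  have h4 : (((⌊x⌋₊ + 1) * (⌊x⌋₊ + 1) : ℕ) : ℝ) < a := by exact_mod_cast h3
  have h5 := Nat.lt_floor_add_one x
  push_cast at h4
  nlinarith

/-- The constant `4` is stable under rounded-up roots: if `a ≤ 4 * y ^ 2` with `y ≥ 1`, then the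
root is at most `2 * y + 1 ≤ 4 * y`. -/
lemma iterate_ceilRoot_le_rpow {n M : ℕ} {c : ℝ} (hn : 1 ≤ n) (hc : 0 ≤ c)
    (hM : (M : ℝ) ≤ 4 * (n : ℝ) ^ c) (k : ℕ) :
    ((ceilRoot^[k] M : ℕ) : ℝ) ≤ 4 * (n : ℝ) ^ (c / 2 ^ k) := by
  have hn' : (1 : ℝ) ≤ n := by exact_mod_cast hn
  induction k with
  | zero => simpa using hM
  | succ k ih =>
    rw [Function.iterate_succ_apply']
    have h1 : (1 : ℝ) ≤ (n : ℝ) ^ (c / 2 ^ (k + 1)) := Real.one_le_rpow hn' (by positivity)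
    have h2 : (2 * (n : ℝ) ^ (c / 2 ^ (k + 1))) ^ 2 = 4 * (n : ℝ) ^ (c / 2 ^ k) := by
      rw [mul_pow, ← Real.rpow_natCast, ← Real.rpow_natCast, ← Real.rpow_mul (by linarith)]
      norm_num
      congr 1
      rw [pow_succ]; field_simp
    have := ceilRoot_le_sqrt_add_one (by linarith) (ih.trans h2.ge)
    linarith

lemma ceil_rpow_one_add_le {n : ℕ} {μ : ℝ} (hn : 1 ≤ n) (hμ : μ ≤ 1) :
    ⌈(n : ℝ) ^ (1 + μ)⌉₊ ≤ n ^ 2 := by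
  have hn' : (1 : ℝ) ≤ n := by exact_mod_cast hn
  rw [Nat.ceil_le]
  push_cast
  rw [← Real.rpow_natCast]
  exact Real.rpow_le_rpow_of_exponent_le hn' (by push_cast; linarith)

lemma le_ceil_rpow_one_add {n : ℕ} {μ : ℝ} (hn : 1 ≤ n) (hμ : 0 ≤ μ) :
    n ≤ ⌈(n : ℝ) ^ (1 + μ)⌉₊ := by
  have hn' : (1 : ℝ) ≤ n := by exact_mod_cast hn
  have h1 : (n : ℝ) ≤ (n : ℝ) ^ (1 + μ) := by
    conv_lhs => rw [← Real.rpow_one (n : ℝ)]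
    exact Real.rpow_le_rpow_of_exponent_le hn' (by linarith)
  exact_mod_cast h1.trans (Nat.le_ceil _)

lemma space_cluster_le {n : ℕ} {c μ : ℝ} (hn : 1 ≤ n) (hμ : μ ≤ 1) (K : ℕ) :
    (cluster n c μ 18 K).space ≤ (n + 2) ^ 7 := by
  have h1 := ceil_rpow_one_add_le hn hμ
  calc 18 * ⌈(n : ℝ) ^ (1 + μ)⌉₊ ≤ 2 ^ 5 * n ^ 2 := by gcongr; norm_num
    _ ≤ (n + 2) ^ 5 * (n + 2) ^ 2 := by gcongr <;> omega
    _ = (n + 2) ^ 7 := by ring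

lemma fits_cluster {n K : ℕ} {c μ : ℝ} (hn : 1 ≤ n) (hμ : 0 ≤ μ) (hμ1 : μ ≤ 1) (hc : c ≤ 1)
    (hK : 7 ≤ K) : (cluster n c μ 18 K).Fits := by
  have hn' : (1 : ℝ) ≤ n := by exact_mod_cast hn
  have h1 := le_ceil_rpow_one_add hn hμ
  have h2 : (n + 2) ^ 7 ≤ (n + 2) ^ K := Nat.pow_le_pow_right (by omega) hK
  refine ⟨hn, Nat.ceil_pos.2 (by positivity), ?_, ?_, (space_cluster_le hn hμ1 K).trans h2, ?_⟩
  · refine Nat.ceil_le.2 ?_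
    change (n : ℝ) ^ (c - μ) ≤ n
    conv_rhs => rw [← Real.rpow_one (n : ℝ)]
    exact Real.rpow_le_rpow_of_exponent_le hn' (by linarith)
  · change 10 + 3 * n ≤ 18 * ⌈(n : ℝ) ^ (1 + μ)⌉₊
    omega
  · refine le_trans ?_ h2
    change n * n + 3 * n + n * n ≤ (n + 2) ^ 7
    have h3 : (n + 2) ^ 3 ≤ (n + 2) ^ 7 := Nat.pow_le_pow_right (by omega) (by omega)
    nlinarith [h3]

/-- A bound for the exponents of the running times of all programs, if there are at most `T`
phases. -/
def maxWeight (T : ℕ) : ℕ := ∑ i ∈ Finset.range (T + 1), ((Prog.phases i 1).map Prog.weight).sum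

lemma weight_le_maxWeight {T i : ℕ} (hi : i ≤ T) {p : Prog} (hp : p ∈ Prog.phases i 1) :
    p.weight ≤ maxWeight T :=
  (List.le_sum_of_mem (List.mem_map_of_mem hp)).trans
    (Finset.single_le_sum (f := fun i => ((Prog.phases i 1).map Prog.weight).sum)
      (fun _ _ => Nat.zero_le _) (Finset.mem_range.2 (by omega)))

/-- The parameters are `X = n ^ (1 + μ)`, `t = n ^ (μ / 4)` and `g = 11 * ⌈n ^ (1 + μ)⌉`. Both `K`
and the error bound refer to `⌈4 / μ⌉` instead of `T`, which makes them independent of `c`. -/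
lemma findsMIS_cluster {n K T : ℕ} {c μ ε : ℝ} (hn : 1 ≤ n) (hμ : 0 < μ) (hμc : μ < c)
    (hc : c ≤ 1) (hT : 4 * c / μ ≤ T) (hT1 : T ≤ ⌈4 / μ⌉₊)
    (hK : 7 * (1 + maxWeight ⌈4 / μ⌉₊) ≤ K) {G : SimpleGraph (Fin n)}
    (hG : (G.edgeSet.ncard : ℝ) ≤ (n : ℝ) ^ (1 + c))
    {place : Fin ⌈(n : ℝ) ^ (c - μ)⌉₊ → List (Fin n × Fin n)}
    (hplace : IsPlacement G ⌈(n : ℝ) ^ (1 + μ)⌉₊ place)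
    (hε : 3 * ⌈4 / μ⌉₊ * (n : ℝ) ^ (1 : ℝ) * Real.exp (-(n : ℝ) ^ (μ / 4)) ≤ ε) :
    ENNReal.ofReal (1 - ε) ≤
      (run (cluster n c μ 18 K) (Prog.phases T 1)
        (inputConfig (cluster n c μ 18 K) place)).toOuterMeasure
        (FindsMIS (cluster n c μ 18 K) G) := by
  have hn' : (1 : ℝ) ≤ n := by exact_mod_cast hn
  have hn0 : (0 : ℝ) < n := by linarith
  have hc0 : 0 < c := hμ.trans hμc
  have hT0 : (0 : ℝ) < T := lt_of_lt_of_le (by positivity) hT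
  have hceil := Nat.le_ceil ((n : ℝ) ^ (1 + μ))
  have hle := le_ceil_rpow_one_add hn hμ.le
  refine findsMIS_phases (P := cluster n c μ 18 K) (g := 11 * ⌈(n : ℝ) ^ (1 + μ)⌉₊)
    (X := (n : ℝ) ^ (1 + μ)) (t := (n : ℝ) ^ (μ / 4))
    (fits_cluster hn hμ.le (hμc.le.trans hc) hc (by omega)) hplace ?_ (by positivity) ?_ ?_ ?_
    (by exact_mod_cast hT0) ?_ ?_ ?_
  -- The space constant is `18 = 6 + 1 + 11`: marks, own input edges, and gathered edges.
  · change 6 * n + ⌈(n : ℝ) ^ (1 + μ)⌉₊ + 11 * ⌈(n : ℝ) ^ (1 + μ)⌉₊ ≤ 18 * ⌈(n : ℝ) ^ (1 + μ)⌉₊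
    omega
  · change (n : ℝ) * (n : ℝ) ^ (μ / 4) ≤ (n : ℝ) ^ (1 + μ)
    rw [Real.rpow_add hn0, Real.rpow_one]
    gcongr
    linarith
  · push_cast
    linarith
  · change (n : ℝ) * (((ceilRoot^[T] ⌈(n : ℝ) ^ (c - μ)⌉₊ : ℕ) : ℝ) * (n : ℝ) ^ (μ / 4)) ≤
      ((11 * ⌈(n : ℝ) ^ (1 + μ)⌉₊ : ℕ) : ℝ)
    have h1 : ((⌈(n : ℝ) ^ (c - μ)⌉₊ : ℕ) : ℝ) ≤ 4 * (n : ℝ) ^ c := by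
      have h2 := (Nat.ceil_lt_add_one (show 0 ≤ (n : ℝ) ^ (c - μ) by positivity)).le
      have h3 : (n : ℝ) ^ (c - μ) ≤ (n : ℝ) ^ c :=
        Real.rpow_le_rpow_of_exponent_le hn' (by linarith)
      have h4 := Real.one_le_rpow hn' hc0.le
      linarith
    have h2 := iterate_ceilRoot_le_rpow hn hc0.le h1 T
    -- The crude bound `T < 2 ^ T` is enough, given `T ≥ 4 c / μ`.
    have h3 : c / 2 ^ T ≤ μ / 4 := by
      have h4 : (T : ℝ) < 2 ^ T := by exact_mod_cast Nat.lt_two_pow_self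
      rw [div_le_iff₀ (by positivity)]
      rw [div_le_iff₀ hμ] at hT
      nlinarith
    have h4 : (n : ℝ) ^ (c / 2 ^ T) ≤ (n : ℝ) ^ (μ / 4) := Real.rpow_le_rpow_of_exponent_le hn' h3
    have h5 : (n : ℝ) * ((n : ℝ) ^ (μ / 4) * (n : ℝ) ^ (μ / 4)) ≤ (n : ℝ) ^ (1 + μ) := by
      rw [← Real.rpow_add hn0]
      nth_rewrite 1 [← Real.rpow_one (n : ℝ)]
      rw [← Real.rpow_add hn0]
      exact Real.rpow_le_rpow_of_exponent_le hn' (by linarith)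
    calc (n : ℝ) * (((ceilRoot^[T] ⌈(n : ℝ) ^ (c - μ)⌉₊ : ℕ) : ℝ) * (n : ℝ) ^ (μ / 4))
        ≤ (n : ℝ) * (4 * (n : ℝ) ^ (μ / 4) * (n : ℝ) ^ (μ / 4)) := by gcongr; linarith
      _ = 4 * ((n : ℝ) * ((n : ℝ) ^ (μ / 4) * (n : ℝ) ^ (μ / 4))) := by ring
      _ ≤ 4 * (n : ℝ) ^ (1 + μ) := by gcongr
      _ ≤ _ := by
        have h6 : (0 : ℝ) ≤ (n : ℝ) ^ (1 + μ) := by positivity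
        push_cast
        linarith
  · change (G.edgeSet.ncard : ℝ) ≤ (n : ℝ) ^ (1 + μ) * (⌈(n : ℝ) ^ (c - μ)⌉₊ : ℕ)
    calc (G.edgeSet.ncard : ℝ) ≤ (n : ℝ) ^ (1 + c) := hG
      _ = (n : ℝ) ^ (1 + μ) * (n : ℝ) ^ (c - μ) := by rw [← Real.rpow_add hn0]; congr 1; ring
      _ ≤ _ := by gcongr; exact Nat.le_ceil _
  · intro p hp
    have h1 := weight_le_maxWeight hT1 hp
    calc (cluster n c μ 18 K).space ^ p.weight ≤ ((n + 2) ^ 7) ^ p.weight := by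
          gcongr; exact space_cluster_le hn (hμc.le.trans hc) K
      _ = (n + 2) ^ (7 * p.weight) := (pow_mul _ _ _).symm
      _ ≤ (n + 2) ^ K := Nat.pow_le_pow_right (by omega) (by nlinarith)
  · refine le_trans ?_ hε
    change (T : ℝ) * ((2 * (n : ℝ) + 1) * Real.exp (-(n : ℝ) ^ (μ / 4))) ≤ _
    have h1 : (T : ℝ) ≤ (⌈4 / μ⌉₊ : ℕ) := by exact_mod_cast hT1
    calc (T : ℝ) * ((2 * (n : ℝ) + 1) * Real.exp (-(n : ℝ) ^ (μ / 4)))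
        ≤ (⌈4 / μ⌉₊ : ℕ) * (3 * (n : ℝ) * Real.exp (-(n : ℝ) ^ (μ / 4))) := by
          gcongr; linarith
      _ = _ := by rw [Real.rpow_one]; ring

end MapReduce
end

/-! ### Assembly of the two parts -/

theorem mainTheorem4 :
    -- the MapReduce algorithm: `O(c / μ)` rounds, `O(n ^ (1 + μ))` space per machine, w.h.p.
    (∃ C₀ : ℝ, ∀ μ : ℝ, 0 < μ → ∃ (C K : ℕ) (n₀ : ℕ → ℕ), ∀ c : ℝ, μ < c → c ≤ 1 →
      ∃ alg : MapReduce.Algorithm, (alg.length : ℝ) ≤ C₀ * (c / μ) ∧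
        ∀ d n : ℕ, n₀ d ≤ n → ∀ G : SimpleGraph (Fin n),
          (G.edgeSet.ncard : ℝ) ≤ (n : ℝ) ^ (1 + c) →
          ∀ place : Fin ⌈(n : ℝ) ^ (c - μ)⌉₊ → List (Fin n × Fin n),
            MapReduce.IsPlacement G ⌈(n : ℝ) ^ (1 + μ)⌉₊ place →
            ENNReal.ofReal (1 - (n : ℝ) ^ (-(d : ℝ))) ≤
              (MapReduce.run (MapReduce.cluster n c μ C K) alg
                (MapReduce.inputConfig (MapReduce.cluster n c μ C K) place)).toOuterMeasure
                (MapReduce.FindsMIS (MapReduce.cluster n c μ C K) G)) ∧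
    -- the hungry-greedy iteration: the number of residual edges drops by `n ^ (μ / 8) / 2`, w.h.p.
    (∀ μ : ℝ, 0 < μ → ∃ n₀ : ℕ → ℕ, ∀ d n : ℕ, n₀ d ≤ n → ∀ G : SimpleGraph (Fin n),
      ∀ pick : Finset (Fin n) → Fin n, (∀ S : Finset (Fin n), S.Nonempty → pick S ∈ S) →
      ∀ I : Finset (Fin n), G.IsIndepSet (I : Set (Fin n)) →
        ENNReal.ofReal (1 - (n : ℝ) ^ (-(d : ℝ))) ≤
          (HungryGreedy.iteration G μ pick I).toOuterMeasure
            {J | I ⊆ J ∧ G.IsIndepSet (J : Set (Fin n)) ∧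
              (HungryGreedy.residualEdges G J : ℝ) ≤
                2 * (HungryGreedy.residualEdges G I : ℝ) / (n : ℝ) ^ (μ / 8)}) := by
  -- There are `7 * ⌈4 c / μ⌉ + 4 ≤ 28 c / μ + 11` rounds, and `1 ≤ c / μ` turns this into `39 c /
  -- μ`.
  refine ⟨⟨39, fun μ hμ => ?_⟩, HungryGreedy.iteration_whp⟩
  have hev : ∀ d : ℕ, ∃ n₀ : ℕ, ∀ n ≥ n₀, 1 ≤ n ∧ 3 * (⌈4 / μ⌉₊ : ℕ) * (n : ℝ) ^ (1 : ℝ) *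
      Real.exp (-(n : ℝ) ^ (μ / 4)) ≤ (n : ℝ) ^ (-(d : ℝ)) := fun d =>
    Filter.eventually_atTop.1 ((Filter.eventually_ge_atTop 1).and
      (HungryGreedy.eventually_mul_exp_neg_rpow_le (by positivity) _ 1 d))
  choose n₀ hn₀ using hev
  refine ⟨18, 7 * (1 + MapReduce.maxWeight ⌈4 / μ⌉₊), n₀, fun c hμc hc =>
    ⟨MapReduce.Prog.phases ⌈4 * c / μ⌉₊ 1, ?_, fun d n hn G hG place hplace => ?_⟩⟩
  · have h1 : 1 ≤ c / μ := (one_le_div hμ).2 hμc.le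
    have h2 := Nat.ceil_lt_add_one (show 0 ≤ 4 * c / μ by
      have := hμ.trans hμc; positivity)
    rw [mul_div_assoc] at h2 ⊢
    rw [MapReduce.Prog.length_phases]
    push_cast
    linarith
  · refine MapReduce.findsMIS_cluster (hn₀ d n hn).1 hμ hμc hc (Nat.le_ceil _) ?_ le_rfl hG hplace
      (hn₀ d n hn).2
    gcongr
    linarith
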